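/- **Conventions.** Trees are finite, planar and rooted; each vertex has a finite ordered list of $k\ge 0$ inputs ("is $k$-ary"); the trivial tree $\mathsf{u}$ (one edge, no vertex) is allowed. For a family of sets $X=(X(n))_{n\in\mathbb N}$ let $T_2X(n)$ be the set of trees with $n$ leaves in which every $k$-ary vertex carries a label in $X(k)$. Grafting/substitution of trees makes $T_2$ a cartesian monad on $\mathbf{Set}/\mathbb N$ (the free non-symmetric operad monad). A *$T_2$-multicategory* $V$ consists of sets $V_0(n)$ of objects over $n$ and $V_1(n)$ of arrows over $n$, each arrow having a domain in $T_2V_0(n)$ and a codomain in $V_0(n)$, with identities (the domain of $1_x$ is the one-vertex tree labelled $x$) and composition of an arrow with a tree of arrows whose codomains form its domain, associative and unital. $T_2\text{-}\mathbf{Multicat}$ is the category of $T_2$-multicategories and maps preserving all this structure. A *$T_2$-structured category* is a category object in the category of $T_2$-algebras; it has an underlying $T_2$-multicategory, in which an arrow from a tree $D$ of objects to $x$ is an arrow from the object obtained by acting on $D$ to $x$; interchanging source and target gives its opposite. Let $\mathbf{TR}$ be the $T_2$-structured category of trees, the free one on the terminal $T_2$-multicategory: the objects of the category $\mathbf{TR}(n)$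 are the unlabelled trees with $n$ leaves; a map $\tau'\to\tau$ is a labelling of each $k$-ary vertex of $\tau$ by a tree with $k$ leaves such that $\tau'$ is the result of substituting these trees for the vertices of $\tau$; and $T_2$ acts by substitution. Write $\tau\circ(\tau_1,\dots,\tau_n)$, $\phi\circ(\phi_1,\dots,\phi_n)$ for grafting of trees and of maps of trees. Let $\mathbf{Set}$ also denote the $T_2$-multicategory in which an object over any $n$ is a set and an arrow from a tree $D$ of sets to $X$ is a function to $X$ from the product of the sets labelling the vertices of $D$. **Enriched plain multicategories.** Let $V$ be a $T_2$-multicategory. A *plain multicategory $C$ enriched in $V$* is a set $C_0$ together with: for all $a_1,\dots,a_n,a\in C_0$, an object $C[a_1,\dots,a_n;a]$ of $V$ over $n$; and for each pasting diagram $D$ over $C_0$ (a tree whose edges are labelled by elements of $C_0$) with input edges labelled $a_1,\dots,a_n$ and output edge labelled $a$, an arrow $\kappa_D$ of $V$ whose codomain is $C[a_1,\dots,a_n;a]$ and whose domain is the underlying tree of $D$ with each vertex, of input edges $b_1,\dots,b_k$ and output edge $b$, labelled by $C[b_1,\dots,b_k;b]$; such that $\kappa$ takes one-vertex diagrams to identities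 and substitution of diagrams to composition. (That is, a map $MI(C_0)\to V$.) **Relaxed multicategories.** A *relaxed multicategory* $C$ consists of a set $C_0$; for $\tau\in\mathbf{TR}(n)$ and $a_1,\dots,a_n,a\in C_0$, a set $C_\tau[a_1,\dots,a_n;a]$; for each map $\phi:\tau'\to\tau$ in $\mathbf{TR}(n)$, functions $C_\tau[a_1,\dots,a_n;a]\to C_{\tau'}[a_1,\dots,a_n;a]$, $f\mapsto f.\phi$; for $\tau\in\mathbf{TR}(n)$ and $\tau_i\in\mathbf{TR}(k_i)$, composition functions $$C_{\tau_1}[a_1^1,\dots,a_1^{k_1};a_1]\times\cdots\times C_{\tau_n}[a_n^1,\dots,a_n^{k_n};a_n]\times C_\tau[a_1,\dots,a_n;a]\to C_{\tau\circ(\tau_1,\dots,\tau_n)}[a_1^1,\dots,a_n^{k_n};a],$$ written $(f_1,\dots,f_n,f)\mapsto f\circ(f_1,\dots,f_n)$; and for each $a\in C_0$ an element $1_a\in C_{\mathsf u}[a;a]$; such that $f.(\phi\circ\phi')=(f.\phi).\phi'$ and $f.1=f$; composition is associative and the $1_a$ are two-sided identities for it; and $(f\circ(f_1,\dots,f_n)).(\phi\circ(\phi_1,\dots,\phi_n))=(f.\phi)\circ(f_1.\phi_1,\dots,f_n.\phi_n)$.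 **Theorem.** (i) The exponential $[\mathbf{TR}^{\mathrm{op}},\mathbf{Set}]$, with its evaluation $\mathrm{ev}:[\mathbf{TR}^{\mathrm{op}},\mathbf{Set}]\times\mathbf{TR}^{\mathrm{op}}\to\mathbf{Set}$, exists in $T_2\text{-}\mathbf{Multicat}$. (ii) A plain multicategory enriched in $[\mathbf{TR}^{\mathrm{op}},\mathbf{Set}]$ is the same thing as a relaxed multicategory. Precisely, for every choice of the exponential, there is a bijection from plain multicategories enriched in $[\mathbf{TR}^{\mathrm{op}},\mathbf{Set}]$ to relaxed multicategories which sends an enriched plain multicategory $C$ to the relaxed multicategory with the same objects $C_0$ such that: $C_\tau[a_1,\dots,a_n;a]$ is the value $\mathrm{ev}(C[a_1,\dots,a_n;a],\tau)$; for $\phi:\tau'\to\tau$ the function $f\mapsto f.\phi$ is the value of $\mathrm{ev}$ at the identity of $C[a_1,\dots,a_n;a]$ and $\phi$ (seen as an arrow $\tau\to\tau'$ of $\mathbf{TR}^{\mathrm{op}}$); composition is the value of $\mathrm{ev}$ at $\kappa_D$, for $D$ the two-level diagram that has a root vertex with inputs $a_1,\dots,a_n$ and output $a$ and, above each $a_i$,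 a vertex with inputs $a_i^1,\dots,a_i^{k_i}$, and at the arrow of $\mathbf{TR}^{\mathrm{op}}$, with domain the two-level tree with vertices labelled $\tau,\tau_1,\dots,\tau_n$, given by the identity of $\tau\circ(\tau_1,\dots,\tau_n)$; and $1_a$ is the value of $\mathrm{ev}$ at $\kappa$ of the trivial diagram at $a$ and the identity of $\mathsf u$. -/

import Mathlib

universe u v v' w w' z z'

namespace Relaxed

/-! ## Trees, and the free plain multicategory monad on families of sets indexed by `ℕ` -/

/-- Finite planar trees in which every vertex with `n` incoming edges carries a label in `X n`.
`leaf` is the trivial tree: one edge and no vertex. -/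
inductive Tr (X : ℕ → Type u) : Type u
  | leaf : Tr X
  | node (n : ℕ) (x : X n) (c : Fin n → Tr X) : Tr X

namespace Tr
variable {X : ℕ → Type u} {Y : ℕ → Type v} {Z : ℕ → Type w}

/-- The number of input edges of a tree. -/
def leaves : Tr X → ℕ
  | leaf => 1
  | node _ _ c => ∑ i, (c i).leaves

/-- Relabel the vertices of a tree. -/
def map (f : ∀ ⦃n⦄, X n → Y n) : Tr X → Tr Y
  | leaf => leaf
  | node n x c => node n (f x) fun i => (c i).map f

theorem leaves_map (f : ∀ ⦃n⦄, X n → Y n) (t : Tr X) : (t.map f).leaves = t.leaves := by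
  induction t with
  | leaf => rfl
  | node n x c ih => simp [map, leaves, ih]

/-- Graft one tree on each input edge of `t`. The input edges of `node n x d` are numbered by
running through those of `d 0`, then those of `d 1`, and so on. -/
def graft : (t : Tr X) → (Fin t.leaves → Tr X) → Tr X
  | leaf, c => c (0 : Fin 1)
  | node n x d, c => node n x fun i => (d i).graft fun j => c (finSigmaFinEquiv ⟨i, j⟩)

theorem leaves_graft (t : Tr X) (c : Fin t.leaves → Tr X) :
    (t.graft c).leaves = ∑ i, (c i).leaves := by
  induction t with
  | leaf => exact (Fin.sum_univ_one (fun i : Fin 1 => (c i).leaves)).symm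
  | node n x d ih =>
    simp only [graft, leaves, ih]
    rw [← Fintype.sum_sigma']
    exact finSigmaFinEquiv.sum_comp (fun i : Fin (∑ i, (d i).leaves) => (c i).leaves)

theorem sum_prefix {N : ℕ} (p : Fin N) (f : Fin N → ℕ) :
    ∑ x : Fin p.val, f (Fin.castLE p.isLt.le x) = ∑ y : Fin N, if y < p then f y else 0 := by
  rw [← Finset.sum_filter]
  refine Finset.sum_bij (fun x _ => Fin.castLE p.isLt.le x) ?_ ?_ ?_ ?_
  · intro x _
    exact Finset.mem_filter.2 ⟨Finset.mem_univ _, x.isLt⟩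
  · intro x _ y _ h
    simpa [Fin.ext_iff] using h
  · intro y hy
    simp only [Finset.mem_filter, Finset.mem_univ, true_and] at hy
    exact ⟨⟨y.val, hy⟩, Finset.mem_univ _, rfl⟩
  · intro x _
    rfl

theorem finSigma_val {n : ℕ} (k : Fin n → ℕ) (i : Fin n) (j : Fin (k i)) :
    (finSigmaFinEquiv (⟨i, j⟩ : (i : Fin n) × Fin (k i))).val =
      (∑ y, if y < i then k y else 0) + j.val := by
  rw [finSigmaFinEquiv_apply, ← sum_prefix i k]

theorem finSigma_lt_of_lt {n : ℕ} {k : Fin n → ℕ} {i i' : Fin n} (h : i' < i)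
    (j : Fin (k i)) (j' : Fin (k i')) :
    (finSigmaFinEquiv ⟨i', j'⟩ : Fin (∑ i, k i)) < finSigmaFinEquiv ⟨i, j⟩ := by
  rw [Fin.lt_def, finSigmaFinEquiv_apply, finSigmaFinEquiv_apply]
  simp only
  rw [sum_prefix i' k, sum_prefix i k]
  have : (∑ y, if y < i' then k y else 0) + k i' ≤ ∑ y, if y < i then k y else 0 := by
    have e : k i' = ∑ y, if y = i' then k y else 0 := by simp
    rw [e, ← Finset.sum_add_distrib]
    refine Finset.sum_le_sum fun y _ => ?_
    by_cases h1 : y < i'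
    · simp [h1, h1.ne, h1.trans h]
    · by_cases h2 : y = i'
      · subst h2; simp [h]
      · simp [h1, h2]
  have := j'.isLt
  omega

theorem finSigma_lt_iff {n : ℕ} {k : Fin n → ℕ} {i i' : Fin n}
    (j : Fin (k i)) (j' : Fin (k i')) :
    (finSigmaFinEquiv ⟨i', j'⟩ : Fin (∑ i, k i)) < finSigmaFinEquiv ⟨i, j⟩ ↔
      i' < i ∨ (i' = i ∧ j'.val < j.val) := by
  rcases lt_trichotomy i' i with h | h | h
  · simp [h, finSigma_lt_of_lt h]
  · subst h
    rw [Fin.lt_def, finSigmaFinEquiv_apply, finSigmaFinEquiv_apply]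
    simp
  · have := finSigma_lt_of_lt h j' j
    simp only [h.not_gt, h.ne', false_and, or_self, iff_false, not_lt]
    exact this.le

theorem finSigma_assoc {n : ℕ} {k : Fin n → ℕ} (m : Fin (∑ i, k i) → ℕ) (i : Fin n)
    (j : Fin (k i)) (l : Fin (m (finSigmaFinEquiv ⟨i, j⟩))) :
    (finSigmaFinEquiv (⟨finSigmaFinEquiv ⟨i, j⟩, l⟩ : (p : Fin (∑ i, k i)) × Fin (m p))).val =
      (finSigmaFinEquiv (n := fun i => ∑ j, m (finSigmaFinEquiv ⟨i, j⟩))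
        ⟨i, finSigmaFinEquiv (n := fun j => m (finSigmaFinEquiv ⟨i, j⟩)) ⟨j, l⟩⟩).val := by
  rw [finSigma_val m, finSigma_val (fun i => ∑ j, m (finSigmaFinEquiv ⟨i, j⟩)),
    finSigma_val (fun j => m (finSigmaFinEquiv ⟨i, j⟩)), ← finSigmaFinEquiv.sum_comp,
    Fintype.sum_sigma, ← add_assoc]
  congr 1
  have e : (∑ y : Fin (k i), if y < j then m (finSigmaFinEquiv ⟨i, y⟩) else 0) =
      ∑ x : Fin n, if h : x = i then
        (∑ y : Fin (k x), if y.val < j.val then m (finSigmaFinEquiv ⟨x, y⟩) else 0) else 0 := by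
    refine Eq.symm ((Finset.sum_eq_single i ?_ ?_).trans ?_)
    · intro b _ hb; simp [hb]
    · simp
    · simp
  rw [e, ← Finset.sum_add_distrib]
  refine Finset.sum_congr rfl fun x _ => ?_
  simp only [finSigma_lt_iff]
  by_cases h : x < i
  · simp [h, h.ne]
  · by_cases h' : x = i
    · subst h'; simp
    · simp [h, h']

theorem graft_congr {t t' : Tr X} (h : t = t') {c : Fin t.leaves → Tr X}
    {c' : Fin t'.leaves → Tr X} (hc : ∀ i j, i.val = j.val → c i = c' j) :
    t.graft c = t'.graft c' := by
  subst h
  congr 1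
  funext i
  exact hc i i rfl

theorem map_id (t : Tr X) : t.map (fun _ x => x) = t := by
  induction t with
  | leaf => rfl
  | node n x c ih => simp [map, ih]

theorem map_map (f : ∀ ⦃n⦄, X n → Y n) (g : ∀ ⦃n⦄, Y n → Z n) (t : Tr X) :
    (t.map f).map g = t.map fun _ x => g (f x) := by
  induction t with
  | leaf => rfl
  | node n x c ih => simp [map, ih]

/-- Positions in a sum only depend on the values of the summands. -/
theorem finSigma_congr {n : ℕ} {k k' : Fin n → ℕ} (h : ∀ i, k i = k' i) (i : Fin n)
    (j : Fin (k i)) (j' : Fin (k' i)) (hj : j.val = j'.val) :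
    (finSigmaFinEquiv (⟨i, j⟩ : (i : Fin n) × Fin (k i))).val =
      (finSigmaFinEquiv (⟨i, j'⟩ : (i : Fin n) × Fin (k' i))).val := by
  obtain rfl : k = k' := funext h
  obtain rfl : j = j' := Fin.ext hj
  rfl

theorem map_graft (f : ∀ ⦃n⦄, X n → Y n) (t : Tr X) (c : Fin t.leaves → Tr X) :
    (t.graft c).map f =
      (t.map f).graft fun i => (c (Fin.cast (leaves_map f t) i)).map f := by
  induction t with
  | leaf => rfl
  | node n x d ih =>
    simp only [graft, map, ih]
    congr 1
    funext i
    refine graft_congr rfl fun j j' hj => ?_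
    congr 2
    refine Fin.ext ?_
    exact finSigma_congr (fun i => (leaves_map f (d i)).symm) i _ _ hj

theorem graft_graft (t : Tr X) (c : Fin t.leaves → Tr X)
    (d : Fin (t.graft c).leaves → Tr X) :
    (t.graft c).graft d = t.graft fun i => (c i).graft fun j =>
      d (Fin.cast (leaves_graft t c).symm (finSigmaFinEquiv ⟨i, j⟩)) := by
  induction t with
  | leaf =>
    refine graft_congr rfl fun i j hij => ?_
    congr 1
    refine Fin.ext ?_
    simp [finSigmaFinEquiv_apply, hij]
  | node n x e ih =>
    simp only [graft, ih]
    congr 1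
    funext i
    refine graft_congr rfl fun j j' hj => ?_
    obtain rfl := Fin.ext hj
    refine graft_congr rfl fun l l' hl => ?_
    obtain rfl := Fin.ext hl
    congr 1
    refine Fin.ext ?_
    refine Eq.trans ?_ (finSigma_assoc (fun p => (c p).leaves) i j l).symm
    exact finSigma_congr (fun i => leaves_graft (e i) _) i _ _ rfl

theorem graft_leaf (t : Tr X) : (t.graft fun _ => leaf) = t := by
  induction t with
  | leaf => rfl
  | node n x d ih => simp [graft, ih]

end Tr

/-- `T X n` is the set of trees with `n` input edges whose `k`-ary vertices are labelled in `X k`,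
i.e. the `n`-ary operations of the free plain multicategory (non-symmetric operad) on `X`.
With `T.map`, `T.unit`, `T.mul` below this is the cartesian monad `T₂` on families over `ℕ`. -/
abbrev T (X : ℕ → Type u) (n : ℕ) : Type u := {t : Tr X // t.leaves = n}

/-- Substitute, for every vertex, the tree which is its label. -/
def Tr.flat {X : ℕ → Type u} : Tr (T X) → Tr X
  | leaf => leaf
  | node _ x c => x.1.graft fun i => (c (Fin.cast x.2 i)).flat

namespace Tr
variable {X : ℕ → Type u} {Y : ℕ → Type v}

theorem leaves_flat (t : Tr (T X)) : t.flat.leaves = t.leaves := by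
  induction t with
  | leaf => rfl
  | node n x c ih =>
    obtain ⟨t, rfl⟩ := x
    simp [flat, leaves, leaves_graft, ih]

theorem node_inj {n : ℕ} {x x' : X n} {c c' : Fin n → Tr X} (h : node n x c = node n x' c') :
    x = x' ∧ c = c' := by
  injection h with _ h1 h2
  exact ⟨h1, h2⟩

theorem map_eq_node {f : ∀ ⦃n⦄, X n → Y n} {q : Tr X} {n : ℕ} {y : Y n} {c : Fin n → Tr Y}
    (h : q.map f = node n y c) :
    ∃ x d, q = node n x d ∧ f x = y ∧ ∀ i, (d i).map f = c i := by
  cases q with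
  | leaf => cases h
  | node m x d =>
    obtain rfl : m = n := by injection h
    obtain ⟨h1, h2⟩ := node_inj h
    exact ⟨x, d, rfl, h1, fun i => congrFun h2 i⟩

theorem map_eq_leaf {f : ∀ ⦃n⦄, X n → Y n} {q : Tr X} (h : q.map f = leaf) : q = leaf := by
  cases q with
  | leaf => rfl
  | node m x d => cases h

theorem split (f : ∀ ⦃n⦄, X n → Y n) (t : Tr Y) (c : Fin t.leaves → Tr Y) (q : Tr X)
    (h : q.map f = t.graft c) :
    ∃ (t' : Tr X) (c' : Fin t'.leaves → Tr X), t'.map f = t ∧ q = t'.graft c' ∧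
      ∀ i j, i.val = j.val → (c' i).map f = c j := by
  induction t generalizing q with
  | leaf =>
    exact ⟨leaf, fun _ => q, rfl, rfl, fun i j _ =>
      h.trans (congrArg c (Subsingleton.elim (α := Fin 1) 0 j))⟩
  | node n y d ih =>
    obtain ⟨x, e, rfl, rfl, he⟩ := map_eq_node h
    choose t' c' h1 h2 h3 using fun i => ih i _ (e i) (he i)
    refine ⟨node n x t', fun p => c' (finSigmaFinEquiv.symm p).1 (finSigmaFinEquiv.symm p).2,
      ?_, ?_, ?_⟩
    · simp [map, h1]
    · simp only [graft]
      congr 1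
      funext i
      rw [h2 i]
      refine graft_congr rfl fun j j' hj => ?_
      obtain rfl := Fin.ext hj
      exact congrArg (fun s : (i : Fin n) × Fin (t' i).leaves => c' s.1 s.2)
        (finSigmaFinEquiv.symm_apply_apply ⟨i, j⟩).symm
    · intro p p' hp
      obtain ⟨⟨i, j⟩, rfl⟩ := finSigmaFinEquiv.surjective p
      refine (congrArg (fun s : (i : Fin n) × Fin (t' i).leaves => (c' s.1 s.2).map f)
        (finSigmaFinEquiv.symm_apply_apply ⟨i, j⟩)).trans ?_
      simp only
      have hl : (d i).leaves = (t' i).leaves := by rw [← h1 i, leaves_map]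
      rw [h3 i j (Fin.cast hl.symm j) rfl]
      congr 1
      refine Fin.ext ?_
      rw [← hp]
      exact finSigma_congr (fun i => by rw [← h1 i, leaves_map]) i _ _ rfl

theorem graft_inj (f : ∀ ⦃n⦄, X n → Y n) (t t' : Tr X) (c : Fin t.leaves → Tr X)
    (c' : Fin t'.leaves → Tr X) (ht : t.map f = t'.map f) (h : t.graft c = t'.graft c') :
    t = t' ∧ ∀ i j, i.val = j.val → c i = c' j := by
  induction t generalizing t' with
  | leaf =>
    obtain rfl := map_eq_leaf ht.symm
    refine ⟨rfl, fun i j _ => ?_⟩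
    obtain rfl : i = (0 : Fin 1) := Subsingleton.elim (α := Fin 1) _ _
    obtain rfl : j = (0 : Fin 1) := Subsingleton.elim (α := Fin 1) _ _
    exact h
  | node n x d ih =>
    obtain ⟨x', d', rfl, -, hd⟩ := map_eq_node ht.symm
    obtain ⟨rfl, h2⟩ := node_inj h
    have key := fun i => ih i (d' i) _ _ (hd i).symm (congrFun h2 i)
    obtain rfl : d = d' := funext fun i => (key i).1
    refine ⟨rfl, fun p p' hp => ?_⟩
    obtain rfl := Fin.ext hp
    obtain ⟨⟨i, j⟩, rfl⟩ := finSigmaFinEquiv.surjective p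
    exact (key i).2 j j rfl

theorem flat_graft (t : Tr (T X)) (d : Fin t.leaves → Tr (T X)) :
    (t.graft d).flat =
      t.flat.graft fun i => (d (Fin.cast (leaves_flat t) i)).flat := by
  induction t with
  | leaf => rfl
  | node n x e ih =>
    obtain ⟨t, rfl⟩ := x
    simp only [graft, flat, ih, graft_graft]
    refine graft_congr rfl fun i i' hi => ?_
    obtain rfl := Fin.ext hi
    refine graft_congr rfl fun j j' hj => ?_
    obtain rfl := Fin.ext hj
    congr 2
    refine Fin.ext ?_
    exact finSigma_congr (fun i => (leaves_flat (e i)).symm) i _ _ rfl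

theorem flat_map (f : ∀ ⦃n⦄, X n → Y n) (t : Tr (T X)) :
    t.flat.map f =
      (t.map fun _ x => (⟨x.1.map f, (leaves_map f x.1).trans x.2⟩ : T Y _)).flat := by
  induction t with
  | leaf => rfl
  | node n x c ih =>
    obtain ⟨t, rfl⟩ := x
    simp only [flat, map, map_graft, ih]
    rfl

theorem flat_flat (t : Tr (T (T X))) :
    t.flat.flat =
      (t.map fun _ x => (⟨x.1.flat, (leaves_flat x.1).trans x.2⟩ : T X _)).flat := by
  induction t with
  | leaf => rfl
  | node n x c ih =>
    obtain ⟨t, rfl⟩ := x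
    simp only [flat, map, flat_graft, ih]
    rfl

theorem flat_node_leaf (n : ℕ) (x : T X n) :
    (node n x fun _ => leaf).flat = x.1 := graft_leaf _

theorem leaves_node_leaf (n : ℕ) (x : X n) : (node n x fun _ => leaf).leaves = n := by
  simp [leaves]

theorem flat_map_unit (t : Tr X) :
    (t.map fun n x => (⟨node n x fun _ => leaf, leaves_node_leaf n x⟩ : T X n)).flat = t := by
  induction t with
  | leaf => rfl
  | node n x c ih =>
    simp only [flat, map, graft, ih]
    congr 1
    funext i
    congr 1
    refine Fin.ext ?_
    refine (finSigmaFinEquiv_apply _).trans ?_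
    simp [leaves]

end Tr

namespace T
variable {X : ℕ → Type u} {Y : ℕ → Type v} {Z : ℕ → Type w}

/-- The functor `T`. -/
def map (f : ∀ ⦃n⦄, X n → Y n) ⦃n : ℕ⦄ (t : T X n) : T Y n :=
  ⟨t.1.map f, (Tr.leaves_map f t.1).trans t.2⟩

/-- The unit of `T`: the tree with one vertex. -/
def unit ⦃n : ℕ⦄ (x : X n) : T X n :=
  ⟨Tr.node n x fun _ => Tr.leaf, Tr.leaves_node_leaf n x⟩

/-- The multiplication of `T`: substitution of the trees labelling the vertices. -/
def mul ⦃n : ℕ⦄ (t : T (T X) n) : T X n :=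
  ⟨t.1.flat, (Tr.leaves_flat t.1).trans t.2⟩

theorem map_id {n : ℕ} (t : T X n) : map (fun _ x => x) t = t :=
  Subtype.ext (Tr.map_id t.1)

theorem map_map (f : ∀ ⦃n⦄, X n → Y n) (g : ∀ ⦃n⦄, Y n → Z n) {n : ℕ} (t : T X n) :
    map g (map f t) = map (fun _ x => g (f x)) t :=
  Subtype.ext (Tr.map_map f g t.1)

theorem eq_map_map {k : ∀ ⦃n⦄, X n → Z n} {f : ∀ ⦃n⦄, X n → Y n} {g : ∀ ⦃n⦄, Y n → Z n}
    (h : ∀ ⦃n⦄ (x : X n), k x = g (f x)) {n : ℕ} (t : T X n) : map k t = map g (map f t) := by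
  rw [map_map]
  congr 1
  funext n x
  exact h x

theorem map_unit (f : ∀ ⦃n⦄, X n → Y n) {n : ℕ} (x : X n) : map f (unit x) = unit (f x) := rfl

theorem map_mul (f : ∀ ⦃n⦄, X n → Y n) {n : ℕ} (t : T (T X) n) :
    map f (mul t) = mul (map (map f) t) :=
  Subtype.ext (Tr.flat_map f t.1)

theorem mul_mul {n : ℕ} (t : T (T (T X)) n) : mul (mul t) = mul (map mul t) :=
  Subtype.ext (Tr.flat_flat t.1)

theorem mul_unit {n : ℕ} (t : T X n) : mul (unit t) = t :=
  Subtype.ext (Tr.flat_node_leaf n t)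

theorem mul_map_unit {n : ℕ} (t : T X n) : mul (map unit t) = t :=
  Subtype.ext (Tr.flat_map_unit t.1)

variable {A : ℕ → Type u} {B : ℕ → Type v} {Y : ℕ → Type w}

theorem exists_split (f : ∀ ⦃n⦄, A n → B n) (d : ∀ ⦃n⦄, Y n → T B n) (Θ : Tr Y) (q : Tr A)
    (h : q.map f = (Θ.map d).flat) :
    ∃ Z : Tr (fun m => {z : Y m × T A m // map f z.2 = d z.1}),
      Z.map (fun _ z => z.1.1) = Θ ∧ (Z.map fun _ z => z.1.2).flat = q := by
  induction Θ generalizing q with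
  | leaf => exact ⟨Tr.leaf, rfl, (Tr.map_eq_leaf h).symm⟩
  | node n y c ih =>
    obtain ⟨t', c', h1, rfl, h3⟩ := Tr.split f _ _ q h
    have hl : t'.leaves = n := by rw [← Tr.leaves_map f t', h1, (d y).2]
    choose Z hZ1 hZ2 using fun i => ih i (c' (Fin.cast hl.symm i)) (h3 _ (Fin.cast (d y).2.symm i) rfl)
    refine ⟨Tr.node n ⟨(y, ⟨t', hl⟩), Subtype.ext h1⟩ Z, ?_, ?_⟩
    · simp [Tr.map, hZ1]
    · simp only [Tr.map, Tr.flat, hZ2]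
      rfl

theorem split_unique (f : ∀ ⦃n⦄, A n → B n) (d : ∀ ⦃n⦄, Y n → T B n)
    (Z Z' : Tr (fun m => {z : Y m × T A m // map f z.2 = d z.1}))
    (h : Z.map (fun _ z => z.1.1) = Z'.map fun _ z => z.1.1)
    (h' : (Z.map fun _ z => z.1.2).flat = (Z'.map fun _ z => z.1.2).flat) : Z = Z' := by
  induction Z generalizing Z' with
  | leaf => exact (Tr.map_eq_leaf h.symm).symm
  | node n z c ih =>
    obtain ⟨z', c', rfl, hz, hc⟩ := Tr.map_eq_node h.symm
    obtain ⟨⟨y, t⟩, ht⟩ := z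
    obtain ⟨⟨y', t'⟩, ht'⟩ := z'
    obtain rfl : y' = y := hz
    obtain ⟨h1, h2⟩ := Tr.graft_inj f t.1 t'.1 _ _
      (congrArg Subtype.val (ht.trans ht'.symm)) h'
    obtain rfl : t = t' := Subtype.ext h1
    have : c = c' := by
      funext i
      refine ih i (c' i) (hc i).symm ?_
      exact h2 (Fin.cast t.2.symm i) (Fin.cast t.2.symm i) rfl
    rw [this]

/-- The multiplication of `T` is cartesian. -/
theorem existsUnique_split (f : ∀ ⦃n⦄, A n → B n) (d : ∀ ⦃n⦄, Y n → T B n) {n : ℕ}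
    (Θ : T Y n) (q : T A n) (h : map f q = mul (map d Θ)) :
    ∃! Z : T (fun m => {z : Y m × T A m // map f z.2 = d z.1}) n,
      map (fun _ z => z.1.1) Z = Θ ∧ mul (map (fun _ z => z.1.2) Z) = q := by
  obtain ⟨Z, h1, h2⟩ := exists_split f d Θ.1 q.1 (congrArg Subtype.val h)
  refine ⟨⟨Z, ?_⟩, ⟨Subtype.ext h1, Subtype.ext h2⟩, ?_⟩
  · rw [← Θ.2, ← h1, Tr.leaves_map]
  · rintro Z' ⟨h1', h2'⟩
    refine Subtype.ext (split_unique f d _ _ ?_ ?_)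
    · exact (congrArg Subtype.val h1').trans h1.symm
    · exact (congrArg Subtype.val h2').trans h2.symm

end T

/-- A `T`-multicategory, for the cartesian monad `T` on families over `ℕ` above: a graph
`T Obj ← Arr → Obj` over `ℕ`, with identities and with the composite `comp Θ g` of an arrow `g` and
a tree `Θ` of arrows whose codomains form the domain of `g`. In `assoc`, `Ω` is a tree of composable
pairs; the equations `h₁ h₂ h₃` only say that the composites make sense and follow from one another. -/
structure T2Multicat where
  Obj : ℕ → Type u
  Arr : ℕ → Type v
  dom : ∀ ⦃n⦄, Arr n → T Obj n
  cod : ∀ ⦃n⦄, Arr n → Obj n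
  id : ∀ ⦃n⦄, Obj n → Arr n
  comp : ∀ ⦃n⦄ (Θ : T Arr n) (g : Arr n), T.map cod Θ = dom g → Arr n
  dom_id : ∀ {n} (x : Obj n), dom (id x) = T.unit x
  cod_id : ∀ {n} (x : Obj n), cod (id x) = x
  dom_comp : ∀ {n} (Θ : T Arr n) (g : Arr n) (h : T.map cod Θ = dom g),
    dom (comp Θ g h) = T.mul (T.map dom Θ)
  cod_comp : ∀ {n} (Θ : T Arr n) (g : Arr n) (h : T.map cod Θ = dom g),
    cod (comp Θ g h) = cod g
  id_comp : ∀ {n} (f : Arr n) (h : T.map cod (T.unit f) = dom (id (cod f))),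
    comp (T.unit f) (id (cod f)) h = f
  comp_id : ∀ {n} (f : Arr n) (h : T.map cod (T.map id (dom f)) = dom f),
    comp (T.map id (dom f)) f h = f
  assoc : ∀ {n} (Ω : T (fun m => {p : T Arr m × Arr m // T.map cod p.1 = dom p.2}) n)
    (g : Arr n)
    (h₁ : T.map cod (T.map (fun _ p => comp p.1.1 p.1.2 p.2) Ω) = dom g)
    (h₂ : T.map cod (T.map (fun _ p => p.1.2) Ω) = dom g)
    (h₃ : T.map cod (T.mul (T.map (fun _ p => p.1.1) Ω)) =
      dom (comp (T.map (fun _ p => p.1.2) Ω) g h₂)),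
    comp (T.map (fun _ p => comp p.1.1 p.1.2 p.2) Ω) g h₁ =
      comp (T.mul (T.map (fun _ p => p.1.1) Ω)) (comp (T.map (fun _ p => p.1.2) Ω) g h₂) h₃

namespace T2Multicat

/-- Maps of `T`-multicategories. -/
@[ext]
structure Hom (C : T2Multicat.{u, v}) (D : T2Multicat.{w, w'}) where
  obj : ∀ ⦃n⦄, C.Obj n → D.Obj n
  arr : ∀ ⦃n⦄, C.Arr n → D.Arr n
  dom_arr : ∀ {n} (f : C.Arr n), D.dom (arr f) = T.map obj (C.dom f)
  cod_arr : ∀ {n} (f : C.Arr n), D.cod (arr f) = obj (C.cod f)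
  arr_id : ∀ {n} (x : C.Obj n), arr (C.id x) = D.id (obj x)
  arr_comp : ∀ {n} (Θ : T C.Arr n) (g : C.Arr n) (h : T.map C.cod Θ = C.dom g)
    (h' : T.map D.cod (T.map arr Θ) = D.dom (arr g)),
    arr (C.comp Θ g h) = D.comp (T.map arr Θ) (arr g) h'

theorem comp_congr (C : T2Multicat.{u, v}) {n : ℕ} {Θ Θ' : T C.Arr n} {g g' : C.Arr n}
    (h1 : Θ = Θ') (h2 : g = g') (h : T.map C.cod Θ = C.dom g) (h' : T.map C.cod Θ' = C.dom g') :
    C.comp Θ g h = C.comp Θ' g' h' := by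
  subst h1 h2; rfl

theorem assoc_map (C : T2Multicat.{u, v}) {I : ℕ → Type w} {n : ℕ} (W : T I n)
    (Θ : ∀ ⦃m⦄, I m → T C.Arr m) (k : ∀ ⦃m⦄, I m → C.Arr m)
    (e : ∀ ⦃m⦄ (i : I m), T.map C.cod (Θ i) = C.dom (k i)) (g : C.Arr n)
    (h₁ : T.map C.cod (T.map (fun _ i => C.comp (Θ i) (k i) (e i)) W) = C.dom g)
    (h₂ : T.map C.cod (T.map k W) = C.dom g)
    (h₃ : T.map C.cod (T.mul (T.map Θ W)) = C.dom (C.comp (T.map k W) g h₂)) :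
    C.comp (T.map (fun _ i => C.comp (Θ i) (k i) (e i)) W) g h₁ =
      C.comp (T.mul (T.map Θ W)) (C.comp (T.map k W) g h₂) h₃ := by
  have := C.assoc (T.map (fun m i => (⟨(Θ i, k i), e i⟩ :
    {p : T C.Arr m × C.Arr m // T.map C.cod p.1 = C.dom p.2})) W) g
  simp only [T.map_map] at this
  simp only [T.map_map] at h₁ h₂
  exact this h₁ h₂ h₃

/-- Composition of maps, `G` after `F`. -/
def Hom.comp {C : T2Multicat.{u, v}} {D : T2Multicat.{w, w'}} {E : T2Multicat.{z, z'}}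
    (G : Hom D E) (F : Hom C D) : Hom C E where
  obj _ x := G.obj (F.obj x)
  arr _ f := G.arr (F.arr f)
  dom_arr f := by rw [G.dom_arr, F.dom_arr, T.map_map]
  cod_arr f := by rw [G.cod_arr, F.cod_arr]
  arr_id x := by rw [F.arr_id, G.arr_id]
  arr_comp Θ g h h' := by
    have e : T.map D.cod (T.map F.arr Θ) = D.dom (F.arr g) := by
      rw [T.map_map, F.dom_arr, ← h, T.map_map]
      simp only [F.cod_arr]
    have e' : T.map E.cod (T.map G.arr (T.map F.arr Θ)) = E.dom (G.arr (F.arr g)) := by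
      rw [T.map_map F.arr G.arr]; exact h'
    rw [F.arr_comp Θ g h e, G.arr_comp _ _ e e']
    exact comp_congr _ (T.map_map _ _ _) rfl _ _

/-- The identity map. -/
def Hom.id (C : T2Multicat.{u, v}) : Hom C C where
  obj _ x := x
  arr _ f := f
  dom_arr _ := (T.map_id _).symm
  cod_arr _ := rfl
  arr_id _ := rfl
  arr_comp _ _ _ _ := comp_congr _ (T.map_id _).symm rfl _ _

/-- An arrow of the product `C × D`: a tree of pairs of objects, with an arrow of `C` and an arrow
of `D` whose domains are the two projections of that tree. -/
@[ext]
structure ProdArr (C : T2Multicat.{u, v}) (D : T2Multicat.{w, w'}) (n : ℕ) where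
  dom : T (fun m => C.Obj m × D.Obj m) n
  fst : C.Arr n
  snd : D.Arr n
  dom_fst : T.map (fun _ x => x.1) dom = C.dom fst
  dom_snd : T.map (fun _ x => x.2) dom = D.dom snd

theorem ProdArr.map_cod_fst {C : T2Multicat.{u, v}} {D : T2Multicat.{w, w'}} {n : ℕ}
    (Θ : T (ProdArr C D) n) (g : ProdArr C D n)
    (h : T.map (fun _ p => (C.cod p.fst, D.cod p.snd)) Θ = g.dom) :
    T.map C.cod (T.map (fun _ p => p.fst) Θ) = C.dom g.fst := by
  rw [← g.dom_fst, ← h, T.map_map, T.map_map]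

/-- The binary product in the category of `T`-multicategories. -/
def prod (C : T2Multicat.{u, v}) (D : T2Multicat.{w, w'}) :
    T2Multicat.{max u w, max u v w w'} where
  Obj n := C.Obj n × D.Obj n
  Arr n := ProdArr C D n
  dom _ p := p.dom
  cod _ p := (C.cod p.fst, D.cod p.snd)
  id _ x :=
    { dom := T.unit x
      fst := C.id x.1
      snd := D.id x.2
      dom_fst := (C.dom_id _).symm
      dom_snd := (D.dom_id _).symm }
  comp _ Θ g h :=
    { dom := T.mul (T.map (fun _ p => p.dom) Θ)
      fst := C.comp (T.map (fun _ p => p.fst) Θ) g.fst (by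
        rw [← g.dom_fst, ← h, T.map_map, T.map_map])
      snd := D.comp (T.map (fun _ p => p.snd) Θ) g.snd (by
        rw [← g.dom_snd, ← h, T.map_map, T.map_map])
      dom_fst := by
        simp only [C.dom_comp, T.map_mul, T.map_map, ProdArr.dom_fst]
      dom_snd := by
        simp only [D.dom_comp, T.map_mul, T.map_map, ProdArr.dom_snd] }
  dom_id _ := rfl
  cod_id x := Prod.ext (C.cod_id _) (D.cod_id _)
  dom_comp _ _ _ := rfl
  cod_comp _ _ _ := Prod.ext (C.cod_comp _ _ _) (D.cod_comp _ _ _)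
  id_comp f h := by
    ext1
    · exact T.mul_unit f.dom
    · exact C.id_comp f.fst _
    · exact D.id_comp f.snd _
  comp_id f h := by
    ext1
    · simp only [T.map_map]
      exact T.mul_map_unit f.dom
    · refine (comp_congr C ?_ rfl _ ?_).trans (C.comp_id f.fst ?_)
      · simp only [T.map_map, ← f.dom_fst]
      all_goals simp only [T.map_map, C.cod_id]; exact T.map_id _
    · refine (comp_congr D ?_ rfl _ ?_).trans (D.comp_id f.snd ?_)
      · simp only [T.map_map, ← f.dom_snd]
      all_goals simp only [T.map_map, D.cod_id]; exact T.map_id _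
  assoc {n} Ω g h₁ h₂ h₃ := by
    ext1
    · simp only [T.map_mul, T.map_map, T.mul_mul]
    · simp only [T.map_mul, T.map_map]
      exact C.assoc_map Ω (fun _ p => T.map (fun _ q => q.fst) p.1.1) (fun _ p => p.1.2.fst)
        (fun _ p => by rw [← p.1.2.dom_fst, ← p.2, T.map_map, T.map_map]) g.fst _ _ _
    · simp only [T.map_mul, T.map_map]
      exact D.assoc_map Ω (fun _ p => T.map (fun _ q => q.snd) p.1.1) (fun _ p => p.1.2.snd)
        (fun _ p => by rw [← p.1.2.dom_snd, ← p.2, T.map_map, T.map_map]) g.snd _ _ _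

/-- The map `F × D`. -/
def prodMap {C : T2Multicat.{u, v}} {C' : T2Multicat.{w, w'}} (F : Hom C C')
    (D : T2Multicat.{z, z'}) : Hom (C.prod D) (C'.prod D) where
  obj _ x := (F.obj x.1, x.2)
  arr _ p :=
    { dom := T.map (fun _ x => (F.obj x.1, x.2)) p.dom
      fst := F.arr p.fst
      snd := p.snd
      dom_fst := by rw [F.dom_arr, ← p.dom_fst, T.map_map, T.map_map]
      dom_snd := by rw [← p.dom_snd, T.map_map] }
  dom_arr _ := rfl
  cod_arr p := Prod.ext (F.cod_arr _) rfl
  arr_id x := ProdArr.ext rfl (F.arr_id _) rfl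
  arr_comp Θ g h h' := by
    have k := ProdArr.map_cod_fst Θ g h
    refine ProdArr.ext ?_ ?_ ?_
    · refine (T.map_mul _ _).trans ?_
      refine congrArg (@T.mul _ _) ?_
      refine (T.map_map _ _ _).trans ?_
      apply T.eq_map_map
      intros; rfl
    · refine (F.arr_comp _ _ k ?_).trans (comp_congr C' ?_ rfl _ _)
      · rw [F.dom_arr, ← k]
        simp only [T.map_map, F.cod_arr]
      · refine (T.map_map _ _ _).trans ?_
        apply T.eq_map_map
        intros; rfl
    · refine comp_congr D ?_ rfl _ _
      apply T.eq_map_map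
      intros; rfl

end T2Multicat

/-- A `T`-structured category: a category object in the category of `T`-algebras. For each `n` there
is a category with objects `Obj n` and arrows `Arr n`; `act` and `actArr` are `T`-algebra structures
on objects and arrows with which source, target, identities and composition are compatible.
Here `comp g f` is `g` after `f`. -/
structure StrucCat where
  Obj : ℕ → Type u
  Arr : ℕ → Type v
  src : ∀ ⦃n⦄, Arr n → Obj n
  tgt : ∀ ⦃n⦄, Arr n → Obj n
  id : ∀ ⦃n⦄, Obj n → Arr n
  comp : ∀ ⦃n⦄ (g f : Arr n), tgt f = src g → Arr n
  src_id : ∀ {n} (x : Obj n), src (id x) = x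
  tgt_id : ∀ {n} (x : Obj n), tgt (id x) = x
  src_comp : ∀ {n} (g f : Arr n) (h : tgt f = src g), src (comp g f h) = src f
  tgt_comp : ∀ {n} (g f : Arr n) (h : tgt f = src g), tgt (comp g f h) = tgt g
  id_comp : ∀ {n} (f : Arr n) (h : tgt f = src (id (tgt f))), comp (id (tgt f)) f h = f
  comp_id : ∀ {n} (f : Arr n) (h : tgt (id (src f)) = src f), comp f (id (src f)) h = f
  assoc : ∀ {n} (k g f : Arr n) (h₁ : tgt g = src k) (h₂ : tgt f = src g)
    (h₃ : tgt (comp g f h₂) = src k) (h₄ : tgt f = src (comp k g h₁)),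
    comp k (comp g f h₂) h₃ = comp (comp k g h₁) f h₄
  act : ∀ ⦃n⦄, T Obj n → Obj n
  actArr : ∀ ⦃n⦄, T Arr n → Arr n
  act_unit : ∀ {n} (x : Obj n), act (T.unit x) = x
  act_mul : ∀ {n} (D : T (T Obj) n), act (T.mul D) = act (T.map act D)
  actArr_unit : ∀ {n} (f : Arr n), actArr (T.unit f) = f
  actArr_mul : ∀ {n} (Φ : T (T Arr) n), actArr (T.mul Φ) = actArr (T.map actArr Φ)
  src_actArr : ∀ {n} (Φ : T Arr n), src (actArr Φ) = act (T.map src Φ)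
  tgt_actArr : ∀ {n} (Φ : T Arr n), tgt (actArr Φ) = act (T.map tgt Φ)
  actArr_id : ∀ {n} (D : T Obj n), actArr (T.map id D) = id (act D)
  actArr_comp : ∀ {n} (Ω : T (fun m => {p : Arr m × Arr m // tgt p.2 = src p.1}) n)
    (h : tgt (actArr (T.map (fun _ p => p.1.2) Ω)) = src (actArr (T.map (fun _ p => p.1.1) Ω))),
    actArr (T.map (fun _ p => comp p.1.1 p.1.2 p.2) Ω) =
      comp (actArr (T.map (fun _ p => p.1.1) Ω)) (actArr (T.map (fun _ p => p.1.2) Ω)) h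

namespace StrucCat

theorem comp_congr (𝒯 : StrucCat.{u, v}) {n : ℕ} {g g' f f' : 𝒯.Arr n}
    (h1 : g = g') (h2 : f = f') (h : 𝒯.tgt f = 𝒯.src g) (h' : 𝒯.tgt f' = 𝒯.src g') :
    𝒯.comp g f h = 𝒯.comp g' f' h' := by
  subst h1 h2; rfl

theorem actArr_comp_map (𝒯 : StrucCat.{u, v}) {I : ℕ → Type w} {n : ℕ} (W : T I n)
    (g f : ∀ ⦃m⦄, I m → 𝒯.Arr m) (e : ∀ ⦃m⦄ (i : I m), 𝒯.tgt (f i) = 𝒯.src (g i))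
    (h : 𝒯.tgt (𝒯.actArr (T.map f W)) = 𝒯.src (𝒯.actArr (T.map g W))) :
    𝒯.actArr (T.map (fun _ i => 𝒯.comp (g i) (f i) (e i)) W) =
      𝒯.comp (𝒯.actArr (T.map g W)) (𝒯.actArr (T.map f W)) h := by
  have := 𝒯.actArr_comp (T.map (fun m i => (⟨(g i, f i), e i⟩ :
    {p : 𝒯.Arr m × 𝒯.Arr m // 𝒯.tgt p.2 = 𝒯.src p.1})) W)
  simp only [T.map_map] at this
  exact this h

/-- The opposite structured category: source and target are interchanged. -/
def op (𝒯 : StrucCat.{u, v}) : StrucCat.{u, v} where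
  Obj := 𝒯.Obj
  Arr := 𝒯.Arr
  src := 𝒯.tgt
  tgt := 𝒯.src
  id := 𝒯.id
  comp _ g f h := 𝒯.comp f g h.symm
  src_id := 𝒯.tgt_id
  tgt_id := 𝒯.src_id
  src_comp g f h := 𝒯.tgt_comp f g h.symm
  tgt_comp g f h := 𝒯.src_comp f g h.symm
  id_comp f h := 𝒯.comp_id f h.symm
  comp_id f h := 𝒯.id_comp f h.symm
  assoc k g f h₁ h₂ h₃ h₄ := (𝒯.assoc f g k h₂.symm h₁.symm h₄.symm h₃.symm).symm
  act := 𝒯.act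
  actArr := 𝒯.actArr
  act_unit := 𝒯.act_unit
  act_mul := 𝒯.act_mul
  actArr_unit := 𝒯.actArr_unit
  actArr_mul := 𝒯.actArr_mul
  src_actArr := 𝒯.tgt_actArr
  tgt_actArr := 𝒯.src_actArr
  actArr_id := 𝒯.actArr_id
  actArr_comp Ω h := by
    have e := 𝒯.actArr_comp (T.map (fun m p => (⟨(p.1.2, p.1.1), p.2.symm⟩ :
      {p : 𝒯.Arr m × 𝒯.Arr m // 𝒯.tgt p.2 = 𝒯.src p.1})) Ω)
    simp only [T.map_map] at e
    exact e h.symm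

/-- An arrow of the underlying `T`-multicategory of `𝒯`: a tree `dom` of objects, and an arrow of
`𝒯` from the action of that tree to some object. -/
@[ext]
structure MultiArr (𝒯 : StrucCat.{u, v}) (n : ℕ) where
  dom : T 𝒯.Obj n
  arr : 𝒯.Arr n
  src_arr : 𝒯.src arr = 𝒯.act dom

/-- The underlying `T`-multicategory of a `T`-structured category. -/
def toMulticat (𝒯 : StrucCat.{u, v}) : T2Multicat.{u, max u v} where
  Obj := 𝒯.Obj
  Arr := 𝒯.MultiArr
  dom _ p := p.dom
  cod _ p := 𝒯.tgt p.arr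
  id _ x :=
    { dom := T.unit x
      arr := 𝒯.id x
      src_arr := (𝒯.src_id x).trans (𝒯.act_unit x).symm }
  comp _ Θ g h :=
    { dom := T.mul (T.map (fun _ p => p.dom) Θ)
      arr := 𝒯.comp g.arr (𝒯.actArr (T.map (fun _ p => p.arr) Θ)) (by
        rw [𝒯.tgt_actArr, g.src_arr, ← h, T.map_map])
      src_arr := by
        simp only [𝒯.src_comp, 𝒯.src_actArr, 𝒯.act_mul, T.map_map, MultiArr.src_arr] }
  dom_id _ := rfl
  cod_id x := 𝒯.tgt_id x
  dom_comp _ _ _ := rfl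
  cod_comp _ _ _ := 𝒯.tgt_comp _ _ _
  id_comp f h := by
    ext1
    · exact T.mul_unit f.dom
    · exact (𝒯.comp_congr rfl (𝒯.actArr_unit f.arr) _ (𝒯.src_id _).symm).trans (𝒯.id_comp _ _)
  comp_id f h := by
    ext1
    · simp only [T.map_map]
      exact T.mul_map_unit f.dom
    · refine (𝒯.comp_congr rfl ?_ _ (𝒯.tgt_id _)).trans (𝒯.comp_id f.arr _)
      simp only [T.map_map, f.src_arr, ← 𝒯.actArr_id]
  assoc Ω g h₁ h₂ h₃ := by
    ext1
    · simp only [T.map_mul, T.map_map, T.mul_mul]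
    · simp only [T.map_map, T.map_mul, 𝒯.actArr_mul]
      have e : ∀ ⦃m⦄ (p : {p : T 𝒯.MultiArr m × 𝒯.MultiArr m //
          T.map (fun _ q => 𝒯.tgt q.arr) p.1 = p.2.dom}),
          𝒯.tgt (𝒯.actArr (T.map (fun _ q => q.arr) p.1.1)) = 𝒯.src p.1.2.arr := fun m p => by
        rw [𝒯.tgt_actArr, p.1.2.src_arr, ← p.2, T.map_map]
      have e' : 𝒯.tgt (𝒯.actArr (T.map (fun _ p => 𝒯.actArr (T.map (fun _ q => q.arr) p.1.1)) Ω)) =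
          𝒯.src (𝒯.actArr (T.map (fun _ p => p.1.2.arr) Ω)) := by
        simp only [𝒯.tgt_actArr, 𝒯.src_actArr, T.map_map]
        congr 2
        funext m p
        rw [p.1.2.src_arr, ← p.2]
      have k := 𝒯.actArr_comp_map Ω (fun _ p => p.1.2.arr)
        (fun _ p => 𝒯.actArr (T.map (fun _ q => q.arr) p.1.1)) e e'
      refine (𝒯.comp_congr rfl k _ ?_).trans (𝒯.assoc _ _ _ _ _ _ _)
      all_goals
        rw [𝒯.tgt_comp, 𝒯.tgt_actArr, g.src_arr, ← h₂]
        simp only [T.map_map]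

end StrucCat

namespace TR

theorem exists_comp {n : ℕ} (g f : T (T fun _ => Unit) n)
    (h : T.map (fun _ _ => ()) f = T.mul g) :
    ∃! Z : T (fun m => {z : T (fun _ => Unit) m × T (T fun _ => Unit) m //
        T.map (fun _ _ => ()) z.2 = z.1}) n,
      T.map (fun _ z => z.1.1) Z = g ∧ T.mul (T.map (fun _ z => z.1.2) Z) = f :=
  T.existsUnique_split (fun _ _ => ()) (fun _ t => t) g f (by rw [T.map_id]; exact h)

/-- Composition of tree maps. `g` is a tree of trees, `f` is a tree of trees of shape `mul g`; so `f`
comes from a unique tree `Z` of pairs: a vertex label `s` of `g` and a tree of trees of shape `s`.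
The composite replaces each label of `g` by the result of the substitution in that pair. -/
noncomputable def comp {n : ℕ} (g f : T (T fun _ => Unit) n)
    (h : T.map (fun _ _ => ()) f = T.mul g) : T (T fun _ => Unit) n :=
  T.map (fun _ z => T.mul z.1.2) (exists_comp g f h).choose

theorem comp_eq {n : ℕ} {g f : T (T fun _ => Unit) n} (h : T.map (fun _ _ => ()) f = T.mul g)
    (Z : T (fun m => {z : T (fun _ => Unit) m × T (T fun _ => Unit) m //
        T.map (fun _ _ => ()) z.2 = z.1}) n)
    (h1 : T.map (fun _ z => z.1.1) Z = g) (h2 : T.mul (T.map (fun _ z => z.1.2) Z) = f) :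
    comp g f h = T.map (fun _ z => T.mul z.1.2) Z := by
  unfold comp
  rw [(exists_comp g f h).choose_spec.2 Z ⟨h1, h2⟩]

theorem comp_eq_map {I : ℕ → Type u} {n : ℕ} {g f : T (T fun _ => Unit) n}
    (h : T.map (fun _ _ => ()) f = T.mul g) (W : T I n)
    (a : ∀ ⦃m⦄, I m → T (fun _ => Unit) m) (b : ∀ ⦃m⦄, I m → T (T fun _ => Unit) m)
    (e : ∀ ⦃m⦄ (i : I m), T.map (fun _ _ => ()) (b i) = a i)
    (h1 : T.map a W = g) (h2 : T.mul (T.map b W) = f) :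
    comp g f h = T.map (fun _ i => T.mul (b i)) W := by
  rw [comp_eq h (T.map (fun m i => ⟨(a i, b i), e i⟩) W) (by rw [T.map_map]; exact h1)
    (by rw [T.map_map]; exact h2), T.map_map]

end TR

/-- The structured category of trees, i.e. the free `T`-structured category on the terminal
`T`-multicategory. An object over `n` is a tree `τ` with `n` leaves. An arrow `τ' ⟶ τ` of `TR(n)` is a
tree `τ` each of whose `k`-ary vertices is labelled by a tree with `k` leaves, where `τ'` is the
result of substituting these trees for the vertices; so it exhibits `τ` as obtained from `τ'` by
contracting some subtrees (possibly trivial ones) to single vertices. `T` acts by substitution. -/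
noncomputable def TR : StrucCat.{0, 0} where
  Obj := T fun _ => Unit
  Arr := T (T fun _ => Unit)
  src := T.mul
  tgt := T.map fun _ _ => ()
  id := T.map T.unit
  comp _ g f h := TR.comp g f h
  src_id x := T.mul_map_unit x
  tgt_id x := (T.map_map _ _ x).trans (T.map_id x)
  src_comp g f h := by
    obtain ⟨Z, ⟨h1, h2⟩, -⟩ := TR.exists_comp g f h
    rw [TR.comp_eq h Z h1 h2, ← h2, T.mul_mul, T.map_map]
  tgt_comp g f h := by
    obtain ⟨Z, ⟨h1, h2⟩, -⟩ := TR.exists_comp g f h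
    rw [TR.comp_eq h Z h1 h2, ← h1, T.map_map, T.map_map]
  id_comp f h := by
    rw [TR.comp_eq_map h f (fun _ _ => T.unit ()) (fun _ x => T.unit x) (fun _ _ => rfl)
      (by rw [T.map_map]) (T.mul_map_unit f)]
    simp only [T.mul_unit]
    exact T.map_id f
  comp_id g h := by
    rw [TR.comp_eq_map h g (fun _ s => s) (fun _ s => T.map T.unit s)
      (fun _ s => (T.map_map _ _ s).trans (T.map_id s)) (T.map_id g) (T.map_mul _ _).symm]
    simp only [T.mul_map_unit]
    exact T.map_id g
  assoc k g f h₁ h₂ h₃ h₄ := by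
    obtain ⟨Z, ⟨a1, a2⟩, -⟩ := TR.exists_comp k g h₁
    obtain ⟨Y, ⟨b1, b2⟩, -⟩ := TR.exists_comp g f h₂
    obtain ⟨W, ⟨c1, c2⟩, -⟩ := T.existsUnique_split (fun _ y => y.1.1) (fun _ z => z.1.2) Z Y
      (b1.trans a2.symm)
    have e1 := TR.comp_eq h₂ Y b1 b2
    have e2 := TR.comp_eq h₁ Z a1 a2
    rw [TR.comp_eq_map h₃ W (fun _ w => w.1.1.1.1)
      (fun _ w => T.map (fun _ y => T.mul y.1.2) w.1.2)
      (fun m w => by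
        rw [T.map_map, ← w.1.1.2, ← w.2, T.map_map])
      (by rw [← a1, ← c1, T.map_map])
      (by rw [e1, ← c2, T.map_mul, T.map_map]),
      TR.comp_eq_map h₄ W (fun _ w => T.mul w.1.1.1.2)
      (fun _ w => T.mul (T.map (fun _ y => y.1.2) w.1.2))
      (fun m w => by
        rw [T.map_mul, T.map_map]
        refine congrArg (@T.mul _ _) ?_
        refine Eq.trans ?_ w.2
        congr 1
        funext m y
        exact y.2)
      (by rw [e2, ← c1, T.map_map])
      (by rw [← b2, ← c2, T.map_mul, T.mul_mul, T.map_map, T.map_map])]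
    simp only [T.mul_mul, T.map_map]
  act := T.mul
  actArr := T.mul
  act_unit := T.mul_unit
  act_mul := T.mul_mul
  actArr_unit := T.mul_unit
  actArr_mul := T.mul_mul
  src_actArr := T.mul_mul
  tgt_actArr Φ := T.map_mul _ Φ
  actArr_id D := (T.map_mul _ D).symm
  actArr_comp Ω h := by
    choose Z hZ _ using fun m (p : {p : T (T fun _ => Unit) m × T (T fun _ => Unit) m //
      T.map (fun _ _ => ()) p.2 = T.mul p.1}) => TR.exists_comp p.1.1 p.1.2 p.2
    rw [TR.comp_eq h (T.mul (T.map Z Ω))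
      (by rw [T.map_mul, T.map_map]; simp only [(hZ _ _).1])
      (by rw [T.map_mul, T.map_map, T.mul_mul, T.map_map]; simp only [(hZ _ _).2])]
    rw [T.map_mul, T.map_map]
    congr 2
    funext m p
    exact TR.comp_eq p.2 (Z m p) (hZ m p).1 (hZ m p).2

/-- A set with an element of it. -/
abbrev Pointed (_ : ℕ) : Type (u + 1) := Σ X : Type u, X

/-- An element of the product, over the vertices of `D`, of the sets labelling them: a tree of
pointed sets lying over `D`. -/
abbrev Elements {n : ℕ} (D : T (fun _ => Type u) n) : Type (u + 1) :=
  {p : T Pointed.{u} n // T.map (fun _ x => x.1) p = D}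

/-- A function to the set `cod` from the product of the sets labelling the vertices of `dom`. -/
structure SetArr (n : ℕ) : Type (u + 1) where
  dom : T (fun _ => Type u) n
  cod : Type u
  fn : Elements dom → cod

namespace SetArr

theorem ext_fn {n : ℕ} {a b : SetArr.{u} n} (hd : a.dom = b.dom) (hc : a.cod = b.cod)
    (hf : ∀ p hp hp', a.fn ⟨p, hp⟩ ≍ b.fn ⟨p, hp'⟩) : a = b := by
  obtain ⟨D, X, f⟩ := a
  obtain ⟨D', X', f'⟩ := b
  dsimp only at hd hc
  subst hd hc
  congr 1
  funext p
  exact eq_of_heq (hf p.1 p.2 p.2)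

theorem exists_unit {n : ℕ} {X : Type u} (p : T Pointed.{u} n)
    (h : T.map (fun _ x => x.1) p = T.unit X) : ∃ x : X, p = T.unit ⟨X, x⟩ := by
  obtain ⟨⟨Y, y⟩, d, hd, hY, hc⟩ := Tr.map_eq_node (congrArg Subtype.val h)
  dsimp only at hY
  subst hY
  refine ⟨y, Subtype.ext (hd.trans ?_)⟩
  have : d = fun _ => Tr.leaf := funext fun i => Tr.map_eq_leaf (hc i)
  rw [this]
  rfl

/-- The identity function of `X`, the product over the one vertex of `T.unit X`. -/
noncomputable def id {n : ℕ} (X : Type u) : SetArr.{u} n where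
  dom := T.unit X
  cod := X
  fn p := (exists_unit p.1 p.2).choose

theorem id_fn {n : ℕ} (X : Type u) (x : X) (h) :
    (id (n := n) X).fn ⟨T.unit ⟨X, x⟩, h⟩ = x := by
  have e : (T.unit ⟨X, x⟩ : T Pointed.{u} n) = _ :=
    (exists_unit (T.unit ⟨X, x⟩ : T Pointed.{u} n) h).choose_spec
  have e1 := (Tr.node_inj (congrArg Subtype.val e)).1
  have e2 := eq_of_heq (Sigma.mk.inj e1).2
  exact e2.symm

theorem exists_split {n : ℕ} (Θ : T SetArr.{u} n) (p : Elements (T.mul (T.map (fun _ f => f.dom) Θ))) :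
    ∃! Z : T (fun m => {z : SetArr.{u} m × T Pointed.{u} m //
        T.map (fun _ x => x.1) z.2 = z.1.dom}) n,
      T.map (fun _ z => z.1.1) Z = Θ ∧ T.mul (T.map (fun _ z => z.1.2) Z) = p.1 :=
  T.existsUnique_split (fun _ x => x.1) (fun _ f => f.dom) Θ p.1 p.2

/-- Split an element of the product of all the domains of a tree of functions into one element of
each domain, and apply the functions. -/
noncomputable def evalAll {n : ℕ} (Θ : T SetArr.{u} n)
    (p : Elements (T.mul (T.map (fun _ f => f.dom) Θ))) : Elements (T.map (fun _ f => f.cod) Θ) :=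
  ⟨T.map (fun _ z => ⟨z.1.1.cod, z.1.1.fn ⟨z.1.2, z.2⟩⟩) (exists_split Θ p).choose, by
    have h := (exists_split Θ p).choose_spec.1.1
    refine Eq.trans ?_ (congrArg (T.map (fun _ (f : SetArr _) => f.cod) ·) h)
    rw [T.map_map, T.map_map]⟩

theorem evalAll_eq {I : ℕ → Type v} {n : ℕ} (W : T I n) (θ : ∀ ⦃m⦄, I m → SetArr.{u} m)
    (q : ∀ ⦃m⦄, I m → T Pointed.{u} m)
    (e : ∀ ⦃m⦄ (i : I m), T.map (fun _ x => x.1) (q i) = (θ i).dom)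
    (Θ : T SetArr.{u} n) (p : Elements (T.mul (T.map (fun _ f => f.dom) Θ)))
    (h1 : T.map θ W = Θ) (h2 : T.mul (T.map q W) = p.1) :
    (evalAll Θ p).1 = T.map (fun _ i => ⟨(θ i).cod, (θ i).fn ⟨q i, e i⟩⟩) W := by
  have h := (exists_split Θ p).choose_spec.2 (T.map (fun m i => ⟨(θ i, q i), e i⟩) W)
    ⟨by rw [T.map_map]; exact h1, by rw [T.map_map]; exact h2⟩
  unfold evalAll
  dsimp only
  rw [← h, T.map_map]

/-- The composite of `g` with a tree `Θ` of functions. -/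
noncomputable def comp {n : ℕ} (Θ : T SetArr.{u} n) (g : SetArr.{u} n)
    (h : T.map (fun _ f => f.cod) Θ = g.dom) : SetArr.{u} n where
  dom := T.mul (T.map (fun _ f => f.dom) Θ)
  cod := g.cod
  fn p := g.fn ⟨(evalAll Θ p).1, (evalAll Θ p).2.trans h⟩

theorem fn_congr {n : ℕ} (g : SetArr.{u} n) {p q : T Pointed.{u} n} (h : p = q)
    (hp : T.map (fun _ x => x.1) p = g.dom) (hq : T.map (fun _ x => x.1) q = g.dom) :
    g.fn ⟨p, hp⟩ = g.fn ⟨q, hq⟩ := by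
  subst h; rfl

theorem comp_assoc {n : ℕ}
    (Ω : T (fun m => {p : T SetArr.{u} m × SetArr.{u} m //
      T.map (fun _ f => f.cod) p.1 = p.2.dom}) n) (g : SetArr.{u} n)
    (h₁ : T.map (fun _ f => f.cod) (T.map (fun _ p => comp p.1.1 p.1.2 p.2) Ω) = g.dom)
    (h₂ : T.map (fun _ f => f.cod) (T.map (fun _ p => p.1.2) Ω) = g.dom)
    (h₃ : T.map (fun _ f => f.cod) (T.mul (T.map (fun _ p => p.1.1) Ω)) =
      (comp (T.map (fun _ p => p.1.2) Ω) g h₂).dom) :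
    comp (T.map (fun _ p => comp p.1.1 p.1.2 p.2) Ω) g h₁ =
      comp (T.mul (T.map (fun _ p => p.1.1) Ω)) (comp (T.map (fun _ p => p.1.2) Ω) g h₂) h₃ := by
  have hd : T.mul (T.map (fun _ f => f.dom) (T.map (fun _ p => comp p.1.1 p.1.2 p.2) Ω)) =
      T.mul (T.map (fun _ p => T.mul (T.map (fun _ f => f.dom) p.1.1)) Ω) := by
    rw [T.map_map]; rfl
  refine ext_fn ?_ rfl fun p hp hp' => heq_of_eq ?_
  · refine hd.trans ?_
    change _ = T.mul (T.map (fun _ f => f.dom) (T.mul (T.map (fun _ p => p.1.1) Ω)))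
    rw [T.map_mul, T.mul_mul, T.map_map, T.map_map]
  obtain ⟨W, ⟨w1, w2⟩, -⟩ := T.existsUnique_split (fun _ x => x.1)
    (fun _ p => T.mul (T.map (fun _ f => f.dom) p.1.1)) Ω p (hp.trans hd)
  let P : Elements (T.mul (T.map (fun _ f => f.dom)
    (T.map (fun _ p => comp p.1.1 p.1.2 p.2) Ω))) := ⟨p, hp⟩
  let P' : Elements (T.mul (T.map (fun _ f => f.dom) (T.mul (T.map (fun _ p => p.1.1) Ω)))) :=
    ⟨p, hp'⟩
  have eL := evalAll_eq W (fun _ w => comp w.1.1.1.1 w.1.1.1.2 w.1.1.2) (fun _ w => w.1.2)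
    (fun _ w => w.2) (T.map (fun _ p => comp p.1.1 p.1.2 p.2) Ω) P
    (by rw [← w1, T.map_map]) w2
  have eI := evalAll_eq (T.mul (T.map (fun _ w => (exists_split w.1.1.1.1 ⟨w.1.2, w.2⟩).choose) W))
    (fun _ z => z.1.1) (fun _ z => z.1.2) (fun _ z => z.2)
    (T.mul (T.map (fun _ p => p.1.1) Ω)) P'
    (by
      rw [T.map_mul, T.map_map, ← w1, T.map_map]
      congr 2
      funext m w
      exact (exists_split w.1.1.1.1 ⟨w.1.2, w.2⟩).choose_spec.1.1)
    (by
      rw [T.map_mul, T.mul_mul, T.map_map, T.map_map]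
      refine Eq.trans ?_ w2
      congr 2
      funext m w
      exact (exists_split w.1.1.1.1 ⟨w.1.2, w.2⟩).choose_spec.1.2)
  have eI' := (eI.trans (T.map_mul _ _)).trans (congrArg (@T.mul _ _) (T.map_map _ _ _))
  let R : Elements (T.mul (T.map (fun _ f => f.dom) (T.map (fun _ p => p.1.2) Ω))) :=
    ⟨(evalAll (T.mul (T.map (fun _ p => p.1.1) Ω)) P').1, (evalAll _ P').2.trans h₃⟩
  have eR := evalAll_eq W (fun _ w => w.1.1.1.2)
    (fun _ w => (evalAll w.1.1.1.1 ⟨w.1.2, w.2⟩).1)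
    (fun _ w => (evalAll w.1.1.1.1 ⟨w.1.2, w.2⟩).2.trans w.1.1.2)
    (T.map (fun _ p => p.1.2) Ω) R
    (by rw [← w1, T.map_map]) (by exact eI'.symm)
  exact fn_congr g (eL.trans eR.symm) _ _

theorem comp_unit_id {n : ℕ} (f : SetArr.{u} n)
    (h : T.map (fun _ f => f.cod) (T.unit f) = (id (n := n) f.cod).dom) :
    comp (T.unit f) (id f.cod) h = f := by
  refine ext_fn (T.mul_unit f.dom) rfl fun p hp hp' => heq_of_eq ?_
  have e := evalAll_eq (I := fun m => {z : SetArr.{u} m × T Pointed.{u} m //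
      T.map (fun _ x => x.1) z.2 = z.1.dom})
    (T.unit ⟨(f, p), hp'⟩) (fun _ z => z.1.1) (fun _ z => z.1.2) (fun _ z => z.2)
    (T.unit f) ⟨p, hp⟩ rfl (T.mul_unit p)
  exact (fn_congr (id f.cod) e _ rfl).trans (id_fn f.cod (f.fn ⟨p, hp'⟩) rfl)

theorem comp_map_id {n : ℕ} (f : SetArr.{u} n)
    (h : T.map (fun _ f => f.cod) (T.map (fun _ X => id X) f.dom) = f.dom) :
    comp (T.map (fun _ X => id X) f.dom) f h = f := by
  have hd : T.mul (T.map (fun _ f => f.dom) (T.map (fun _ X => id X) f.dom)) = f.dom := by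
    rw [T.map_map]; exact T.mul_map_unit _
  refine ext_fn hd rfl fun p hp hp' => heq_of_eq ?_
  have e := evalAll_eq p (fun _ x => id x.1) (fun _ x => T.unit x) (fun _ _ => rfl)
    (T.map (fun _ X => id X) f.dom) ⟨p, hp⟩ (by rw [← hp', T.map_map]) (T.mul_map_unit p)
  refine fn_congr f (e.trans ?_) _ _
  refine Eq.trans ?_ (T.map_id p)
  congr 1
  funext m x
  exact Sigma.ext rfl (heq_of_eq (id_fn x.1 x.2 rfl))

end SetArr

/-- The `T`-multicategory `Set` given by the monoidal category of sets under `×`: an object over any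
`n` is a set, an arrow `D ⟶ X` is a function to `X` from the product, over the vertices of the tree
`D`, of the sets labelling them; composition and identities are those of functions. -/
noncomputable def SetT2 : T2Multicat.{u + 1, u + 1} where
  Obj _ := Type u
  Arr := SetArr
  dom _ f := f.dom
  cod _ f := f.cod
  id _ X := SetArr.id X
  comp _ Θ g h := SetArr.comp Θ g h
  dom_id _ := rfl
  cod_id _ := rfl
  dom_comp _ _ _ := rfl
  cod_comp _ _ _ := rfl
  id_comp f h := SetArr.comp_unit_id f h
  comp_id f h := SetArr.comp_map_id f h
  assoc Ω g h₁ h₂ h₃ := SetArr.comp_assoc Ω g h₁ h₂ h₃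

/-- Concatenate a list of lists. -/
def concat {A : Type u} {n : ℕ} {k : Fin n → ℕ} (bs : ∀ i, Fin (k i) → A) :
    Fin (∑ i, k i) → A :=
  fun p => bs (finSigmaFinEquiv.symm p).1 (finSigmaFinEquiv.symm p).2

/-- The tree with a root vertex `x` and, on its `i`-th input, a vertex `y i`. -/
def T.twoLevel {X : ℕ → Type u} {n : ℕ} (x : X n) {k : Fin n → ℕ} (y : ∀ i, X (k i)) :
    T X (∑ i, k i) :=
  ⟨.node n x fun i => .node (k i) (y i) fun _ => .leaf, by simp [Tr.leaves]⟩

theorem T.map_twoLevel {X : ℕ → Type u} {Y : ℕ → Type v} (f : ∀ ⦃n⦄, X n → Y n) {n : ℕ} (x : X n)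
    {k : Fin n → ℕ} (y : ∀ i, X (k i)) :
    T.map f (T.twoLevel x y) = T.twoLevel (f x) fun i => f (y i) := rfl

/-- The tree without vertices. -/
def T.trivial {X : ℕ → Type u} : T X 1 := ⟨.leaf, rfl⟩

/-- A pair of a list of `n` elements and a further one, `([a₁, …, aₙ], a)`. -/
abbrev IndObj (A : Type u) (n : ℕ) : Type u := (Fin n → A) × A

/-- A tree of pairs `([a₁, …, aₙ], a)` has edges coloured consistently by `A`, with input edges
coloured by `as` and output edge coloured by `a`. -/
def Tr.Typed {A : Type u} : (t : Tr (IndObj A)) → (Fin t.leaves → A) → A → Prop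
  | leaf, as, a => as (0 : Fin 1) = a
  | node _ x c, as, a =>
      x.2 = a ∧ ∀ i, (c i).Typed (fun j => as (finSigmaFinEquiv ⟨i, j⟩)) (x.1 i)

namespace Tr

theorem Typed.congr {A : Type u} {t t' : Tr (IndObj A)} (ht : t = t') {as : Fin t.leaves → A}
    {as' : Fin t'.leaves → A} {a : A} (h : ∀ i j, i.val = j.val → as i = as' j)
    (H : t.Typed as a) : t'.Typed as' a := by
  subst ht
  obtain rfl : as = as' := funext fun i => h i i rfl
  exact H

theorem Typed.graft {A : Type u} (t : Tr (IndObj A)) (c : Fin t.leaves → Tr (IndObj A))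
    (bs : Fin t.leaves → A) (as : Fin (t.graft c).leaves → A) (a : A) (h : t.Typed bs a)
    (hc : ∀ i, (c i).Typed (fun j => as (Fin.cast (leaves_graft t c).symm
      (finSigmaFinEquiv ⟨i, j⟩))) (bs i)) : (t.graft c).Typed as a := by
  induction t generalizing a with
  | leaf =>
    have e : bs (0 : Fin 1) = a := h
    subst e
    refine Typed.congr rfl ?_ (hc (0 : Fin 1))
    intro i j hij
    congr 1
    refine Fin.ext ?_
    simp [finSigmaFinEquiv_apply, hij]
  | node n x d ih =>
    obtain ⟨h1, h2⟩ := h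
    refine ⟨h1, fun i => ih i _ _ _ _ (h2 i) fun j => ?_⟩
    refine Typed.congr rfl ?_ (hc (finSigmaFinEquiv ⟨i, j⟩))
    intro l l' hl
    obtain rfl := Fin.ext hl
    congr 1
    refine Fin.ext ?_
    refine (finSigma_assoc (fun p => (c p).leaves) i j l).trans ?_
    exact finSigma_congr (fun i => (leaves_graft (d i) _).symm) i _ _ rfl

end Tr

/-- A composition diagram: a tree coloured consistently, with its input and output colours. -/
@[ext]
structure MIArr (A : Type u) (n : ℕ) where
  dom : T (IndObj A) n
  ins : Fin n → A
  out : A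
  typed : dom.1.Typed (fun i => ins (Fin.cast dom.2 i)) out

theorem MIArr.typed_flat {A : Type u} (Θ : Tr (MIArr A))
    (as : Fin (Θ.map fun _ f => ((f.ins, f.out) : IndObj A _)).leaves → A) (a : A)
    (h : (Θ.map fun _ f => ((f.ins, f.out) : IndObj A _)).Typed as a)
    (as' : Fin (Θ.map fun _ f => f.dom).flat.leaves → A)
    (has : ∀ i j, i.val = j.val → as i = as' j) :
    (Θ.map fun _ f => f.dom).flat.Typed as' a := by
  induction Θ generalizing a with
  | leaf => exact Tr.Typed.congr rfl has h
  | node n f c ih =>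
    obtain ⟨⟨t, rfl⟩, ins, out, ht⟩ := f
    obtain ⟨h1, h2⟩ := h
    dsimp only at h1
    subst h1
    refine Tr.Typed.graft t _ ins as' out ht fun i => ih i _ _ (h2 i) _ fun j j' hj => ?_
    refine has _ _ ?_
    exact Tr.finSigma_congr (k := fun i => ((c i).map fun _ f => ((f.ins, f.out) : IndObj A _)).leaves)
      (k' := fun i => ((c i).map fun _ f => f.dom).flat.leaves)
      (fun i => by rw [Tr.leaves_map, Tr.leaves_flat, Tr.leaves_map]) i j j' hj

/-- The `T`-multicategory of composition diagrams in the indiscrete plain multicategory on the set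
`A`. Its objects over `n` are the pairs `([a₁, …, aₙ], a)`. For every tree of such pairs which is
coloured consistently by `A`, with input colours `[b₁, …, bₙ]` and output colour `b`, it has just one
arrow from that tree to `([b₁, …, bₙ], b)`. The colours are kept in `MIArr`, as the tree alone does not
determine them when `n = 1` and it is trivial. Composition is substitution. -/
def MI (A : Type u) : T2Multicat.{u, u} where
  Obj := IndObj A
  Arr := MIArr A
  dom _ f := f.dom
  cod _ f := (f.ins, f.out)
  id _ x :=
    { dom := T.unit x
      ins := x.1
      out := x.2
      typed := ⟨rfl, fun i => congrArg x.1 (Fin.ext (by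
        refine (finSigmaFinEquiv_apply _).trans ?_
        simp [Tr.leaves]))⟩ }
  comp _ Θ g h :=
    { dom := T.mul (T.map (fun _ f => f.dom) Θ)
      ins := g.ins
      out := g.out
      typed := by
        refine MIArr.typed_flat Θ.1 (fun i => g.ins (Fin.cast ((Tr.leaves_map _ _).trans Θ.2) i))
          g.out ?_ _ ?_
        · refine Tr.Typed.congr (congrArg Subtype.val h).symm ?_ g.typed
          intro i j hij
          exact congrArg g.ins (Fin.ext hij)
        · intro i j hij
          exact congrArg g.ins (Fin.ext hij) }
  dom_id _ := rfl
  cod_id _ := rfl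
  dom_comp _ _ _ := rfl
  cod_comp _ _ _ := rfl
  id_comp f h := MIArr.ext (T.mul_unit f.dom) rfl rfl
  comp_id f h := MIArr.ext
    ((congrArg (@T.mul _ _) (T.map_map _ _ _)).trans (T.mul_map_unit f.dom)) rfl rfl
  assoc Ω g h₁ h₂ h₃ := by
    refine MIArr.ext ?_ rfl rfl
    simp only [T.map_mul, T.map_map, T.mul_mul]

/-- `E` with the evaluation `ev : E × A ⟶ B` is an exponential of `B` by `A` in the category of
`T`-multicategories. -/
structure IsExponential {A : T2Multicat.{u, v}} {B : T2Multicat.{w, w'}}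
    (E : T2Multicat.{z, z'}) (ev : T2Multicat.Hom (E.prod A) B) : Prop where
  existsUnique_transpose : ∀ (Z : T2Multicat.{z, z'}) (G : T2Multicat.Hom (Z.prod A) B),
    ∃! H : T2Multicat.Hom Z E, ev.comp (T2Multicat.prodMap H A) = G

/-- A plain multicategory enriched in the `T`-multicategory `V`: a set `C₀` and a map `MI C₀ ⟶ V`.
It amounts to an object `C[a₁, …, aₙ; a]` of `V` over `n` for all `a₁, …, aₙ, a`, and to an arrow of
`V`, for every coloured tree, from the tree of these objects at its vertices to the object at its
boundary, compatibly with substitution of trees. For two-level trees these arrows are composition,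
and for trivial trees identities. -/
structure EnrichedPlain (V : T2Multicat.{u, v}) where
  C₀ : Type w
  hom : T2Multicat.Hom (MI C₀) V

namespace StrucCat
variable (𝒯 : StrucCat.{u, v})

/-- The arrows `τ' ⟶ τ` of `𝒯(n)`. -/
def Hom {n : ℕ} (τ' τ : 𝒯.Obj n) : Type v := {φ : 𝒯.Arr n // 𝒯.src φ = τ' ∧ 𝒯.tgt φ = τ}

/-- The object `τ ∘ (σ₁, …, σₙ)`. -/
def substObj {n : ℕ} {k : Fin n → ℕ} (τ : 𝒯.Obj n) (σ : ∀ i, 𝒯.Obj (k i)) :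
    𝒯.Obj (∑ i, k i) :=
  𝒯.act (T.twoLevel τ σ)

/-- The unit object over `1`; in `TR` it is the trivial tree. -/
def unitObj : 𝒯.Obj 1 := 𝒯.act T.trivial

variable {𝒯}

/-- The identity arrow of `τ`. -/
def homId {n : ℕ} (τ : 𝒯.Obj n) : 𝒯.Hom τ τ := ⟨𝒯.id τ, 𝒯.src_id τ, 𝒯.tgt_id τ⟩

/-- The composite `φ ∘ φ'`. -/
def homComp {n : ℕ} {τ'' τ' τ : 𝒯.Obj n} (φ : 𝒯.Hom τ' τ) (φ' : 𝒯.Hom τ'' τ') : 𝒯.Hom τ'' τ :=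
  ⟨𝒯.comp φ.1 φ'.1 (φ'.2.2.trans φ.2.1.symm), (𝒯.src_comp _ _ _).trans φ'.2.1,
    (𝒯.tgt_comp _ _ _).trans φ.2.2⟩

/-- The arrow `φ ∘ (ψ₁, …, ψₙ)`. -/
def substHom {n : ℕ} {k : Fin n → ℕ} {τ' τ : 𝒯.Obj n} {σ' σ : ∀ i, 𝒯.Obj (k i)}
    (φ : 𝒯.Hom τ' τ) (ψ : ∀ i, 𝒯.Hom (σ' i) (σ i)) :
    𝒯.Hom (𝒯.substObj τ' σ') (𝒯.substObj τ σ) :=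
  ⟨𝒯.actArr (T.twoLevel φ.1 fun i => (ψ i).1), by
    rw [𝒯.src_actArr, T.map_twoLevel, φ.2.1]
    simp only [(ψ _).2.1, substObj], by
    rw [𝒯.tgt_actArr, T.map_twoLevel, φ.2.2]
    simp only [(ψ _).2.2, substObj]⟩

end StrucCat

/-- The data of a relaxed multicategory: a set `C₀` of objects, sets `Hom τ [a₁, …, aₙ] a` for `τ`
in `𝒯(n)`, functions `f ↦ f.φ`, composition functions `(f₁, …, fₙ, f) ↦ f ∘ (f₁, …, fₙ)`, and an
element `1_a` for each object `a`. -/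
structure RelaxedData (𝒯 : StrucCat.{z, z'}) where
  C₀ : Type w
  Hom : ∀ {n : ℕ}, 𝒯.Obj n → (Fin n → C₀) → C₀ → Type u
  act : ∀ {n : ℕ} {τ' τ : 𝒯.Obj n} {as : Fin n → C₀} {a : C₀},
    𝒯.Hom τ' τ → Hom τ as a → Hom τ' as a
  comp : ∀ {n : ℕ} {k : Fin n → ℕ} {τ : 𝒯.Obj n} {σ : ∀ i, 𝒯.Obj (k i)}
    {bs : ∀ i, Fin (k i) → C₀} {as : Fin n → C₀} {a : C₀},
    (∀ i, Hom (σ i) (bs i) (as i)) → Hom τ as a → Hom (𝒯.substObj τ σ) (concat bs) a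
  ident : ∀ a : C₀, Hom 𝒯.unitObj (fun _ => a) a

namespace RelaxedData

/-- An arrow together with its shape, domain and codomain. Equality of these is used to compare
arrows whose arities, shapes and domains are equal, but not by definition. -/
structure Arrow {𝒯 : StrucCat.{z, z'}} (C : RelaxedData.{u, w} 𝒯) where
  arity : ℕ
  tree : 𝒯.Obj arity
  ins : Fin arity → C.C₀
  out : C.C₀
  arr : C.Hom tree ins out

def toArrow {𝒯 : StrucCat.{z, z'}} (C : RelaxedData.{u, w} 𝒯) {n : ℕ} {τ : 𝒯.Obj n}
    {as : Fin n → C.C₀} {a : C.C₀} (f : C.Hom τ as a) : C.Arrow := ⟨n, τ, as, a, f⟩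

end RelaxedData

/-- A relaxed multicategory (for `𝒯 = TR`): the action of `𝒯(n)` is functorial, composition is
associative and unital, and both are compatible,
`(f ∘ (f₁, …, fₙ)).(φ ∘ (φ₁, …, φₙ)) = (f.φ) ∘ (f₁.φ₁, …, fₙ.φₙ)`. -/
structure RelaxedMulticategory (𝒯 : StrucCat.{z, z'}) extends RelaxedData.{u, w} 𝒯 where
  act_id : ∀ {n : ℕ} {τ : 𝒯.Obj n} {as : Fin n → C₀} {a : C₀} (f : Hom τ as a),
    act (StrucCat.homId τ) f = f
  act_comp : ∀ {n : ℕ} {τ'' τ' τ : 𝒯.Obj n} {as : Fin n → C₀} {a : C₀}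
    (φ : 𝒯.Hom τ' τ) (φ' : 𝒯.Hom τ'' τ') (f : Hom τ as a),
    act (StrucCat.homComp φ φ') f = act φ' (act φ f)
  assoc : ∀ {n : ℕ} {k : Fin n → ℕ} {l : ∀ i, Fin (k i) → ℕ}
    {τ : 𝒯.Obj n} {σ : ∀ i, 𝒯.Obj (k i)} {ρ : ∀ i j, 𝒯.Obj (l i j)}
    {cs : ∀ i j, Fin (l i j) → C₀} {bs : ∀ i, Fin (k i) → C₀} {as : Fin n → C₀} {a : C₀}
    (h : ∀ i j, Hom (ρ i j) (cs i j) (bs i j)) (g : ∀ i, Hom (σ i) (bs i) (as i))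
    (f : Hom τ as a),
    toRelaxedData.toArrow (comp (fun i => comp (h i) (g i)) f) =
      toRelaxedData.toArrow
        (comp (fun p : Fin (∑ i, k i) => h (finSigmaFinEquiv.symm p).1 (finSigmaFinEquiv.symm p).2)
          (comp g f))
  comp_ident : ∀ {n : ℕ} {τ : 𝒯.Obj n} {as : Fin n → C₀} {a : C₀} (f : Hom τ as a),
    toRelaxedData.toArrow (comp (fun i => ident (as i)) f) = toRelaxedData.toArrow f
  ident_comp : ∀ {n : ℕ} {τ : 𝒯.Obj n} {as : Fin n → C₀} {a : C₀} (f : Hom τ as a),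
    toRelaxedData.toArrow (comp (fun _ : Fin 1 => f) (ident a)) = toRelaxedData.toArrow f
  act_substHom : ∀ {n : ℕ} {k : Fin n → ℕ} {τ' τ : 𝒯.Obj n} {σ' σ : ∀ i, 𝒯.Obj (k i)}
    {bs : ∀ i, Fin (k i) → C₀} {as : Fin n → C₀} {a : C₀}
    (φ : 𝒯.Hom τ' τ) (ψ : ∀ i, 𝒯.Hom (σ' i) (σ i))
    (g : ∀ i, Hom (σ i) (bs i) (as i)) (f : Hom τ as a),
    act (StrucCat.substHom φ ψ) (comp g f) = comp (fun i => act (ψ i) (g i)) (act φ f)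

/-- The function underlying an arrow of `Set` with prescribed domain and codomain. -/
def SetArr.toFun {n : ℕ} (r : SetArr.{u} n) {D : T (fun _ => Type u) n} {X : Type u}
    (hD : r.dom = D) (hX : r.cod = X) (p : Elements D) : X :=
  cast hX (r.fn ⟨p.1, p.2.trans hD.symm⟩)

theorem MIArr.typed_twoLevel {A : Type u} {n : ℕ} {k : Fin n → ℕ} (bs : ∀ i, Fin (k i) → A)
    (as : Fin n → A) (a : A) :
    (T.twoLevel (X := IndObj A) (as, a) fun i => (bs i, as i)).1.Typed
      (fun i => concat bs (Fin.cast (T.twoLevel (X := IndObj A) (as, a) fun i => (bs i, as i)).2 i))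
      a := by
  refine ⟨rfl, fun i => ⟨rfl, fun j => ?_⟩⟩
  have e : ∀ p : Fin (∑ i, k i), p = finSigmaFinEquiv ⟨i, j⟩ → concat bs p = bs i j := by
    rintro p rfl
    unfold concat
    rw [Equiv.symm_apply_apply]
  refine e _ (Fin.ext ?_)
  refine Tr.finSigma_congr
    (k := fun i => (Tr.node (X := IndObj A) (k i) (bs i, as i) fun _ => .leaf).leaves) (k' := k)
    (fun i => by simp [Tr.leaves]) i _ j ?_
  refine (finSigmaFinEquiv_apply _).trans ?_
  simp [Tr.leaves]

/-- The two-level composition diagram, in which `([bᵢ¹, bᵢ², …], aᵢ)` for all `i` are composed with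
`([a₁, …, aₙ], a)`. -/
def MIArr.twoLevel {A : Type u} {n : ℕ} {k : Fin n → ℕ} (bs : ∀ i, Fin (k i) → A)
    (as : Fin n → A) (a : A) : MIArr A (∑ i, k i) where
  dom := T.twoLevel (X := IndObj A) (as, a) fun i => (bs i, as i)
  ins := concat bs
  out := a
  typed := MIArr.typed_twoLevel bs as a

/-- The composition diagram without vertices at `a`. -/
def MIArr.trivial {A : Type u} (a : A) : MIArr A 1 where
  dom := T.trivial
  ins _ := a
  out := a
  typed := rfl

/-- The identity of the action of `D`, as an arrow of the opposite of `𝒯` with domain `D`. -/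
def StrucCat.opArr (𝒯 : StrucCat.{u, v}) {n : ℕ} (D : T 𝒯.Obj n) :
    𝒯.op.toMulticat.Arr n where
  dom := D
  arr := 𝒯.id (𝒯.act D)
  src_arr := 𝒯.tgt_id _

namespace EnrichedPlain

variable {𝒯 : StrucCat.{z, z'}} {E : T2Multicat.{v, v'}}

/-- The data of a relaxed multicategory underlying a plain multicategory enriched in the exponential
`E` of `Set` by the opposite of `𝒯`. `Hom τ [a₁, …, aₙ] a` is the value at `τ` of `C[a₁, …, aₙ; a]`;
`act` is functoriality of this value in `τ`; composition and identities are the components, at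
`(τ, σ₁, …, σₙ)` and at `()`, of the arrows of `E` given by the two-level and the trivial diagrams. -/
def relaxedData (ev : T2Multicat.Hom (E.prod 𝒯.op.toMulticat) SetT2.{u})
    (C : EnrichedPlain.{v, v', w} E) : RelaxedData.{u, w} 𝒯 where
  C₀ := C.C₀
  Hom τ as a := ev.obj (C.hom.obj (as, a), τ)
  act {n τ' τ as a} φ f :=
    (ev.arr (n := n)
      { dom := T.unit (C.hom.obj (as, a), τ)
        fst := E.id (C.hom.obj (as, a))
        snd := ⟨T.unit τ, φ.1, φ.2.2.trans (𝒯.act_unit τ).symm⟩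
        dom_fst := (E.dom_id _).symm
        dom_snd := rfl }).toFun (D := T.unit (ev.obj (C.hom.obj (as, a), τ)))
      (ev.dom_arr _)
      ((ev.cod_arr _).trans (congrArg (fun x => ev.obj x)
        (Prod.ext (E.cod_id _) φ.2.1)))
      ⟨T.unit ⟨_, f⟩, rfl⟩
  comp {n k τ σ bs as a} g f :=
    (ev.arr (n := ∑ i, k i)
      { dom := T.twoLevel (X := fun m => E.Obj m × 𝒯.Obj m) (C.hom.obj (as, a), τ)
          fun i => (C.hom.obj (bs i, as i), σ i)
        fst := C.hom.arr (MIArr.twoLevel bs as a)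
        snd := 𝒯.opArr (T.twoLevel τ σ)
        dom_fst := (C.hom.dom_arr (MIArr.twoLevel bs as a)).symm
        dom_snd := rfl }).toFun
      (D := T.twoLevel (X := fun _ => Type u) (ev.obj (C.hom.obj (as, a), τ))
        fun i => ev.obj (C.hom.obj (bs i, as i), σ i))
      (ev.dom_arr _)
      ((ev.cod_arr _).trans (congrArg (fun x => ev.obj x)
        (Prod.ext (C.hom.cod_arr _) (𝒯.src_id _))))
      ⟨T.twoLevel (X := Pointed) ⟨_, f⟩ fun i => ⟨_, g i⟩, rfl⟩
  ident a :=
    (ev.arr (n := 1)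
      { dom := T.trivial
        fst := C.hom.arr (MIArr.trivial a)
        snd := 𝒯.opArr T.trivial
        dom_fst := (C.hom.dom_arr (MIArr.trivial a)).symm
        dom_snd := rfl }).toFun (D := T.trivial)
      (ev.dom_arr _)
      ((ev.cod_arr _).trans (congrArg (fun x => ev.obj x)
        (Prod.ext (C.hom.cod_arr _) (𝒯.src_id _))))
      ⟨T.trivial, rfl⟩

end EnrichedPlain

end Relaxed

open Relaxed

/-! Of `TR` only the fact that it is a structured category is used; both halves are proved for an
arbitrary one, `𝒮` or `𝒯`.

Existence. In the multicategory under a structured category `𝒮`, an arrow out of a tree of objects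
is an arrow out of the object on which the tree acts. This representability makes exponentials by it
exist. An object of the exponential is a functor from `𝒮(n)` to unary arrows of `B`. An arrow is a
family of arrows of `B`, indexed by a tree of objects of `𝒮` and an arrow `α` out of its action,
natural in both. To compose, the tree is split along the inner arrows, uniquely since `T` is
cartesian, and `α` has to be distributed over the inner and outer arrows. The distribution is not
unique, but by naturality it does not matter: `compFn` gives all of `α` to the outer arrow and
identities to the inner ones, and `compFn_comp` shows that every other choice agrees. Hence
evaluation preserves composition, and `curry`, `expEval_curry` and `eq_curry` give the universal
property.

Enriched multicategories. Transposition turns a map `MI C₀ ⟶ E` into a map `G` from `MI C₀ × 𝒯ᵒᵖ` to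
`Set`. An exponential is tested only against multicategories in its own universes, while `MI C₀` may
live elsewhere; `IsExponential.bijective` closes this gap by comparison with the explicit
exponential. It remains to identify such maps `G` with relaxed multicategories on `C₀`.

From `G`, the action, composition and identities are read off at one-vertex, two-level and trivial
trees. The axioms hold because both sides of each one are values of `G` at the same substituted
diagram (`val_mul`, `val_congr`). Conversely, a relaxed multicategory composes whole trees of
operations recursively (`eval`) and then acts by an arrow of `𝒯`. General associativity `eval_flat`
and general compatibility with the action `eval_act` make this a map to `Set` (`setArr_comp`). The
two passages are mutually inverse: one way the three kinds of small trees return the given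
operations (`relaxedData_toHom`), the other way every tree is built from small ones by substitution,
so `G` has no further freedom (`eval_eq_val`, `toHom_ofHom`). -/

namespace Relaxed

/-! ## The monad `T` preserves pullbacks -/

namespace T
variable {A : ℕ → Type u} {B : ℕ → Type v} {C : ℕ → Type w}

theorem map_congr {f g : ∀ ⦃n⦄, A n → B n} (h : ∀ ⦃n⦄ (x : A n), f x = g x) {n : ℕ} (t : T A n) :
    map f t = map g t := by
  congr 1
  funext n x
  exact h x

end T

namespace Tr
variable {A : ℕ → Type u} {B : ℕ → Type v} {C : ℕ → Type w}

/-- Relabelling does not change the shape, so trees with a common image can be paired vertex by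
vertex. Uniqueness of the pairing is an instance of `pair_ext`. -/
theorem exists_pullback (f : ∀ ⦃n⦄, A n → C n) (g : ∀ ⦃n⦄, B n → C n) (a : Tr A) (b : Tr B)
    (h : a.map f = b.map g) :
    ∃ P : Tr (fun m => {y : A m × B m // f y.1 = g y.2}),
      P.map (fun _ y => y.1.1) = a ∧ P.map (fun _ y => y.1.2) = b := by
  induction a generalizing b with
  | leaf =>
    obtain rfl := map_eq_leaf h.symm
    exact ⟨leaf, rfl, rfl⟩
  | node n x c ih =>
    obtain ⟨y, d, rfl, hy, hd⟩ := map_eq_node h.symm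
    choose P h1 h2 using fun i => ih i (d i) (hd i).symm
    exact ⟨node n ⟨(x, y), hy.symm⟩ P, by simp [map, h1], by simp [map, h2]⟩

theorem pair_ext (f : ∀ ⦃n⦄, A n → B n) (g : ∀ ⦃n⦄, A n → C n)
    (inj : ∀ ⦃n⦄ (x y : A n), f x = f y → g x = g y → x = y) (a b : Tr A)
    (h1 : a.map f = b.map f) (h2 : a.map g = b.map g) : a = b := by
  induction a generalizing b with
  | leaf => exact (map_eq_leaf h1.symm).symm
  | node n x c ih =>
    obtain ⟨y, d, rfl, hy, hd⟩ := map_eq_node h1.symm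
    obtain ⟨h3, h4⟩ := node_inj h2
    obtain rfl := inj _ _ hy h3.symm
    obtain rfl : c = d := funext fun i => ih i _ (hd i).symm (congrFun h4 i)
    rfl

end Tr

namespace T
variable {A : ℕ → Type u} {B : ℕ → Type v} {C : ℕ → Type w}

theorem exists_pullback (f : ∀ ⦃n⦄, A n → C n) (g : ∀ ⦃n⦄, B n → C n) {n : ℕ} (a : T A n)
    (b : T B n) (h : map f a = map g b) :
    ∃ P : T (fun m => {y : A m × B m // f y.1 = g y.2}) n,
      map (fun _ y => y.1.1) P = a ∧ map (fun _ y => y.1.2) P = b := by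
  obtain ⟨P, h1, h2⟩ := Tr.exists_pullback f g a.1 b.1 (congrArg Subtype.val h)
  refine ⟨⟨P, ?_⟩, Subtype.ext h1, Subtype.ext h2⟩
  rw [← a.2, ← h1, Tr.leaves_map]

theorem pair_ext (f : ∀ ⦃n⦄, A n → B n) (g : ∀ ⦃n⦄, A n → C n)
    (inj : ∀ ⦃n⦄ (x y : A n), f x = f y → g x = g y → x = y) {n : ℕ} (a b : T A n)
    (h1 : map f a = map f b) (h2 : map g a = map g b) : a = b :=
  Subtype.ext (Tr.pair_ext f g inj a.1 b.1 (congrArg Subtype.val h1) (congrArg Subtype.val h2))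

/-- The unit of `T` is cartesian. -/
theorem eq_unit_of_map {f : ∀ ⦃n⦄, A n → B n} {n : ℕ} {t : T A n} {y : B n}
    (h : map f t = unit y) : ∃ x, t = unit x ∧ f x = y := by
  obtain ⟨x, d, hd, hx, hc⟩ := Tr.map_eq_node (congrArg Subtype.val h)
  refine ⟨x, Subtype.ext (hd.trans ?_), hx⟩
  obtain rfl : d = fun _ => Tr.leaf := funext fun i => Tr.map_eq_leaf (hc i)
  rfl

end T

/-- Associativity for a one-vertex tree of composable pairs. -/
theorem T2Multicat.comp_unit_comp (C : T2Multicat.{u, v}) {n : ℕ} (Θ : T C.Arr n) (f g : C.Arr n)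
    (h₁ : T.map C.cod Θ = C.dom f) (h₂ : T.map C.cod (T.unit (C.comp Θ f h₁)) = C.dom g)
    (h₃ : T.map C.cod (T.unit f) = C.dom g)
    (h₄ : T.map C.cod Θ = C.dom (C.comp (T.unit f) g h₃)) :
    C.comp (T.unit (C.comp Θ f h₁)) g h₂ = C.comp Θ (C.comp (T.unit f) g h₃) h₄ := by
  refine (C.assoc (T.unit ⟨(Θ, f), h₁⟩) g h₂ h₃ ?_).trans ?_
  · rw [T.map_unit, T.mul_unit]; exact h₄
  · exact C.comp_congr (T.mul_unit Θ) rfl _ _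

/-! ## Exponentials by the underlying multicategory of a structured category -/

namespace StrucCat

/-- A functor from the category `𝒮(n)` to the category of unary arrows of `B` over `n`. -/
@[ext]
structure ExpObj (𝒮 : StrucCat.{u, v}) (B : T2Multicat.{w, w'}) (n : ℕ) where
  obj : 𝒮.Obj n → B.Obj n
  arr : 𝒮.Arr n → B.Arr n
  dom_arr : ∀ α, B.dom (arr α) = T.unit (obj (𝒮.src α))
  cod_arr : ∀ α, B.cod (arr α) = obj (𝒮.tgt α)
  arr_id : ∀ τ, arr (𝒮.id τ) = B.id (obj τ)
  arr_comp : ∀ (β α) (h : 𝒮.tgt α = 𝒮.src β) (h' : T.map B.cod (T.unit (arr α)) = B.dom (arr β)),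
    arr (𝒮.comp β α h) = B.comp (T.unit (arr α)) (arr β) h'

/-- An arrow of the exponential: a family of arrows `fn D α` of `B`, for every tree `D` of pairs of
one of the functors in the domain and an object at which to evaluate it, and every arrow `α` out of
the action of the tree of these objects; natural in all the objects. -/
structure ExpArr (𝒮 : StrucCat.{u, v}) (B : T2Multicat.{w, w'}) (n : ℕ) where
  dom : T (𝒮.ExpObj B) n
  cod : 𝒮.ExpObj B n
  fn : ∀ (D : T (fun m => 𝒮.ExpObj B m × 𝒮.Obj m) n) (α : 𝒮.Arr n),
    T.map (fun _ x => x.1) D = dom → 𝒮.src α = 𝒮.act (T.map (fun _ x => x.2) D) → B.Arr n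
  dom_fn : ∀ D α h h', B.dom (fn D α h h') = T.map (fun _ x => x.1.obj x.2) D
  cod_fn : ∀ D α h h', B.cod (fn D α h h') = cod.obj (𝒮.tgt α)
  nat_cod : ∀ D α β h h' (e : 𝒮.tgt α = 𝒮.src β)
    (e₁ : 𝒮.src (𝒮.comp β α e) = 𝒮.act (T.map (fun _ x => x.2) D))
    (e₂ : T.map B.cod (T.unit (fn D α h h')) = B.dom (cod.arr β)),
    fn D (𝒮.comp β α e) h e₁ = B.comp (T.unit (fn D α h h')) (cod.arr β) e₂
  nat_dom : ∀ (W : T (fun m => 𝒮.ExpObj B m × 𝒮.Arr m) n) (β : 𝒮.Arr n)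
    (e : 𝒮.tgt (𝒮.actArr (T.map (fun _ x => x.2) W)) = 𝒮.src β)
    (h₁ : T.map (fun _ x => x.1) (T.map (fun _ x => (x.1, 𝒮.src x.2)) W) = dom)
    (h₂ : T.map (fun _ x => x.1) (T.map (fun _ x => (x.1, 𝒮.tgt x.2)) W) = dom)
    (h₃ : 𝒮.src (𝒮.comp β (𝒮.actArr (T.map (fun _ x => x.2) W)) e) =
      𝒮.act (T.map (fun _ x => x.2) (T.map (fun _ x => (x.1, 𝒮.src x.2)) W)))
    (h₄ : 𝒮.src β = 𝒮.act (T.map (fun _ x => x.2) (T.map (fun _ x => (x.1, 𝒮.tgt x.2)) W)))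
    (h₅ : T.map B.cod (T.map (fun _ x => x.1.arr x.2) W) =
      B.dom (fn (T.map (fun _ x => (x.1, 𝒮.tgt x.2)) W) β h₂ h₄)),
    fn (T.map (fun _ x => (x.1, 𝒮.src x.2)) W) (𝒮.comp β (𝒮.actArr (T.map (fun _ x => x.2) W)) e)
      h₁ h₃ = B.comp (T.map (fun _ x => x.1.arr x.2) W)
        (fn (T.map (fun _ x => (x.1, 𝒮.tgt x.2)) W) β h₂ h₄) h₅

namespace ExpArr
variable {𝒮 : StrucCat.{u, v}} {B : T2Multicat.{w, w'}}

theorem ext_fn {n : ℕ} {a b : 𝒮.ExpArr B n} (hd : a.dom = b.dom) (hc : a.cod = b.cod)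
    (hf : ∀ D α h h' k, a.fn D α h k = b.fn D α h' k) : a = b := by
  obtain ⟨D, X, f⟩ := a
  obtain ⟨D', X', f'⟩ := b
  dsimp only at hd hc
  subst hd hc
  congr 1
  funext D α h k
  exact hf D α h h k

theorem fn_congr {n : ℕ} {a b : 𝒮.ExpArr B n} (hab : a = b)
    {D D' : T (fun m => 𝒮.ExpObj B m × 𝒮.Obj m) n} {α α' : 𝒮.Arr n} (hD : D = D') (hα : α = α')
    (h k h' k') : a.fn D α h k = b.fn D' α' h' k' := by
  subst hab hD hα; rfl

/-- The identity of a functor. -/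
def id {n : ℕ} (F : 𝒮.ExpObj B n) : 𝒮.ExpArr B n where
  dom := T.unit F
  cod := F
  fn _ α _ _ := F.arr α
  dom_fn D α h h' := by
    -- Because the unit is cartesian, `D` is a single vertex carrying the functor itself.
    obtain ⟨⟨F', τ⟩, rfl, rfl⟩ := T.eq_unit_of_map h
    rw [F'.dom_arr, h', T.map_unit, 𝒮.act_unit, T.map_unit]
  cod_fn D α h h' := F.cod_arr α
  nat_cod D α β h h' e e₁ e₂ := F.arr_comp β α e e₂
  nat_dom W β e h₁ h₂ h₃ h₄ h₅ := by
    rw [T.map_map] at h₁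
    obtain ⟨⟨F', τ⟩, rfl, rfl⟩ := T.eq_unit_of_map h₁
    simp only [T.map_unit, 𝒮.actArr_unit] at e ⊢
    exact F'.arr_comp β τ e _

theorem exists_split {n : ℕ} (Θ : T (𝒮.ExpArr B) n) (D : T (fun m => 𝒮.ExpObj B m × 𝒮.Obj m) n)
    (h : T.map (fun _ x => x.1) D = T.mul (T.map (fun _ f => f.dom) Θ)) :
    ∃! Z : T (fun m => {z : 𝒮.ExpArr B m × T (fun m => 𝒮.ExpObj B m × 𝒮.Obj m) m //
        T.map (fun _ x => x.1) z.2 = z.1.dom}) n,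
      T.map (fun _ z => z.1.1) Z = Θ ∧ T.mul (T.map (fun _ z => z.1.2) Z) = D :=
  T.existsUnique_split (fun _ x => x.1) (fun _ f => f.dom) Θ D h

variable {I : ℕ → Type z}

/-- This and the next lemma make the outer arrow of a composite evaluable: its tree has one vertex
for each part, carrying the codomain functor of that part and the object on which the part's tree
acts. -/
theorem map_fst_cods_eq_dom {n : ℕ} (W : T I n) (θ : ∀ ⦃m⦄, I m → 𝒮.ExpArr B m)
    (q : ∀ ⦃m⦄, I m → T (fun m => 𝒮.ExpObj B m × 𝒮.Obj m) m)
    (e : ∀ ⦃m⦄ (i : I m), T.map (fun _ x => x.1) (q i) = (θ i).dom)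
    (Θ : T (𝒮.ExpArr B) n) (g : 𝒮.ExpArr B n) (h : T.map (fun _ f => f.cod) Θ = g.dom)
    (h1 : T.map θ W = Θ) :
    T.map (fun _ x => x.1) (T.map (fun _ i => ((θ i).cod, 𝒮.act (T.map (fun _ x => x.2) (q i)))) W) =
      g.dom := by
  rw [← h, ← h1, T.map_map, T.map_map]

theorem src_eq_act_map_snd_cods {n : ℕ} (W : T I n) (θ : ∀ ⦃m⦄, I m → 𝒮.ExpArr B m)
    (q : ∀ ⦃m⦄, I m → T (fun m => 𝒮.ExpObj B m × 𝒮.Obj m) m)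
    (D : T (fun m => 𝒮.ExpObj B m × 𝒮.Obj m) n) (α : 𝒮.Arr n)
    (hα : 𝒮.src α = 𝒮.act (T.map (fun _ x => x.2) D)) (h2 : T.mul (T.map q W) = D) :
    𝒮.src α = 𝒮.act (T.map (fun _ x => x.2)
      (T.map (fun _ i => ((θ i).cod, 𝒮.act (T.map (fun _ x => x.2) (q i)))) W)) := by
  rw [hα, ← h2, T.map_mul, 𝒮.act_mul, T.map_map, T.map_map, T.map_map]

/-- The composite of `g` with a tree `Θ` of arrows: split the tree at which to evaluate it. -/
noncomputable def compFn {n : ℕ} (Θ : T (𝒮.ExpArr B) n) (g : 𝒮.ExpArr B n)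
    (h : T.map (fun _ f => f.cod) Θ = g.dom) (D : T (fun m => 𝒮.ExpObj B m × 𝒮.Obj m) n)
    (α : 𝒮.Arr n) (hD : T.map (fun _ x => x.1) D = T.mul (T.map (fun _ f => f.dom) Θ))
    (hα : 𝒮.src α = 𝒮.act (T.map (fun _ x => x.2) D)) : B.Arr n :=
  B.comp (T.map (fun _ z => z.1.1.fn z.1.2 (𝒮.id (𝒮.act (T.map (fun _ x => x.2) z.1.2))) z.2
      (𝒮.src_id _)) (exists_split Θ D hD).choose)
    (g.fn (T.map (fun _ z => (z.1.1.cod, 𝒮.act (T.map (fun _ x => x.2) z.1.2)))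
      (exists_split Θ D hD).choose) α
      (map_fst_cods_eq_dom (exists_split Θ D hD).choose (fun _ z => z.1.1) (fun _ z => z.1.2)
        (fun _ z => z.2) Θ g h (exists_split Θ D hD).choose_spec.1.1)
      (src_eq_act_map_snd_cods (exists_split Θ D hD).choose (fun _ z => z.1.1) (fun _ z => z.1.2) D α hα
        (exists_split Θ D hD).choose_spec.1.2))
    (by
      rw [dom_fn, T.map_map, T.map_map]
      exact T.map_congr (fun _ z => by rw [cod_fn, 𝒮.tgt_id]) _)

/-- Splittings are unique, so any presentation of one by an index tree `W` computes the composite.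
This removes the choice in `compFn` from later arguments. -/
theorem compFn_eq {n : ℕ} (W : T I n) (θ : ∀ ⦃m⦄, I m → 𝒮.ExpArr B m)
    (q : ∀ ⦃m⦄, I m → T (fun m => 𝒮.ExpObj B m × 𝒮.Obj m) m)
    (e : ∀ ⦃m⦄ (i : I m), T.map (fun _ x => x.1) (q i) = (θ i).dom)
    (Θ : T (𝒮.ExpArr B) n) (g : 𝒮.ExpArr B n) (h : T.map (fun _ f => f.cod) Θ = g.dom)
    (D : T (fun m => 𝒮.ExpObj B m × 𝒮.Obj m) n) (α : 𝒮.Arr n)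
    (hD : T.map (fun _ x => x.1) D = T.mul (T.map (fun _ f => f.dom) Θ))
    (hα : 𝒮.src α = 𝒮.act (T.map (fun _ x => x.2) D))
    (h1 : T.map θ W = Θ) (h2 : T.mul (T.map q W) = D) (h3 h4 h5) :
    compFn Θ g h D α hD hα =
      B.comp (T.map (fun _ i => (θ i).fn (q i) (𝒮.id (𝒮.act (T.map (fun _ x => x.2) (q i)))) (e i)
        (𝒮.src_id _)) W)
      (g.fn (T.map (fun _ i => ((θ i).cod, 𝒮.act (T.map (fun _ x => x.2) (q i)))) W) α h3 h4) h5 := by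
  have hZ := (exists_split Θ D hD).choose_spec.2 (T.map (fun m i => ⟨(θ i, q i), e i⟩) W)
    ⟨by rw [T.map_map]; exact h1, by rw [T.map_map]; exact h2⟩
  unfold compFn
  refine B.comp_congr ?_ ?_ _ _
  · rw [← hZ, T.map_map]
  · refine fn_congr rfl ?_ rfl _ _ _ _
    rw [← hZ, T.map_map]

theorem dom_compFn {n : ℕ} (Θ : T (𝒮.ExpArr B) n) (g : 𝒮.ExpArr B n)
    (h : T.map (fun _ f => f.cod) Θ = g.dom) (D : T (fun m => 𝒮.ExpObj B m × 𝒮.Obj m) n)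
    (α : 𝒮.Arr n) (hD : T.map (fun _ x => x.1) D = T.mul (T.map (fun _ f => f.dom) Θ))
    (hα : 𝒮.src α = 𝒮.act (T.map (fun _ x => x.2) D)) :
    B.dom (compFn Θ g h D α hD hα) = T.map (fun _ x => x.1.obj x.2) D := by
  unfold compFn
  rw [B.dom_comp, T.map_map]
  simp only [dom_fn]
  conv_rhs => rw [← (exists_split Θ D hD).choose_spec.1.2, T.map_mul, T.map_map]

theorem cod_compFn {n : ℕ} (Θ : T (𝒮.ExpArr B) n) (g : 𝒮.ExpArr B n)
    (h : T.map (fun _ f => f.cod) Θ = g.dom) (D : T (fun m => 𝒮.ExpObj B m × 𝒮.Obj m) n)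
    (α : 𝒮.Arr n) (hD : T.map (fun _ x => x.1) D = T.mul (T.map (fun _ f => f.dom) Θ))
    (hα : 𝒮.src α = 𝒮.act (T.map (fun _ x => x.2) D)) :
    B.cod (compFn Θ g h D α hD hα) = g.cod.obj (𝒮.tgt α) := by
  unfold compFn
  rw [B.cod_comp, cod_fn]

/-- Naturality in the codomain at an identity: the values at identities determine all values. -/
theorem comp_unit_fn_id {n : ℕ} (f : 𝒮.ExpArr B n) (q α h h' k k' e) :
    B.comp (T.unit (f.fn q (𝒮.id (𝒮.act (T.map (fun _ x => x.2) q))) h h')) (f.cod.arr α) e =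
      f.fn q α k k' := by
  have e' : 𝒮.tgt (𝒮.id (𝒮.act (T.map (fun _ x => x.2) q))) = 𝒮.src α := by rw [𝒮.tgt_id, k']
  have e'' : 𝒮.comp α (𝒮.id (𝒮.act (T.map (fun _ x => x.2) q))) e' = α :=
    (𝒮.comp_congr rfl (by rw [k']) _ (𝒮.tgt_id _)).trans (𝒮.comp_id α (𝒮.tgt_id _))
  rw [← f.nat_cod q _ α h h' e' (by rw [e'', k']) e]
  exact fn_congr rfl rfl e'' _ _ _ _

/-- Composites may be evaluated along any arrows out of the actions of the parts. -/
theorem compFn_comp {n : ℕ} (W : T I n) (θ : ∀ ⦃m⦄, I m → 𝒮.ExpArr B m)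
    (q : ∀ ⦃m⦄, I m → T (fun m => 𝒮.ExpObj B m × 𝒮.Obj m) m) (a : ∀ ⦃m⦄, I m → 𝒮.Arr m)
    (e : ∀ ⦃m⦄ (i : I m), T.map (fun _ x => x.1) (q i) = (θ i).dom)
    (ea : ∀ ⦃m⦄ (i : I m), 𝒮.src (a i) = 𝒮.act (T.map (fun _ x => x.2) (q i)))
    (Θ : T (𝒮.ExpArr B) n) (g : 𝒮.ExpArr B n) (h : T.map (fun _ f => f.cod) Θ = g.dom)
    (D : T (fun m => 𝒮.ExpObj B m × 𝒮.Obj m) n) (β : 𝒮.Arr n)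
    (hβ : 𝒮.tgt (𝒮.actArr (T.map a W)) = 𝒮.src β)
    (hD : T.map (fun _ x => x.1) D = T.mul (T.map (fun _ f => f.dom) Θ))
    (hα : 𝒮.src (𝒮.comp β (𝒮.actArr (T.map a W)) hβ) = 𝒮.act (T.map (fun _ x => x.2) D))
    (h1 : T.map θ W = Θ) (h2 : T.mul (T.map q W) = D) (h3 h4 h5) :
    compFn Θ g h D (𝒮.comp β (𝒮.actArr (T.map a W)) hβ) hD hα =
      B.comp (T.map (fun _ i => (θ i).fn (q i) (a i) (e i) (ea i)) W)
      (g.fn (T.map (fun _ i => ((θ i).cod, 𝒮.tgt (a i))) W) β h3 h4) h5 := by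
  -- The tree along which naturality of `g` is applied: each `a i` next to the functor through which
  -- it acts.
  let V : T (fun m => 𝒮.ExpObj B m × 𝒮.Arr m) n := T.map (fun _ i => ((θ i).cod, a i)) W
  have hV : T.map (fun _ x => x.2) V = T.map a W := T.map_map _ _ _
  have hs : T.map (fun _ x => (x.1, 𝒮.src x.2)) V =
      T.map (fun _ i => ((θ i).cod, 𝒮.act (T.map (fun _ x => x.2) (q i)))) W := by
    refine (T.map_map _ _ _).trans (T.map_congr (fun _ i => ?_) W)
    rw [ea]
  have ht : T.map (fun _ x => (x.1, 𝒮.tgt x.2)) V =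
      T.map (fun _ i => ((θ i).cod, 𝒮.tgt (a i))) W := T.map_map _ _ _
  have har : T.map (fun _ x => x.1.arr x.2) V = T.map (fun _ i => (θ i).cod.arr (a i)) W :=
    T.map_map _ _ _
  have k3 := map_fst_cods_eq_dom W θ q e Θ g h h1
  have k4 := src_eq_act_map_snd_cods W θ q D _ hα h2
  have k5 : T.map B.cod (T.map (fun _ i => (θ i).fn (q i)
      (𝒮.id (𝒮.act (T.map (fun _ x => x.2) (q i)))) (e i) (𝒮.src_id _)) W) =
      B.dom (g.fn (T.map (fun _ i => ((θ i).cod, 𝒮.act (T.map (fun _ x => x.2) (q i)))) W)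
        _ k3 k4) := by
    rw [dom_fn, T.map_map, T.map_map]
    exact T.map_congr (fun _ z => by rw [cod_fn, 𝒮.tgt_id]) _
  rw [compFn_eq W θ q e Θ g h D _ hD hα h1 h2 k3 k4 k5]
  have n1 : T.map B.cod (T.map (fun _ x => x.1.arr x.2) V) =
      B.dom (g.fn (T.map (fun _ x => (x.1, 𝒮.tgt x.2)) V) β (by rw [ht]; exact h3)
        (by rw [ht]; exact h4)) := by
    simp only [dom_fn, T.map_map, ExpObj.cod_arr]
  have n2 := g.nat_dom V β (by rw [hV]; exact hβ) (by rw [hs]; exact k3) (by rw [ht]; exact h3)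
    (by simp only [𝒮.src_comp, 𝒮.src_actArr, T.map_map])
    (by rw [ht]; exact h4) n1
  -- Naturality of `g` moves the arrows `a i` out of its argument, where they act through the
  -- codomain functors of the parts.
  have n3 : g.fn (T.map (fun _ i => ((θ i).cod, 𝒮.act (T.map (fun _ x => x.2) (q i)))) W)
      (𝒮.comp β (𝒮.actArr (T.map a W)) hβ) k3 k4 =
      B.comp (T.map (fun _ i => (θ i).cod.arr (a i)) W)
        (g.fn (T.map (fun _ i => ((θ i).cod, 𝒮.tgt (a i))) W) β h3 h4) (by
          rw [← har, n1]; congr 1; exact fn_congr rfl ht rfl _ _ _ _) := by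
    refine Eq.trans ?_ (n2.trans ?_)
    · exact fn_congr rfl hs.symm (𝒮.comp_congr rfl (by rw [hV]) _ _) _ _ _ _
    · exact B.comp_congr har (fn_congr rfl ht rfl _ _ _ _) _ _
  have k6 : ∀ ⦃m⦄ (i : I m), T.map B.cod (T.unit ((θ i).fn (q i)
      (𝒮.id (𝒮.act (T.map (fun _ x => x.2) (q i)))) (e i) (𝒮.src_id _))) =
      B.dom ((θ i).cod.arr (a i)) := fun m i => by
    rw [ExpObj.dom_arr, T.map_unit, cod_fn, 𝒮.tgt_id, ea]
  -- Associativity in `B` regroups the composite so that each part, evaluated at an identity, meets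
  -- `(θ i).cod.arr (a i)`; `comp_unit_fn_id` merges the two.
  have as := B.assoc_map W (fun _ i => T.unit ((θ i).fn (q i)
    (𝒮.id (𝒮.act (T.map (fun _ x => x.2) (q i)))) (e i) (𝒮.src_id _)))
    (fun _ i => (θ i).cod.arr (a i)) k6
    (g.fn (T.map (fun _ i => ((θ i).cod, 𝒮.tgt (a i))) W) β h3 h4)
    (by
      rw [dom_fn, T.map_map, T.map_map]
      exact T.map_congr (fun _ i => by rw [B.cod_comp, ExpObj.cod_arr]) W)
    (by
      rw [dom_fn, T.map_map, T.map_map]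
      exact T.map_congr (fun _ i => by rw [ExpObj.cod_arr]) W)
    (by
      rw [B.dom_comp, T.map_mul, T.map_map, T.map_map]
      exact congrArg (@T.mul _ _) (T.map_congr (fun _ i => k6 i) W))
  refine Eq.trans ?_ (as.symm.trans ?_)
  · refine B.comp_congr ?_ n3 _ _
    rw [← T.map_map, T.mul_map_unit]
  · refine B.comp_congr (T.map_congr (fun _ i => ?_) W) rfl _ _
    exact comp_unit_fn_id _ _ _ _ _ _ _ _

theorem compFn_congr {n : ℕ} (Θ : T (𝒮.ExpArr B) n) (g : 𝒮.ExpArr B n)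
    (h : T.map (fun _ f => f.cod) Θ = g.dom) {D D' : T (fun m => 𝒮.ExpObj B m × 𝒮.Obj m) n}
    {α α' : 𝒮.Arr n} (hD : D = D') (hα : α = α') (h₁ h₂ h₃ h₄) :
    compFn Θ g h D α h₁ h₂ = compFn Θ g h D' α' h₃ h₄ := by
  subst hD hα; rfl

/-- Naturality in the domain, with an identity as the outer arrow `β`. -/
theorem fn_actArr {n : ℕ} (f : 𝒮.ExpArr B n) (W : T (fun m => 𝒮.ExpObj B m × 𝒮.Arr m) n)
    (h₁ : T.map (fun _ x => x.1) (T.map (fun _ x => (x.1, 𝒮.src x.2)) W) = f.dom)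
    (h₂ : T.map (fun _ x => x.1) (T.map (fun _ x => (x.1, 𝒮.tgt x.2)) W) = f.dom)
    (h₃ : 𝒮.src (𝒮.actArr (T.map (fun _ x => x.2) W)) =
      𝒮.act (T.map (fun _ x => x.2) (T.map (fun _ x => (x.1, 𝒮.src x.2)) W)))
    (h₄ : T.map B.cod (T.map (fun _ x => x.1.arr x.2) W) =
      B.dom (f.fn (T.map (fun _ x => (x.1, 𝒮.tgt x.2)) W) (𝒮.id (𝒮.act (T.map (fun _ x => x.2)
        (T.map (fun _ x => (x.1, 𝒮.tgt x.2)) W)))) h₂ (𝒮.src_id _))) :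
    f.fn (T.map (fun _ x => (x.1, 𝒮.src x.2)) W) (𝒮.actArr (T.map (fun _ x => x.2) W)) h₁ h₃ =
      B.comp (T.map (fun _ x => x.1.arr x.2) W)
        (f.fn (T.map (fun _ x => (x.1, 𝒮.tgt x.2)) W) (𝒮.id (𝒮.act (T.map (fun _ x => x.2)
          (T.map (fun _ x => (x.1, 𝒮.tgt x.2)) W)))) h₂ (𝒮.src_id _)) h₄ := by
  have ht : 𝒮.tgt (𝒮.actArr (T.map (fun _ x => x.2) W)) =
      𝒮.act (T.map (fun _ x => x.2) (T.map (fun _ x => (x.1, 𝒮.tgt x.2)) W)) := by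
    rw [𝒮.tgt_actArr, T.map_map, T.map_map]
  refine Eq.trans ?_ (f.nat_dom W _ (by rw [ht, 𝒮.src_id]) h₁ h₂ (by rw [𝒮.src_comp, h₃])
    (𝒮.src_id _) h₄)
  refine fn_congr rfl rfl ?_ _ _ _ _
  refine (𝒮.id_comp _ (𝒮.src_id _).symm).symm.trans ?_
  exact 𝒮.comp_congr (by rw [ht]) rfl _ _

/-- The arrow `α` enters a composite only through `g`, so this is naturality of `g` followed by
associativity in `B`. -/
theorem compFn_nat_cod {n : ℕ} (Θ : T (𝒮.ExpArr B) n) (g : 𝒮.ExpArr B n)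
    (h : T.map (fun _ f => f.cod) Θ = g.dom) (D : T (fun m => 𝒮.ExpObj B m × 𝒮.Obj m) n)
    (α β : 𝒮.Arr n) (hD : T.map (fun _ x => x.1) D = T.mul (T.map (fun _ f => f.dom) Θ))
    (hα : 𝒮.src α = 𝒮.act (T.map (fun _ x => x.2) D)) (e : 𝒮.tgt α = 𝒮.src β)
    (e₁ : 𝒮.src (𝒮.comp β α e) = 𝒮.act (T.map (fun _ x => x.2) D))
    (e₂ : T.map B.cod (T.unit (compFn Θ g h D α hD hα)) = B.dom (g.cod.arr β)) :
    compFn Θ g h D (𝒮.comp β α e) hD e₁ =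
      B.comp (T.unit (compFn Θ g h D α hD hα)) (g.cod.arr β) e₂ := by
  have h1 := (exists_split Θ D hD).choose_spec.1.1
  have h2 := (exists_split Θ D hD).choose_spec.1.2
  have k3 := map_fst_cods_eq_dom (exists_split Θ D hD).choose (fun _ z => z.1.1) (fun _ z => z.1.2) (fun _ z => z.2) Θ g h h1
  have k4 := src_eq_act_map_snd_cods (exists_split Θ D hD).choose (fun _ z => z.1.1) (fun _ z => z.1.2) D α hα h2
  have k5 := src_eq_act_map_snd_cods (exists_split Θ D hD).choose (fun _ z => z.1.1) (fun _ z => z.1.2) D _ e₁ h2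
  have k6 : T.map B.cod (T.unit (g.fn _ α k3 k4)) = B.dom (g.cod.arr β) := by
    rw [ExpObj.dom_arr, T.map_unit, cod_fn, e]
  unfold compFn
  refine Eq.trans ?_ (B.comp_unit_comp _ _ _ _ _ k6 ?_).symm
  · exact B.comp_congr rfl (g.nat_cod _ α β k3 k4 e k5 k6) _ _
  · rw [B.dom_comp, T.map_unit, T.mul_unit, dom_fn, T.map_map, T.map_map]
    exact T.map_congr (fun _ z => by rw [cod_fn, 𝒮.tgt_id]) _

theorem compFn_nat_dom {n : ℕ} (Θ : T (𝒮.ExpArr B) n) (g : 𝒮.ExpArr B n)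
    (h : T.map (fun _ f => f.cod) Θ = g.dom)
    (W : T (fun m => 𝒮.ExpObj B m × 𝒮.Arr m) n) (β : 𝒮.Arr n)
    (e : 𝒮.tgt (𝒮.actArr (T.map (fun _ x => x.2) W)) = 𝒮.src β)
    (h₁ : T.map (fun _ x => x.1) (T.map (fun _ x => (x.1, 𝒮.src x.2)) W) =
      T.mul (T.map (fun _ f => f.dom) Θ))
    (h₂ : T.map (fun _ x => x.1) (T.map (fun _ x => (x.1, 𝒮.tgt x.2)) W) =
      T.mul (T.map (fun _ f => f.dom) Θ))
    (h₃ : 𝒮.src (𝒮.comp β (𝒮.actArr (T.map (fun _ x => x.2) W)) e) =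
      𝒮.act (T.map (fun _ x => x.2) (T.map (fun _ x => (x.1, 𝒮.src x.2)) W)))
    (h₄ : 𝒮.src β = 𝒮.act (T.map (fun _ x => x.2) (T.map (fun _ x => (x.1, 𝒮.tgt x.2)) W)))
    (h₅ : T.map B.cod (T.map (fun _ x => x.1.arr x.2) W) =
      B.dom (compFn Θ g h (T.map (fun _ x => (x.1, 𝒮.tgt x.2)) W) β h₂ h₄)) :
    compFn Θ g h (T.map (fun _ x => (x.1, 𝒮.src x.2)) W)
      (𝒮.comp β (𝒮.actArr (T.map (fun _ x => x.2) W)) e)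
      h₁ h₃ = B.comp (T.map (fun _ x => x.1.arr x.2) W)
        (compFn Θ g h (T.map (fun _ x => (x.1, 𝒮.tgt x.2)) W) β h₂ h₄) h₅ := by
  -- Splitting `W` itself along `Θ` splits its tree of sources and its tree of targets
  -- simultaneously.
  obtain ⟨Z, ⟨z1, z2⟩, -⟩ := T.existsUnique_split (fun _ x => x.1) (fun _ f => f.dom) Θ W
    (by rw [← h₁, T.map_map])
  have ha : T.map (fun _ x => x.2) W =
      T.mul (T.map (fun _ z => T.map (fun _ x => x.2) z.1.2) Z) := by
    rw [← z2, T.map_mul, T.map_map]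
  have hs : T.mul (T.map (fun _ z => T.map (fun _ x => (x.1, 𝒮.src x.2)) z.1.2) Z) =
      T.map (fun _ x => (x.1, 𝒮.src x.2)) W := by
    rw [← z2, T.map_mul, T.map_map]
  have ht : T.mul (T.map (fun _ z => T.map (fun _ x => (x.1, 𝒮.tgt x.2)) z.1.2) Z) =
      T.map (fun _ x => (x.1, 𝒮.tgt x.2)) W := by
    rw [← z2, T.map_mul, T.map_map]
  have har : T.map (fun _ x => x.1.arr x.2) W =
      T.mul (T.map (fun _ z => T.map (fun _ x => x.1.arr x.2) z.1.2) Z) := by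
    rw [← z2, T.map_mul, T.map_map]
  have ha' : 𝒮.actArr (T.map (fun _ x => x.2) W) =
      𝒮.actArr (T.map (fun _ z => 𝒮.actArr (T.map (fun _ x => x.2) z.1.2)) Z) := by
    rw [ha, 𝒮.actArr_mul, T.map_map]
  have hθ : ∀ ⦃m⦄ (z : {z : 𝒮.ExpArr B m × T (fun m => 𝒮.ExpObj B m × 𝒮.Arr m) m //
      T.map (fun _ x => x.1) z.2 = z.1.dom}), 
      T.map (fun _ x => x.1) (T.map (fun _ x => (x.1, 𝒮.src x.2)) z.1.2) = z.1.1.dom :=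
    fun m z => (T.map_map _ _ _).trans z.2
  have hθ' : ∀ ⦃m⦄ (z : {z : 𝒮.ExpArr B m × T (fun m => 𝒮.ExpObj B m × 𝒮.Arr m) m //
      T.map (fun _ x => x.1) z.2 = z.1.dom}), 
      T.map (fun _ x => x.1) (T.map (fun _ x => (x.1, 𝒮.tgt x.2)) z.1.2) = z.1.1.dom :=
    fun m z => (T.map_map _ _ _).trans z.2
  have hsrc : ∀ ⦃m⦄ (z : {z : 𝒮.ExpArr B m × T (fun m => 𝒮.ExpObj B m × 𝒮.Arr m) m //
      T.map (fun _ x => x.1) z.2 = z.1.dom}),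
      𝒮.src (𝒮.actArr (T.map (fun _ x => x.2) z.1.2)) =
        𝒮.act (T.map (fun _ x => x.2) (T.map (fun _ x => (x.1, 𝒮.src x.2)) z.1.2)) := fun m z => by
    rw [𝒮.src_actArr, T.map_map, T.map_map]
  have htgt : ∀ ⦃m⦄ (z : {z : 𝒮.ExpArr B m × T (fun m => 𝒮.ExpObj B m × 𝒮.Arr m) m //
      T.map (fun _ x => x.1) z.2 = z.1.dom}),
      𝒮.tgt (𝒮.actArr (T.map (fun _ x => x.2) z.1.2)) =
        𝒮.act (T.map (fun _ x => x.2) (T.map (fun _ x => (x.1, 𝒮.tgt x.2)) z.1.2)) := fun m z => by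
    rw [𝒮.tgt_actArr, T.map_map, T.map_map]
  have hcm : ∀ ⦃m⦄ (z : {z : 𝒮.ExpArr B m × T (fun m => 𝒮.ExpObj B m × 𝒮.Arr m) m //
      T.map (fun _ x => x.1) z.2 = z.1.dom}),
      T.map B.cod (T.map (fun _ x => x.1.arr x.2) z.1.2) =
      B.dom (z.1.1.fn (T.map (fun _ x => (x.1, 𝒮.tgt x.2)) z.1.2) (𝒮.id (𝒮.act
        (T.map (fun _ x => x.2) (T.map (fun _ x => (x.1, 𝒮.tgt x.2)) z.1.2)))) (hθ' z)
          (𝒮.src_id _)) := fun m z => by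
    simp only [dom_fn, T.map_map, ExpObj.cod_arr]
  have hβ : 𝒮.tgt (𝒮.actArr (T.map (fun _ z => 𝒮.actArr (T.map (fun _ x => x.2) z.1.2)) Z)) =
      𝒮.src β := by rw [← ha', e]
  have k3 := map_fst_cods_eq_dom Z (fun _ z => z.1.1) (fun _ z => T.map (fun _ x => (x.1, 𝒮.tgt x.2)) z.1.2)
    hθ' Θ g h z1
  have k4 := src_eq_act_map_snd_cods Z (fun _ z => z.1.1) (fun _ z => T.map (fun _ x => (x.1, 𝒮.tgt x.2)) z.1.2)
    _ β h₄ ht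
  have k5 : T.map (fun m z => (z.1.1.cod, 𝒮.tgt (𝒮.actArr (T.map (fun _ x => x.2) z.1.2)))) Z =
      T.map (fun m z => (z.1.1.cod, 𝒮.act (T.map (fun _ x => x.2)
        (T.map (fun _ x => (x.1, 𝒮.tgt x.2)) z.1.2)))) Z :=
    T.map_congr (fun _ z => by rw [htgt]) Z
  have k6 : T.map B.cod (T.map (fun _ z => z.1.1.fn (T.map (fun _ x => (x.1, 𝒮.tgt x.2)) z.1.2)
        (𝒮.id (𝒮.act (T.map (fun _ x => x.2) (T.map (fun _ x => (x.1, 𝒮.tgt x.2)) z.1.2))))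
          (hθ' z) (𝒮.src_id _)) Z) = B.dom (g.fn _ β k3 k4) := by
    rw [dom_fn, T.map_map, T.map_map]
    exact T.map_congr (fun _ z => by rw [cod_fn, 𝒮.tgt_id]) _
  have k7 : T.map B.cod (T.map (fun _ z => z.1.1.fn (T.map (fun _ x => (x.1, 𝒮.src x.2)) z.1.2)
        (𝒮.actArr (T.map (fun _ x => x.2) z.1.2)) (hθ z) (hsrc z)) Z) =
      B.dom (g.fn _ β k3 k4) := by
    rw [dom_fn, T.map_map, T.map_map]
    exact T.map_congr (fun _ z => by rw [cod_fn, htgt]) _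
  -- The left side is evaluated with each part taken along the action of its own arrows rather than
  -- along an identity.
  have e1 := compFn_comp Z (fun _ z => z.1.1)
    (fun _ z => T.map (fun _ x => (x.1, 𝒮.src x.2)) z.1.2)
    (fun _ z => 𝒮.actArr (T.map (fun _ x => x.2) z.1.2)) hθ hsrc Θ g h
    (T.map (fun _ x => (x.1, 𝒮.src x.2)) W) β hβ h₁
    (by rw [𝒮.src_comp, ← ha', ← h₃, 𝒮.src_comp]) z1 hs (by rw [k5]; exact k3)
    (by rw [k5]; exact k4) (by
      rw [k7]; exact congrArg (@B.dom n) (fn_congr rfl k5.symm rfl _ _ _ _))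
  refine (compFn_congr Θ g h rfl (𝒮.comp_congr rfl ha' _ hβ) _ _ _ _).trans (e1.trans ?_)
  have e2 := compFn_eq Z (fun _ z => z.1.1)
    (fun _ z => T.map (fun _ x => (x.1, 𝒮.tgt x.2)) z.1.2) hθ' Θ g h
    (T.map (fun _ x => (x.1, 𝒮.tgt x.2)) W) β h₂ h₄ z1 ht k3 k4 k6
  have k8 : T.map B.cod (T.mul (T.map (fun _ z => T.map (fun _ x => x.1.arr x.2) z.1.2) Z)) =
      B.dom (B.comp _ _ k6) := by
    rw [← har, h₅, e2]
  refine Eq.trans ?_ (B.comp_congr har.symm e2.symm k8 _)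
  -- By `fn_actArr` each part on the left is the arrows of `W` in that part followed by its value at
  -- an identity; associativity collects these arrows in front.
  refine Eq.trans ?_ (B.assoc_map Z (fun _ z => T.map (fun _ x => x.1.arr x.2) z.1.2) _ hcm _
    ?_ k6 k8)
  · refine B.comp_congr (T.map_congr (fun _ z => fn_actArr _ _ (hθ z) (hθ' z) (hsrc z) (hcm z)) Z)
      (fn_congr rfl k5 rfl _ _ _ _) _ _
  · rw [← k7]
    exact congrArg (fun t => T.map B.cod t)
      (T.map_congr (fun _ z => (fn_actArr _ _ (hθ z) (hθ' z) (hsrc z) (hcm z)).symm) Z)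

/-- Composition in the exponential. -/
noncomputable def comp {n : ℕ} (Θ : T (𝒮.ExpArr B) n) (g : 𝒮.ExpArr B n)
    (h : T.map (fun _ f => f.cod) Θ = g.dom) : 𝒮.ExpArr B n where
  dom := T.mul (T.map (fun _ f => f.dom) Θ)
  cod := g.cod
  fn := compFn Θ g h
  dom_fn := dom_compFn Θ g h
  cod_fn := cod_compFn Θ g h
  nat_cod := compFn_nat_cod Θ g h
  nat_dom := compFn_nat_dom Θ g h

end ExpArr
end StrucCat

/-! ### Unit and associativity laws of the exponential -/

namespace StrucCat
namespace ExpArr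
variable {𝒮 : StrucCat.{u, v}} {B : T2Multicat.{w, w'}}

theorem cod_fn_id {n : ℕ} (f : 𝒮.ExpArr B n) (D : T (fun m => 𝒮.ExpObj B m × 𝒮.Obj m) n)
    (τ : 𝒮.Obj n) (h h') : B.cod (f.fn D (𝒮.id τ) h h') = f.cod.obj τ := by
  rw [cod_fn, 𝒮.tgt_id]

theorem comp_unit_id {n : ℕ} (f : 𝒮.ExpArr B n)
    (h : T.map (fun _ f => f.cod) (T.unit f) = (id f.cod).dom) : comp (T.unit f) (id f.cod) h = f := by
  refine ext_fn (T.mul_unit f.dom) rfl fun D α hD hD' hα => ?_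
  have k : T.map B.cod (T.unit (f.fn D (𝒮.id (𝒮.act (T.map (fun _ x => x.2) D))) hD'
      (𝒮.src_id _))) = B.dom (f.cod.arr α) := by
    rw [ExpObj.dom_arr, T.map_unit, cod_fn, 𝒮.tgt_id, hα]
  refine (compFn_eq (I := fun m => {z : 𝒮.ExpArr B m × T (fun m => 𝒮.ExpObj B m × 𝒮.Obj m) m //
        T.map (fun _ x => x.1) z.2 = z.1.dom}) (T.unit ⟨(f, D), hD'⟩) (fun _ z => z.1.1)
    (fun _ z => z.1.2) (fun _ z => z.2) (T.unit f) (id f.cod) h D α hD hα rfl (T.mul_unit D) rfl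
    (by rw [T.map_unit, T.map_unit, 𝒮.act_unit]; exact hα) k).trans ?_
  exact comp_unit_fn_id f D α _ _ _ _ _

theorem comp_map_id {n : ℕ} (f : 𝒮.ExpArr B n)
    (h : T.map (fun _ f => f.cod) (T.map (fun _ F => id F) f.dom) = f.dom) :
    comp (T.map (fun _ F => id F) f.dom) f h = f := by
  have hd : T.mul (T.map (fun _ f => f.dom) (T.map (fun _ F => id (𝒮 := 𝒮) (B := B) F) f.dom)) =
      f.dom := by
    rw [T.map_map]; exact T.mul_map_unit _
  refine ext_fn hd rfl fun D α hD hD' hα => ?_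
  have e : T.map (fun _ x => (x.1, 𝒮.act (T.unit x.2))) D = D := by
    simp only [𝒮.act_unit]; exact T.map_id D
  -- Here every vertex of `D` is a part of its own, evaluated at an identity; functors preserve
  -- identities, so the unit law of `B` applies.
  have e' : T.map (fun _ (x : 𝒮.ExpObj B _ × 𝒮.Obj _) => x.1.arr (𝒮.id (𝒮.act (T.unit x.2)))) D =
      T.map B.id (B.dom (f.fn D α hD' hα)) := by
    simp only [𝒮.act_unit, ExpObj.arr_id, dom_fn, T.map_map]
  have k : T.map B.cod (T.map B.id (B.dom (f.fn D α hD' hα))) = B.dom (f.fn D α hD' hα) := by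
    simp only [T.map_map, B.cod_id]; exact T.map_id _
  refine (compFn_eq D (fun _ x => id x.1) (fun _ x => T.unit x) (fun _ x => rfl) _ f h D α hD hα
    ?_ (T.mul_map_unit D) ?_ ?_ ?_).trans (Eq.trans (B.comp_congr e' (fn_congr rfl e rfl _ _ _ _) _ k)
      (B.comp_id _ _))
  · rw [← hD', T.map_map]
  · exact (congrArg (fun t => T.map (fun _ x => x.1) t) e).trans hD'
  · exact hα.trans (congrArg (fun t => 𝒮.act (T.map (fun _ x => x.2) t)) e.symm)
  · exact (congrArg (fun t => T.map B.cod t) e').trans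
      (k.trans (congrArg (@B.dom n) (fn_congr rfl e.symm rfl _ _ _ _)))

/-- Both sides are computed from one double splitting of `D`: `W` along the pairs of `Ω`, then `Z`
inside each pair. What remains is associativity in `B`. -/
theorem comp_assoc {n : ℕ}
    (Ω : T (fun m => {p : T (𝒮.ExpArr B) m × 𝒮.ExpArr B m //
      T.map (fun _ f => f.cod) p.1 = p.2.dom}) n) (g : 𝒮.ExpArr B n)
    (h₁ : T.map (fun _ f => f.cod) (T.map (fun _ p => comp p.1.1 p.1.2 p.2) Ω) = g.dom)
    (h₂ : T.map (fun _ f => f.cod) (T.map (fun _ p => p.1.2) Ω) = g.dom)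
    (h₃ : T.map (fun _ f => f.cod) (T.mul (T.map (fun _ p => p.1.1) Ω)) =
      (comp (T.map (fun _ p => p.1.2) Ω) g h₂).dom) :
    comp (T.map (fun _ p => comp p.1.1 p.1.2 p.2) Ω) g h₁ =
      comp (T.mul (T.map (fun _ p => p.1.1) Ω)) (comp (T.map (fun _ p => p.1.2) Ω) g h₂) h₃ := by
  have hd : T.mul (T.map (fun _ f => f.dom) (T.map (fun _ p => comp p.1.1 p.1.2 p.2) Ω)) =
      T.mul (T.map (fun _ p => T.mul (T.map (fun _ f => f.dom) p.1.1)) Ω) := by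
    rw [T.map_map]; rfl
  refine ext_fn ?_ rfl fun D α hD hD' hα => ?_
  · refine hd.trans ?_
    change _ = T.mul (T.map (fun _ f => f.dom) (T.mul (T.map (fun _ p => p.1.1) Ω)))
    rw [T.map_mul, T.mul_mul, T.map_map, T.map_map]
  obtain ⟨W, ⟨w1, w2⟩, -⟩ := T.existsUnique_split (fun _ x => x.1)
    (fun _ p => T.mul (T.map (fun _ f => f.dom) p.1.1)) Ω D (hD.trans hd)
  choose Z hZ _ using fun m (w : {z : {p : T (𝒮.ExpArr B) m × 𝒮.ExpArr B m //
      T.map (fun _ f => f.cod) p.1 = p.2.dom} × T (fun m => 𝒮.ExpObj B m × 𝒮.Obj m) m //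
      T.map (fun _ x => x.1) z.2 = T.mul (T.map (fun _ f => f.dom) z.1.1.1)}) =>
    exists_split w.1.1.1.1 w.1.2 w.2
  -- Acting on the pieces and then on the results is acting once on the whole. The two sides
  -- therefore evaluate the outer arrow of each pair at an identity of the same object.
  have hZa : ∀ m w, 𝒮.act (T.map (fun _ x => x.2) (T.map (fun _ z => (z.1.1.cod,
      𝒮.act (T.map (fun _ x => x.2) z.1.2))) (Z m w))) = 𝒮.act (T.map (fun _ x => x.2) w.1.2) :=
    fun m w => by
      rw [← (hZ m w).2, T.map_mul, 𝒮.act_mul, T.map_map, T.map_map, T.map_map]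
  have c1 : T.map (fun _ w => comp w.1.1.1.1 w.1.1.1.2 w.1.1.2) W =
      T.map (fun _ p => comp p.1.1 p.1.2 p.2) Ω := by rw [← w1, T.map_map]
  have c2 : T.map (fun _ w => w.1.1.1.2) W = T.map (fun _ p => p.1.2) Ω := by rw [← w1, T.map_map]
  have c3 : T.map (fun _ z => z.1.1) (T.mul (T.map Z W)) = T.mul (T.map (fun _ p => p.1.1) Ω) := by
    rw [T.map_mul, T.map_map, ← w1, T.map_map]
    exact congrArg (@T.mul _ _) (T.map_congr (fun m w => (hZ m w).1) W)
  have c4 : T.mul (T.map (fun _ z => z.1.2) (T.mul (T.map Z W))) = D := by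
    rw [T.map_mul, T.mul_mul, T.map_map, T.map_map]
    exact (congrArg (@T.mul _ _) (T.map_congr (fun m w => (hZ m w).2) W)).trans w2
  -- the value of the composite of a pair
  have iA := fun m w => map_fst_cods_eq_dom (Z m w) (fun _ z => z.1.1) (fun _ z => z.1.2) (fun _ z => z.2)
    w.1.1.1.1 w.1.1.1.2 w.1.1.2 (hZ m w).1
  have iB := fun m w => src_eq_act_map_snd_cods (Z m w) (fun _ z => z.1.1) (fun _ z => z.1.2) w.1.2
    (𝒮.id (𝒮.act (T.map (fun _ x => x.2) w.1.2))) (𝒮.src_id _) (hZ m w).2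
  have iC : ∀ m w, T.map B.cod (T.map (fun _ z => z.1.1.fn z.1.2 (𝒮.id (𝒮.act (T.map
      (fun _ x => x.2) z.1.2))) z.2 (𝒮.src_id _)) (Z m w)) =
      B.dom (w.1.1.1.2.fn _ _ (iA m w) (iB m w)) := fun m w => by
    rw [dom_fn, T.map_map, T.map_map]
    refine T.map_congr (fun _ z => ?_) _
    exact cod_fn_id _ _ _ _ _
  have iE := fun m w => compFn_eq (Z m w) (fun _ z => z.1.1) (fun _ z => z.1.2) (fun _ z => z.2)
    w.1.1.1.1 w.1.1.1.2 w.1.1.2 w.1.2 (𝒮.id (𝒮.act (T.map (fun _ x => x.2) w.1.2)))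
    w.2 (𝒮.src_id _) (hZ m w).1 (hZ m w).2 (iA m w) (iB m w) (iC m w)
  -- the left hand side
  have lA := map_fst_cods_eq_dom W (fun _ w => comp w.1.1.1.1 w.1.1.1.2 w.1.1.2) (fun _ w => w.1.2)
    (fun _ w => w.2) _ g h₁ c1
  have lB := src_eq_act_map_snd_cods W (fun _ w => comp w.1.1.1.1 w.1.1.1.2 w.1.1.2) (fun _ w => w.1.2) D α hα w2
  have lC : T.map B.cod (T.map (fun _ w => (comp w.1.1.1.1 w.1.1.1.2 w.1.1.2).fn w.1.2
      (𝒮.id (𝒮.act (T.map (fun _ x => x.2) w.1.2))) w.2 (𝒮.src_id _)) W) =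
      B.dom (g.fn _ α lA lB) := by
    rw [dom_fn, T.map_map, T.map_map]
    refine T.map_congr (fun _ z => ?_) _
    exact cod_fn_id _ _ _ _ _
  have lE := compFn_eq W (fun _ w => comp w.1.1.1.1 w.1.1.1.2 w.1.1.2) (fun _ w => w.1.2)
    (fun _ w => w.2) _ g h₁ D α hD hα c1 w2 lA lB lC
  -- the right hand side
  have rA := map_fst_cods_eq_dom (T.mul (T.map Z W)) (fun _ z => z.1.1) (fun _ z => z.1.2) (fun _ z => z.2)
    _ _ h₃ c3
  have rB := src_eq_act_map_snd_cods (T.mul (T.map Z W)) (fun _ z => z.1.1) (fun _ z => z.1.2) D α hα c4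
  have rC : T.map B.cod (T.map (fun _ z => z.1.1.fn z.1.2 (𝒮.id (𝒮.act (T.map
      (fun _ x => x.2) z.1.2))) z.2 (𝒮.src_id _)) (T.mul (T.map Z W))) =
      B.dom ((comp (T.map (fun _ p => p.1.2) Ω) g h₂).fn _ α rA rB) := by
    rw [dom_fn, T.map_map, T.map_map]
    refine T.map_congr (fun _ z => ?_) _
    exact cod_fn_id _ _ _ _ _
  have rE := compFn_eq (T.mul (T.map Z W)) (fun _ z => z.1.1) (fun _ z => z.1.2) (fun _ z => z.2)
    (T.mul (T.map (fun _ p => p.1.1) Ω)) (comp (T.map (fun _ p => p.1.2) Ω) g h₂) (by exact h₃) D α (by exact hD') hα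
    c3 c4 rA rB rC
  -- the inner part of the right hand side
  have hq : T.mul (T.map (fun m w => T.map (fun _ z => (z.1.1.cod,
      𝒮.act (T.map (fun _ x => x.2) z.1.2))) (Z m w)) W) =
      T.map (fun _ z => (z.1.1.cod, 𝒮.act (T.map (fun _ x => x.2) z.1.2))) (T.mul (T.map Z W)) := by
    rw [T.map_mul, T.map_map]
  have jg : T.map (fun m w => (w.1.1.1.2.cod, 𝒮.act (T.map (fun _ x => x.2) (T.map (fun _ z =>
      (z.1.1.cod, 𝒮.act (T.map (fun _ x => x.2) z.1.2))) (Z m w))))) W =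
      T.map (fun _ w => ((comp w.1.1.1.1 w.1.1.1.2 w.1.1.2).cod,
        𝒮.act (T.map (fun _ x => x.2) w.1.2))) W :=
    T.map_congr (fun m w => by rw [hZa]; rfl) W
  have jA := map_fst_cods_eq_dom W (fun _ w => w.1.1.1.2) (fun m w => T.map (fun _ z => (z.1.1.cod,
      𝒮.act (T.map (fun _ x => x.2) z.1.2))) (Z m w)) iA _ g h₂ c2
  have jB := src_eq_act_map_snd_cods W (fun _ w => w.1.1.1.2) (fun m w => T.map (fun _ z => (z.1.1.cod,
      𝒮.act (T.map (fun _ x => x.2) z.1.2))) (Z m w)) _ α rB hq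
  have jC : T.map B.cod (T.map (fun m w => w.1.1.1.2.fn _ (𝒮.id _) (iA m w) (𝒮.src_id _)) W) =
      B.dom (g.fn _ α jA jB) := by
    rw [dom_fn, T.map_map, T.map_map]
    refine T.map_congr (fun _ z => ?_) _
    exact cod_fn_id _ _ _ _ _
  have jE := compFn_eq W (fun _ w => w.1.1.1.2) (fun m w => T.map (fun _ z => (z.1.1.cod,
      𝒮.act (T.map (fun _ x => x.2) z.1.2))) (Z m w)) iA _ g h₂ _ α rA rB c2 hq jA jB jC
  have iE' : ∀ m w, (comp w.1.1.1.1 w.1.1.1.2 w.1.1.2).fn w.1.2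
      (𝒮.id (𝒮.act (T.map (fun _ x => x.2) w.1.2))) w.2 (𝒮.src_id _) =
      B.comp (T.map (fun _ z => z.1.1.fn z.1.2 (𝒮.id (𝒮.act (T.map
      (fun _ x => x.2) z.1.2))) z.2 (𝒮.src_id _)) (Z m w))
      (w.1.1.1.2.fn _ (𝒮.id _) (iA m w) (𝒮.src_id _)) (by
        rw [iC]; exact congrArg (@B.dom m) (fn_congr rfl rfl (by rw [hZa]) _ _ _ _)) :=
    fun m w => (iE m w).trans (B.comp_congr rfl (fn_congr rfl rfl (by rw [hZa]) _ _ _ _) _ _)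
  have k1 : T.map B.cod (T.mul (T.map (fun m w => T.map (fun _ z => z.1.1.fn z.1.2 (𝒮.id (𝒮.act
      (T.map (fun _ x => x.2) z.1.2))) z.2 (𝒮.src_id _)) (Z m w)) W)) = B.dom (B.comp _ _ jC) := by
    rw [← jE]
    refine Eq.trans ?_ rC
    simp only [T.map_mul, T.map_map]
  have a1 := fun m w => (iC m w).trans (congrArg (@B.dom m) (fn_congr rfl rfl
    (congrArg (@𝒮.id m) (hZa m w).symm) _ _ (iA m w) (𝒮.src_id _)))
  have a2 := ((congrArg (fun t => T.map B.cod t) (T.map_congr iE' W)).symm.trans lC).trans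
    (congrArg (@B.dom n) (fn_congr rfl jg.symm rfl lA lB jA jB))
  refine lE.trans (Eq.trans ?_ rE.symm)
  refine (B.comp_congr (T.map_congr iE' W) (fn_congr rfl jg.symm rfl lA lB jA jB) lC a2).trans
    ((B.assoc_map W (fun m w => T.map (fun _ z => z.1.1.fn z.1.2 (𝒮.id (𝒮.act
    (T.map (fun _ x => x.2) z.1.2))) z.2 (𝒮.src_id _)) (Z m w)) (fun m w => w.1.1.1.2.fn _
    (𝒮.id _) (iA m w) (𝒮.src_id _)) a1 (g.fn _ α jA jB) a2 jC k1).trans ?_)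
  refine B.comp_congr ?_ jE.symm _ _
  rw [T.map_mul, T.map_map]

end ExpArr

/-- The exponential of `B` by the underlying multicategory of `𝒮`. -/
noncomputable def exp (𝒮 : StrucCat.{u, v}) (B : T2Multicat.{w, w'}) :
    T2Multicat.{max u v w w', max u v w w'} where
  Obj := 𝒮.ExpObj B
  Arr := 𝒮.ExpArr B
  dom _ f := f.dom
  cod _ f := f.cod
  id _ F := ExpArr.id F
  comp _ Θ g h := ExpArr.comp Θ g h
  dom_id _ := rfl
  cod_id _ := rfl
  dom_comp _ _ _ := rfl
  cod_comp _ _ _ := rfl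
  id_comp f h := ExpArr.comp_unit_id f h
  comp_id f h := ExpArr.comp_map_id f h
  assoc Ω g h₁ h₂ h₃ := ExpArr.comp_assoc Ω g h₁ h₂ h₃

end StrucCat

/-- Pulling `D` back along `f` attaches its second components to the vertices of `t`. -/
theorem T.exists_zip {A : ℕ → Type u} {B : ℕ → Type v} {S : ℕ → Type w} (f : ∀ ⦃n⦄, A n → B n)
    {n : ℕ} (t : T A n) (D : T (fun m => B m × S m) n)
    (h : T.map (fun _ x => x.1) D = T.map f t) :
    ∃ P : T (fun m => A m × S m) n,
      T.map (fun _ x => x.1) P = t ∧ T.map (fun _ x => (f x.1, x.2)) P = D := by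
  obtain ⟨P, h1, h2⟩ := T.exists_pullback f (fun _ x => x.1) t D h.symm
  refine ⟨T.map (fun _ y => (y.1.1, y.1.2.2)) P, ?_, ?_⟩
  · rw [T.map_map]; exact h1
  · rw [T.map_map, ← h2]
    refine T.map_congr (fun _ y => ?_) P
    exact Prod.ext y.2 rfl

/-! ### Evaluation -/

namespace StrucCat
variable {𝒮 : StrucCat.{u, v}} {B : T2Multicat.{w, w'}}

/-- Evaluation. -/
noncomputable def expEval (𝒮 : StrucCat.{u, v}) (B : T2Multicat.{w, w'}) :
    T2Multicat.Hom ((𝒮.exp B).prod 𝒮.toMulticat) B where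
  obj _ x := x.1.obj x.2
  arr _ p := ExpArr.fn p.fst p.dom p.snd.arr p.dom_fst
    (p.snd.src_arr.trans (congrArg (fun t => 𝒮.act t) p.dom_snd.symm))
  dom_arr p := ExpArr.dom_fn _ _ _ _ _
  cod_arr p := ExpArr.cod_fn _ _ _ _ _
  arr_id x := x.1.arr_id x.2
  arr_comp {n} Θ g h h' := by
    have e : T.map (fun _ (p : T2Multicat.ProdArr (𝒮.exp B) 𝒮.toMulticat _) =>
        (ExpArr.cod p.fst, 𝒮.tgt p.snd.arr)) Θ = g.dom := h
    have k : 𝒮.tgt (𝒮.actArr (T.map (fun _ (p : T2Multicat.ProdArr (𝒮.exp B) 𝒮.toMulticat _) =>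
        p.snd.arr) Θ)) = 𝒮.src g.snd.arr := by
      rw [𝒮.tgt_actArr, g.snd.src_arr]
      refine congrArg (fun t => 𝒮.act t) (Eq.trans ?_ g.dom_snd)
      exact (T.eq_map_map (by intros; rfl) Θ).symm.trans
        ((T.eq_map_map (by intros; rfl) Θ).trans (congrArg (fun t => T.map (fun _ (x : 𝒮.ExpObj B _ × 𝒮.Obj _) => x.2) t) e))
    have hs := fun m (p : T2Multicat.ProdArr (𝒮.exp B) 𝒮.toMulticat m) =>
      p.snd.src_arr.trans (congrArg (fun t => 𝒮.act t) p.dom_snd.symm)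
    let c := ((𝒮.exp B).prod 𝒮.toMulticat).comp Θ g h
    -- A composite in the product comes with its arrow of `𝒮` factored as that of `g` after the
    -- action of the inner ones, which is the freedom allowed by `compFn_comp`.
    refine Eq.trans ?_ ((ExpArr.compFn_comp Θ (fun _ p => p.fst) (fun _ p => p.dom)
      (fun _ p => p.snd.arr) (fun _ p => p.dom_fst) hs (T.map (fun _ p => p.fst) Θ) g.fst
      (by exact T2Multicat.ProdArr.map_cod_fst Θ g h) c.dom g.snd.arr k (by exact c.dom_fst)
      ?_ rfl rfl (by exact (congrArg (fun t => T.map (fun _ (x : 𝒮.ExpObj B _ × 𝒮.Obj _) => x.1) t) e).trans g.dom_fst)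
      ((hs n g).trans (congrArg (fun t => 𝒮.act (T.map (fun _ x => x.2) t)) e.symm)) ?_).trans ?_)
    · refine ExpArr.compFn_congr _ _ _ rfl (𝒮.comp_congr rfl ?_ _ _) (by exact c.dom_fst) (hs n c) _ _
      exact congrArg (fun t => 𝒮.actArr t) (T.eq_map_map (by intros; rfl) Θ).symm
    · refine Eq.trans (congrArg (fun t => 𝒮.src t) ?_)
        (c.snd.src_arr.trans (congrArg (fun t => 𝒮.act t) c.dom_snd.symm))
      refine 𝒮.comp_congr rfl ?_ _ _
      exact congrArg (fun t => 𝒮.actArr t) (T.eq_map_map (by intros; rfl) Θ)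
    · refine h'.trans (congrArg (@B.dom n) (ExpArr.fn_congr rfl e.symm rfl _ _ _ _))
    · exact B.comp_congr rfl (ExpArr.fn_congr rfl e rfl _ _ _ _) _ _

end StrucCat

/-! ### Construction of the transpose -/

namespace T2Multicat.Hom
variable {𝒮 : StrucCat.{u, v}} {B : T2Multicat.{w, w'}} {Z : T2Multicat.{z, z'}}

/-- The value of a map out of a product with the multicategory of `𝒮` at an arrow `f` of `Z` and an
arrow `α` of `𝒮`; the tree `P` of pairs is that of the domain. -/
def app (G : Hom (Z.prod 𝒮.toMulticat) B) {n : ℕ} (P : T (fun m => Z.Obj m × 𝒮.Obj m) n)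
    (f : Z.Arr n) (α : 𝒮.Arr n) (h : T.map (fun _ x => x.1) P = Z.dom f)
    (h' : 𝒮.src α = 𝒮.act (T.map (fun _ x => x.2) P)) : B.Arr n :=
  G.arr (n := n) ⟨P, f, ⟨T.map (fun _ x => x.2) P, α, h'⟩, h, rfl⟩

variable (G : Hom (Z.prod 𝒮.toMulticat) B)

/-- The domain stored in the second component is forced by the tree of pairs, so `app` loses
nothing. -/
theorem arr_eq_app {n : ℕ} (p : ProdArr Z 𝒮.toMulticat n) :
    G.arr p = G.app p.dom p.fst p.snd.arr p.dom_fst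
      (p.snd.src_arr.trans (congrArg (fun t => 𝒮.act t) p.dom_snd.symm)) := by
  obtain ⟨P, f, ⟨D, α, hα⟩, h, hD⟩ := p
  have hD' : T.map (fun _ x => x.2) P = D := hD
  subst hD'
  rfl

theorem app_congr {n : ℕ} {P P' : T (fun m => Z.Obj m × 𝒮.Obj m) n} {f f' : Z.Arr n}
    {α α' : 𝒮.Arr n} (hP : P = P') (hf : f = f') (hα : α = α') (h₁ h₂ h₃ h₄) :
    G.app P f α h₁ h₂ = G.app P' f' α' h₃ h₄ := by
  subst hP hf hα; rfl

theorem dom_app {n : ℕ} (P : T (fun m => Z.Obj m × 𝒮.Obj m) n)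
    (f : Z.Arr n) (α : 𝒮.Arr n) (h h') :
    B.dom (G.app P f α h h') = T.map (fun _ x => G.obj x) P := G.dom_arr _

theorem cod_app {n : ℕ} (P : T (fun m => Z.Obj m × 𝒮.Obj m) n)
    (f : Z.Arr n) (α : 𝒮.Arr n) (h h') :
    B.cod (G.app P f α h h') = G.obj (Z.cod f, 𝒮.tgt α) := G.cod_arr _

theorem app_id {n : ℕ} (x : Z.Obj n) (τ : 𝒮.Obj n) (h h') :
    G.app (T.unit (x, τ)) (Z.id x) (𝒮.id τ) h h' = B.id (G.obj (x, τ)) := G.arr_id (x, τ)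

/-- Preservation of composition, with the inner arrows indexed by an arbitrary tree so that it fits
any splitting. -/
theorem app_comp {I : ℕ → Type v'} {n : ℕ} (W : T I n)
    (P : ∀ ⦃m⦄, I m → T (fun m => Z.Obj m × 𝒮.Obj m) m) (f : ∀ ⦃m⦄, I m → Z.Arr m)
    (a : ∀ ⦃m⦄, I m → 𝒮.Arr m) (h : ∀ ⦃m⦄ (i : I m), T.map (fun _ x => x.1) (P i) = Z.dom (f i))
    (h' : ∀ ⦃m⦄ (i : I m), 𝒮.src (a i) = 𝒮.act (T.map (fun _ x => x.2) (P i)))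
    (Q : T (fun m => Z.Obj m × 𝒮.Obj m) n) (g : Z.Arr n) (β : 𝒮.Arr n)
    (k : T.map (fun _ x => x.1) Q = Z.dom g) (k' : 𝒮.src β = 𝒮.act (T.map (fun _ x => x.2) Q))
    (e : T.map (fun _ i => (Z.cod (f i), 𝒮.tgt (a i))) W = Q)
    (R : T (fun m => Z.Obj m × 𝒮.Obj m) n) (hR : T.mul (T.map P W) = R)
    (l₁ l₂ l₃ l₄ l₅) :
    G.app R (Z.comp (T.map f W) g l₁) (𝒮.comp β (𝒮.actArr (T.map a W)) l₂) l₃ l₄ =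
      B.comp (T.map (fun _ i => G.app (P i) (f i) (a i) (h i) (h' i)) W) (G.app Q g β k k') l₅ := by
  subst e hR
  let p : ∀ ⦃m⦄, I m → ProdArr Z 𝒮.toMulticat m := fun m i =>
    ⟨P i, f i, ⟨T.map (fun _ x => x.2) (P i), a i, h' i⟩, h i, rfl⟩
  have := G.arr_comp (n := n) (T.map p W) ⟨_, g, ⟨_, β, k'⟩, k, rfl⟩
    (T.eq_map_map (by intros; rfl) W).symm
    ((congrArg (fun t => T.map B.cod t) (T.eq_map_map (by intros; rfl) W).symm).trans l₅)
  refine Eq.trans ?_ (this.trans ?_)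
  · unfold app
    refine congrArg (@G.arr n) (ProdArr.ext ?_ ?_ ?_)
    · exact congrArg (@T.mul _ _) (T.eq_map_map (by intros; rfl) W)
    · exact Z.comp_congr (T.eq_map_map (by intros; rfl) W) rfl _ _
    · refine StrucCat.MultiArr.ext ?_ ?_
      · refine (T.map_mul _ _).trans (congrArg (@T.mul _ _) ?_)
        refine (T.map_map _ _ _).trans ?_
        exact (T.eq_map_map (f := fun m i => (p i).snd) (g := fun _ q => q.dom) (by intros; rfl)
          W).trans (congrArg (fun t => T.map _ t) (T.eq_map_map (by intros; rfl) W))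
      · refine 𝒮.comp_congr rfl (congrArg (@𝒮.actArr n) ?_) _ _
        exact (T.eq_map_map (f := fun m i => (p i).snd) (g := fun _ q => q.arr) (by intros; rfl)
          W).trans (congrArg (fun t => T.map _ t) (T.eq_map_map (by intros; rfl) W))
  · exact B.comp_congr (T.eq_map_map (by intros; rfl) W).symm rfl _ _

/-- The functor that the transpose of `G` assigns to an object. -/
def curryObj {n : ℕ} (x : Z.Obj n) : 𝒮.ExpObj B n where
  obj τ := G.obj (x, τ)
  arr α := G.app (T.unit (x, 𝒮.src α)) (Z.id x) α (Z.dom_id _).symm (𝒮.act_unit _).symm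
  dom_arr α := G.dom_app _ _ _ _ _
  cod_arr α := (G.cod_app _ _ _ _ _).trans (by rw [Z.cod_id])
  arr_id τ := by
    rw [← G.app_id x τ (Z.dom_id _).symm (by rw [𝒮.src_id]; exact (𝒮.act_unit _).symm)]
    exact G.app_congr (by rw [𝒮.src_id]) rfl rfl _ _ _ _
  arr_comp β α h h' := by
    have e : T.map Z.cod (T.unit (Z.id x)) = Z.dom (Z.id x) := by
      rw [T.map_unit, Z.cod_id, Z.dom_id]
    -- An identity of `Z` composed with itself is that identity, so composing in the product
    -- composes in `𝒮` alone.
    have e' : Z.comp (T.unit (Z.id x)) (Z.id x) e = Z.id x :=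
      (Z.comp_congr rfl (by rw [Z.cod_id]) _ (by rw [T.map_unit, Z.dom_id])).trans
        (Z.id_comp (Z.id x) (by rw [T.map_unit, Z.dom_id]))
    have := G.app_comp (I := fun m => Z.Obj m × 𝒮.Arr m) (T.unit (x, α))
      (fun _ y => T.unit (y.1, 𝒮.src y.2)) (fun _ y => Z.id y.1)
      (fun _ y => y.2) (fun _ _ => (Z.dom_id _).symm) (fun _ _ => (𝒮.act_unit _).symm)
      (T.unit (x, 𝒮.src β)) (Z.id x) β (Z.dom_id _).symm (𝒮.act_unit _).symm
      (by rw [T.map_unit, Z.cod_id, h]) (T.unit (x, 𝒮.src α)) (T.mul_unit _) e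
      (by rw [T.map_unit, 𝒮.actArr_unit, h])
      (by exact (congrArg (@Z.dom n) e').trans (Z.dom_id _) |>.symm) (by
        rw [𝒮.src_comp, T.map_unit, T.map_unit, 𝒮.actArr_unit, 𝒮.act_unit]) h'
    refine Eq.trans ?_ this
    refine G.app_congr (by rw [𝒮.src_comp]) e'.symm (𝒮.comp_congr rfl ?_ _ _) _ _ _ _
    rw [T.map_unit, 𝒮.actArr_unit]

/-- Different objects of `Z` may give the same functor, so `D` alone does not name objects of `Z`;
the domain of `f` supplies them. -/
theorem exists_curry {n : ℕ} (f : Z.Arr n) (D : T (fun m => 𝒮.ExpObj B m × 𝒮.Obj m) n)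
    (h : T.map (fun _ x => x.1) D = T.map (fun _ x => G.curryObj x) (Z.dom f)) :
    ∃ P : T (fun m => Z.Obj m × 𝒮.Obj m) n, T.map (fun _ x => x.1) P = Z.dom f ∧
      T.map (fun _ x => (G.curryObj x.1, x.2)) P = D :=
  T.exists_zip (fun _ x => G.curryObj x) (Z.dom f) D h

theorem snd_curry {n : ℕ} {D : T (fun m => 𝒮.ExpObj B m × 𝒮.Obj m) n}
    {P : T (fun m => Z.Obj m × 𝒮.Obj m) n} {α : 𝒮.Arr n}
    (h : T.map (fun _ x => (G.curryObj x.1, x.2)) P = D)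
    (h' : 𝒮.src α = 𝒮.act (T.map (fun _ x => x.2) D)) :
    𝒮.src α = 𝒮.act (T.map (fun _ x => x.2) P) := by
  rw [h', ← h, T.map_map]

/-- The transpose of `G` on arrows. -/
noncomputable def curryFn {n : ℕ} (f : Z.Arr n) (D : T (fun m => 𝒮.ExpObj B m × 𝒮.Obj m) n)
    (α : 𝒮.Arr n) (h : T.map (fun _ x => x.1) D = T.map (fun _ x => G.curryObj x) (Z.dom f))
    (h' : 𝒮.src α = 𝒮.act (T.map (fun _ x => x.2) D)) : B.Arr n :=
  G.app (G.exists_curry f D h).choose f α (G.exists_curry f D h).choose_spec.1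
    (G.snd_curry (G.exists_curry f D h).choose_spec.2 h')

/-- The lift `P` is unique: its first components are fixed by the domain of `f`, its second ones by
`D`. -/
theorem curryFn_eq {n : ℕ} (f : Z.Arr n) (D : T (fun m => 𝒮.ExpObj B m × 𝒮.Obj m) n)
    (α : 𝒮.Arr n) (h h') (P : T (fun m => Z.Obj m × 𝒮.Obj m) n)
    (h₁ : T.map (fun _ x => x.1) P = Z.dom f)
    (h₂ : T.map (fun _ x => (G.curryObj x.1, x.2)) P = D) (h₃) :
    G.curryFn f D α h h' = G.app P f α h₁ h₃ := by
  unfold curryFn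
  refine G.app_congr ?_ rfl rfl _ _ _ _
  have s := (G.exists_curry f D h).choose_spec
  refine T.pair_ext (fun _ x => x.1) (fun _ x => x.2) (fun _ _ _ => Prod.ext) _ _
    (s.1.trans h₁.symm) ?_
  have := congrArg (fun t => T.map (fun _ x => x.2) t) (s.2.trans h₂.symm)
  simpa only [T.map_map] using this

theorem dom_curryFn {n : ℕ} (f : Z.Arr n) (D : T (fun m => 𝒮.ExpObj B m × 𝒮.Obj m) n)
    (α : 𝒮.Arr n) (h h') : B.dom (G.curryFn f D α h h') = T.map (fun _ x => x.1.obj x.2) D := by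
  obtain ⟨P, p1, p2⟩ := G.exists_curry f D h
  rw [G.curryFn_eq f D α h h' P p1 p2 (G.snd_curry p2 h'), dom_app, ← p2, T.map_map]
  rfl

/-- In the product, `(f, β ∘ α)` is `(f, α)` followed by an identity of `Z` paired with `β`. -/
theorem curryFn_nat_cod {n : ℕ} (f : Z.Arr n) (D : T (fun m => 𝒮.ExpObj B m × 𝒮.Obj m) n)
    (α β : 𝒮.Arr n) (h h') (e : 𝒮.tgt α = 𝒮.src β) (e₁)
    (e₂ : T.map B.cod (T.unit (G.curryFn f D α h h')) = B.dom ((G.curryObj (Z.cod f)).arr β)) :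
    G.curryFn f D (𝒮.comp β α e) h e₁ =
      B.comp (T.unit (G.curryFn f D α h h')) ((G.curryObj (Z.cod f)).arr β) e₂ := by
  obtain ⟨P, p1, p2⟩ := G.exists_curry f D h
  have p3 := G.snd_curry p2 h'
  have e3 : Z.comp (T.unit f) (Z.id (Z.cod f)) (Z.dom_id _).symm = f := Z.id_comp f _
  have q := G.curryFn_eq f D α h h' P p1 p2 p3
  have e4 : T.map B.cod (T.unit (G.app P f α p1 p3)) = B.dom ((G.curryObj (Z.cod f)).arr β) := by
    rw [← q, e₂]
  have hc : 𝒮.actArr (T.unit α) = α := 𝒮.actArr_unit α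
  have := G.app_comp (I := fun m => {y : Z.Arr m × 𝒮.Arr m × T (fun m => Z.Obj m × 𝒮.Obj m) m //
      T.map (fun _ x => x.1) y.2.2 = Z.dom y.1 ∧ 𝒮.src y.2.1 = 𝒮.act (T.map (fun _ x => x.2) y.2.2)})
    (T.unit ⟨(f, α, P), p1, p3⟩) (fun _ y => y.1.2.2) (fun _ y => y.1.1) (fun _ y => y.1.2.1)
    (fun _ y => y.2.1) (fun _ y => y.2.2) (T.unit (Z.cod f, 𝒮.src β)) (Z.id (Z.cod f)) β
    (Z.dom_id _).symm (𝒮.act_unit _).symm (by rw [T.map_unit, e]) P (T.mul_unit P)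
    (Z.dom_id _).symm ((congrArg (@𝒮.tgt n) hc).trans e)
    (p1.trans (congrArg (@Z.dom n) e3).symm)
    ((𝒮.src_comp _ _ _).trans ((congrArg (@𝒮.src n) hc).trans p3)) e4
  refine (G.curryFn_eq f D _ h e₁ P p1 p2 (G.snd_curry p2 e₁)).trans (Eq.trans ?_ (this.trans ?_))
  · exact G.app_congr rfl e3.symm (𝒮.comp_congr rfl hc.symm _ _) _ _ _ _
  · exact B.comp_congr (congrArg (@T.unit B.Arr n) q.symm) rfl _ _

/-- Here `f` is written as itself after the identities of its domain, each paired with the matching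
arrow of `W`. -/
theorem curryFn_nat_dom {n : ℕ} (f : Z.Arr n) (W : T (fun m => 𝒮.ExpObj B m × 𝒮.Arr m) n)
    (β : 𝒮.Arr n) (e : 𝒮.tgt (𝒮.actArr (T.map (fun _ x => x.2) W)) = 𝒮.src β) (h₁ h₂ h₃ h₄)
    (h₅ : T.map B.cod (T.map (fun _ x => x.1.arr x.2) W) =
      B.dom (G.curryFn f (T.map (fun _ x => (x.1, 𝒮.tgt x.2)) W) β h₂ h₄)) :
    G.curryFn f (T.map (fun _ x => (x.1, 𝒮.src x.2)) W)
      (𝒮.comp β (𝒮.actArr (T.map (fun _ x => x.2) W)) e) h₁ h₃ =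
      B.comp (T.map (fun _ x => x.1.arr x.2) W)
        (G.curryFn f (T.map (fun _ x => (x.1, 𝒮.tgt x.2)) W) β h₂ h₄) h₅ := by
  obtain ⟨P, p1, p2⟩ := T.exists_zip (fun _ x => G.curryObj x) (Z.dom f) W
    (by rw [← h₁, T.map_map])
  have c1 : T.map (fun _ x => x.1) (T.map (fun _ x => (x.1, 𝒮.src x.2)) P) = Z.dom f := by
    rw [T.map_map]; exact p1
  have c2 : T.map (fun _ x => (G.curryObj x.1, x.2)) (T.map (fun _ x => (x.1, 𝒮.src x.2)) P) =
      T.map (fun _ x => (x.1, 𝒮.src x.2)) W := by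
    rw [T.map_map, ← p2, T.map_map]
  have d1 : T.map (fun _ x => x.1) (T.map (fun _ x => (x.1, 𝒮.tgt x.2)) P) = Z.dom f := by
    rw [T.map_map]; exact p1
  have d2 : T.map (fun _ x => (G.curryObj x.1, x.2)) (T.map (fun _ x => (x.1, 𝒮.tgt x.2)) P) =
      T.map (fun _ x => (x.1, 𝒮.tgt x.2)) W := by
    rw [T.map_map, ← p2, T.map_map]
  have c3 := G.snd_curry c2 h₃
  have d3 := G.snd_curry d2 h₄
  have q := G.curryFn_eq f _ β h₂ h₄ _ d1 d2 d3
  have ha : T.map (fun _ x => x.2) W = T.map (fun _ x => x.2) P := by rw [← p2, T.map_map]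
  have hf : T.map (fun _ (x : Z.Obj _ × 𝒮.Arr _) => Z.id x.1) P = T.map Z.id (Z.dom f) := by
    rw [← p1, T.map_map]
  have hr : T.map (fun _ x => x.1.arr x.2) W =
      T.map (fun _ x => (G.curryObj x.1).arr x.2) P := by rw [← p2, T.map_map]
  have l : T.map Z.cod (T.map (fun _ (x : Z.Obj _ × 𝒮.Arr _) => Z.id x.1) P) = Z.dom f := by
    rw [hf, T.map_map]; simp only [Z.cod_id]; exact T.map_id _
  have l' : T.map Z.cod (T.map Z.id (Z.dom f)) = Z.dom f := by rw [← hf, l]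
  have e3 : Z.comp _ f l = f := (Z.comp_congr hf rfl _ l').trans (Z.comp_id f l')
  have := G.app_comp P (fun _ x => T.unit (x.1, 𝒮.src x.2)) (fun _ x => Z.id x.1) (fun _ x => x.2)
    (fun _ _ => (Z.dom_id _).symm) (fun _ _ => (𝒮.act_unit _).symm)
    (T.map (fun _ x => (x.1, 𝒮.tgt x.2)) P) f β d1 d3 (by simp only [Z.cod_id])
    (T.map (fun _ x => (x.1, 𝒮.src x.2)) P)
    ((congrArg (@T.mul _ n) (T.eq_map_map (by intros; rfl) P)).trans (T.mul_map_unit _))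
    l (by rw [← ha, e]) (by rw [e3]; exact c1) (by rw [𝒮.src_comp, ← ha, ← 𝒮.src_comp β _ e, c3])
    (by rw [← q, ← h₅, hr]; rfl)
  refine (G.curryFn_eq f _ _ h₁ h₃ _ c1 c2 c3).trans (Eq.trans ?_ (this.trans ?_))
  · exact G.app_congr rfl e3.symm (𝒮.comp_congr rfl (by rw [ha]) _ _) _ _ _ _
  · exact B.comp_congr hr.symm q.symm _ _

/-- The transpose of `G` on arrows. -/
noncomputable def curryArr {n : ℕ} (f : Z.Arr n) : 𝒮.ExpArr B n where
  dom := T.map (fun _ x => G.curryObj x) (Z.dom f)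
  cod := G.curryObj (Z.cod f)
  fn := G.curryFn f
  dom_fn := G.dom_curryFn f
  cod_fn _ _ _ _ := G.cod_app _ _ _ _ _
  nat_cod := G.curryFn_nat_cod f
  nat_dom := G.curryFn_nat_dom f

end T2Multicat.Hom

open StrucCat

/-! ### The transpose is a map, and the universal property -/

namespace T2Multicat
namespace Hom
variable {𝒮 : StrucCat.{u, v}} {B : T2Multicat.{w, w'}} {Z : T2Multicat.{z, z'}}
variable (G : Hom (Z.prod 𝒮.toMulticat) B)

theorem curryArr_id {n : ℕ} (x : Z.Obj n) : G.curryArr (Z.id x) = ExpArr.id (G.curryObj x) := by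
  have e : T.map (fun _ x => G.curryObj x) (Z.dom (Z.id x)) = T.unit (G.curryObj x) := by
    rw [Z.dom_id, T.map_unit]
  refine ExpArr.ext_fn e (congrArg (fun y => G.curryObj y) (Z.cod_id x)) fun D α hD hD' hα => ?_
  obtain ⟨⟨F, τ⟩, rfl, hF⟩ := T.eq_unit_of_map hD'
  refine G.curryFn_eq (Z.id x) _ α hD hα (T.unit (x, 𝒮.src α)) (Z.dom_id x).symm ?_
    (𝒮.act_unit _).symm
  rw [T.map_unit, hα, T.map_unit, 𝒮.act_unit, ← hF]

/-- Composition in the exponential evaluates the inner arrows at identities. Correspondingly, in the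
product the composite of the inner arrows paired with identities and of `g` paired with `α` is the
composite in `Z` paired with `α`. -/
theorem curryArr_comp {n : ℕ} (Θ : T Z.Arr n) (g : Z.Arr n) (h : T.map Z.cod Θ = Z.dom g)
    (h' : T.map (fun _ f => f.cod) (T.map (fun _ f => G.curryArr f) Θ) = (G.curryArr g).dom) :
    G.curryArr (Z.comp Θ g h) = ExpArr.comp (T.map (fun _ f => G.curryArr f) Θ) (G.curryArr g) h' := by
  have e : (G.curryArr (Z.comp Θ g h)).dom =
      T.mul (T.map (fun _ f => f.dom) (T.map (fun _ f => G.curryArr f) Θ)) := by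
    rw [T.map_map]
    change T.map (fun _ x => G.curryObj x) (Z.dom (Z.comp Θ g h)) = T.mul (T.map (fun _ f =>
      T.map (fun _ x => G.curryObj x) (Z.dom f)) Θ)
    rw [Z.dom_comp, T.map_mul, T.map_map]
  refine ExpArr.ext_fn e (congrArg (fun y => G.curryObj y) (Z.cod_comp Θ g h))
    fun D α hD hD' hα => ?_
  obtain ⟨P, p1, p2⟩ := G.exists_curry _ D hD
  have p3 := G.snd_curry p2 hα
  obtain ⟨W, ⟨w1, w2⟩, -⟩ := T.existsUnique_split (fun _ x => x.1) Z.dom Θ P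
    (p1.trans (Z.dom_comp Θ g h))
  have t1 : ∀ m (i : {z : Z.Arr m × T (fun m => Z.Obj m × 𝒮.Obj m) m //
      T.map (fun _ x => x.1) z.2 = Z.dom z.1}),
      T.map (fun _ x => x.1) (T.map (fun _ x => (G.curryObj x.1, x.2)) i.1.2) =
        T.map (fun _ x => G.curryObj x) (Z.dom i.1.1) := fun m i => by
    rw [← i.2, T.map_map, T.map_map]
  have t2 : ∀ m (i : {z : Z.Arr m × T (fun m => Z.Obj m × 𝒮.Obj m) m //
      T.map (fun _ x => x.1) z.2 = Z.dom z.1}),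
      𝒮.act (T.map (fun _ x => x.2) (T.map (fun _ x => (G.curryObj x.1, x.2)) i.1.2)) =
        𝒮.act (T.map (fun _ x => x.2) i.1.2) := fun m i => by rw [T.map_map]
  have w3 : T.mul (T.map (fun _ i => T.map (fun _ x => (G.curryObj x.1, x.2)) i.1.2) W) = D := by
    rw [← p2, ← w2, T.map_mul, T.map_map]
  have w4 : T.map (fun _ i => G.curryArr i.1.1) W = T.map (fun _ f => G.curryArr f) Θ := by
    rw [← w1, T.map_map]
  let Q : T (fun m => Z.Obj m × 𝒮.Obj m) n :=
    T.map (fun _ i => (Z.cod i.1.1, 𝒮.act (T.map (fun _ x => x.2) i.1.2))) W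
  have q1 : T.map (fun _ x => x.1) Q = Z.dom g := by
    rw [← h, ← w1, T.map_map, T.map_map]
  have q2 : T.map (fun _ x => x.2) Q = T.map (fun _ i => 𝒮.act (T.map (fun _ x => x.2) i.1.2)) W :=
    T.map_map _ _ _
  have q3 : 𝒮.src α = 𝒮.act (T.map (fun _ x => x.2) Q) := by
    rw [p3, ← w2, q2, T.map_mul, 𝒮.act_mul, T.map_map, T.map_map]
  have q4 : T.map (fun _ x => (G.curryObj x.1, x.2)) Q =
      T.map (fun _ i => ((G.curryArr i.1.1).cod, 𝒮.act (T.map (fun _ x => x.2)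
        (T.map (fun _ x => (G.curryObj x.1, x.2)) i.1.2)))) W := by
    refine (T.map_map _ _ _).trans (T.map_congr (fun _ i => ?_) W)
    rw [t2]; rfl
  have k1 : ∀ m (i : {z : Z.Arr m × T (fun m => Z.Obj m × 𝒮.Obj m) m //
      T.map (fun _ x => x.1) z.2 = Z.dom z.1}),
      G.curryFn i.1.1 _ (𝒮.id (𝒮.act (T.map (fun _ x => x.2)
        (T.map (fun _ x => (G.curryObj x.1, x.2)) i.1.2)))) (t1 m i) (𝒮.src_id _) =
      G.app i.1.2 i.1.1 (𝒮.id (𝒮.act (T.map (fun _ x => x.2) i.1.2))) i.2 (𝒮.src_id _) :=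
    fun m i => (G.curryFn_eq i.1.1 _ _ (t1 m i) (𝒮.src_id _) i.1.2 i.2 rfl
      ((𝒮.src_id _).trans (t2 m i))).trans (G.app_congr rfl rfl (by rw [t2]) _ _ _ _)
  have f3 := ExpArr.map_fst_cods_eq_dom W (fun _ i => G.curryArr i.1.1)
    (fun _ i => T.map (fun _ x => (G.curryObj x.1, x.2)) i.1.2) t1 _ (G.curryArr g) h' w4
  have f4 := ExpArr.src_eq_act_map_snd_cods W (fun _ i => G.curryArr i.1.1)
    (fun _ i => T.map (fun _ x => (G.curryObj x.1, x.2)) i.1.2) D α hα w3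
  have k2 : G.curryFn g _ α f3 f4 = G.app Q g α q1 q3 :=
    G.curryFn_eq g _ α f3 f4 Q q1 q4 q3
  have l1 : T.map B.cod (T.map (fun _ i => G.app i.1.2 i.1.1 (𝒮.id (𝒮.act (T.map (fun _ x => x.2)
      i.1.2))) i.2 (𝒮.src_id _)) W) = B.dom (G.app Q g α q1 q3) := by
    rw [dom_app, T.map_map]
    refine Eq.trans (T.map_congr (fun _ i => ?_) W) (T.map_map _ _ _).symm
    exact (G.cod_app _ _ _ _ _).trans (congrArg (fun τ => G.obj (_, τ)) (𝒮.tgt_id _))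
  have l2 : T.map B.cod (T.map (fun _ i => (G.curryArr i.1.1).fn _ (𝒮.id (𝒮.act (T.map
      (fun _ x => x.2) (T.map (fun _ x => (G.curryObj x.1, x.2)) i.1.2)))) (t1 _ i) (𝒮.src_id _)) W) =
      B.dom ((G.curryArr g).fn _ α f3 f4) :=
    (congrArg (fun t => T.map B.cod t) (T.map_congr k1 W)).trans
      (l1.trans (congrArg (@B.dom n) k2.symm))
  refine Eq.trans ?_ (ExpArr.compFn_eq W (fun _ i => G.curryArr i.1.1)
    (fun _ i => T.map (fun _ x => (G.curryObj x.1, x.2)) i.1.2) t1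
    (T.map (fun _ f => G.curryArr f) Θ) (G.curryArr g) h' D α hD' hα w4 w3 f3 f4 l2).symm
  refine Eq.trans ?_ (B.comp_congr (T.map_congr k1 W) k2 l2 l1).symm
  refine (G.curryFn_eq _ D α hD hα P p1 p2 p3).trans ?_
  have a1 : 𝒮.actArr (T.map (fun _ i => 𝒮.id (𝒮.act (T.map (fun _ x => x.2) i.1.2))) W) =
      𝒮.id (𝒮.src α) := by
    rw [q3, ← 𝒮.actArr_id, q2, T.map_map]
  have a2 : 𝒮.tgt (𝒮.actArr (T.map (fun _ i => 𝒮.id (𝒮.act (T.map (fun _ x => x.2) i.1.2))) W)) =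
      𝒮.src α := by rw [a1, 𝒮.tgt_id]
  have a3 : T.map Z.cod (T.map (fun _ i => i.1.1) W) = Z.dom g := by rw [w1, h]
  have a4 : Z.comp (T.map (fun _ i => i.1.1) W) g a3 = Z.comp Θ g h := Z.comp_congr w1 rfl _ _
  have := G.app_comp W (fun _ i => i.1.2) (fun _ i => i.1.1)
    (fun _ i => 𝒮.id (𝒮.act (T.map (fun _ x => x.2) i.1.2))) (fun _ i => i.2)
    (fun _ _ => 𝒮.src_id _) Q g α q1 q3 (T.map_congr (fun _ i => by rw [𝒮.tgt_id]) W) P w2 a3 a2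
    (by rw [a4, p1]) (by rw [𝒮.src_comp, a1, 𝒮.src_id, p3]) l1
  refine Eq.trans ?_ this
  refine G.app_congr rfl a4.symm ?_ _ _ _ _
  exact ((𝒮.comp_congr rfl a1 _ (𝒮.tgt_id _)).trans (𝒮.comp_id α (𝒮.tgt_id _))).symm

/-- The transpose of `G`. -/
noncomputable def curry : Hom Z (𝒮.exp B) where
  obj _ x := G.curryObj x
  arr _ f := G.curryArr f
  dom_arr _ := rfl
  cod_arr _ := rfl
  arr_id x := G.curryArr_id x
  arr_comp Θ g h h' := G.curryArr_comp Θ g h h'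

theorem expEval_curry : (expEval 𝒮 B).comp (prodMap G.curry 𝒮.toMulticat) = G := by
  refine Hom.ext rfl ?_
  funext n p
  refine Eq.trans ?_ (G.arr_eq_app p).symm
  let q := (prodMap G.curry 𝒮.toMulticat).arr p
  exact G.curryFn_eq p.fst _ p.snd.arr (by exact q.dom_fst)
    (q.snd.src_arr.trans (congrArg (fun t => 𝒮.act t) q.dom_snd.symm)) p.dom p.dom_fst rfl _

theorem eq_curry (H : Hom Z (𝒮.exp B)) :
    H = ((expEval 𝒮 B).comp (prodMap H 𝒮.toMulticat)).curry := by
  have ho : ∀ n (x : Z.Obj n), H.obj x =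
      ((expEval 𝒮 B).comp (prodMap H 𝒮.toMulticat)).curryObj x := fun n x => by
    refine ExpObj.ext rfl ?_
    funext α
    -- As `H` preserves identities and the identity of a functor `F` has values `F.arr α`, the arrow
    -- part of `H.obj x` is visible in the evaluation at the identity of `x`.
    refine Eq.symm ((ExpArr.fn_congr (H.arr_id x) rfl rfl _ _ ?_ ?_).trans rfl)
    · rfl
    · exact (𝒮.act_unit _).symm
  have ho' : H.obj = fun n x => ((expEval 𝒮 B).comp (prodMap H 𝒮.toMulticat)).curryObj x := by
    funext n x; exact ho n x
  refine Hom.ext ho' ?_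
  funext n f
  refine ExpArr.ext_fn ((H.dom_arr f).trans (T.map_congr ho _)) ((H.cod_arr f).trans (ho _ _))
    fun D α h h' k => ?_
  obtain ⟨P, p1, p2⟩ := exists_curry _ f D h'
  refine Eq.trans ?_ (curryFn_eq _ f D α h' k P p1 p2 (snd_curry _ p2 k)).symm
  refine ExpArr.fn_congr rfl (p2.symm.trans (T.map_congr (fun _ x => ?_) P)) rfl _ _ _ _
  exact Prod.ext (ho _ _).symm rfl

end Hom

theorem comp_prodMap_comp.{x, y} {A : T2Multicat.{u, v}} {B : T2Multicat.{w, w'}}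
    {Z : T2Multicat.{x, y}} {E E' : T2Multicat.{z, z'}} (ev : Hom (E'.prod A) B) (K : Hom E E') (H : Hom Z E) :
    (ev.comp (prodMap K A)).comp (prodMap H A) = ev.comp (prodMap (K.comp H) A) := by
  refine Hom.ext rfl ?_
  funext n p
  refine congrArg (@ev.arr n) (ProdArr.ext ?_ rfl rfl)
  exact T.map_map _ _ _

theorem isExponential_expEval (𝒮 : StrucCat.{u, v}) (B : T2Multicat.{w, w'}) :
    IsExponential (𝒮.exp B) (expEval 𝒮 B) where
  existsUnique_transpose Z G := by
    refine ⟨G.curry, G.expEval_curry, fun H hH => ?_⟩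
    rw [H.eq_curry]
    exact congrArg Hom.curry hH

/-- Transposition of maps out of any multicategory, of any size, for any choice of the exponential. -/
theorem _root_.Relaxed.IsExponential.bijective {𝒮 : StrucCat.{u, v}} {B : T2Multicat.{w, w'}}
    {E : T2Multicat.{max u v w w', max u v w w'}} {ev : Hom (E.prod 𝒮.toMulticat) B}
    (hE : IsExponential E ev) (Z : T2Multicat.{z, z'}) :
    Function.Bijective fun H : Hom Z E => ev.comp (prodMap H 𝒮.toMulticat) := by
  -- The explicit exponential lies in the universes in which `E` is tested. The comparison map `H`
  -- then transports its universal property, valid for `Z` of any size.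
  obtain ⟨H, hH, -⟩ := hE.existsUnique_transpose (𝒮.exp B) (expEval 𝒮 B)
  -- Both maps are transposes of `ev`, so uniqueness with `E` itself as test object identifies them.
  have h2 : H.comp ev.curry = Hom.id E := by
    refine (hE.existsUnique_transpose E ev).unique ?_ ?_
    · rw [← comp_prodMap_comp, hH, ev.expEval_curry]
    · refine Hom.ext rfl ?_
      funext n p
      exact congrArg (@ev.arr n) (ProdArr.ext (T.map_id _) rfl rfl)
  constructor
  · intro F F' h
    -- Transposing through the explicit exponential and comparing back recovers `F`, since currying
    -- is natural in `Z`.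
    have e : ∀ F : Hom Z E, F = H.comp (ev.comp (prodMap F 𝒮.toMulticat)).curry := fun F => by
      have : (ev.comp (prodMap F 𝒮.toMulticat)).curry = (ev.curry).comp F := by
        rw [((ev.curry).comp F).eq_curry, ← comp_prodMap_comp, ev.expEval_curry]
      rw [this]
      exact (congrArg (fun K : Hom E E => K.comp F) h2).symm
    rw [e F, e F']
    exact congrArg (fun G => H.comp (Hom.curry G)) h
  · intro G
    refine ⟨H.comp G.curry, ?_⟩
    change ev.comp (prodMap (H.comp G.curry) 𝒮.toMulticat) = G
    rw [← comp_prodMap_comp, hH, G.expEval_curry]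

end T2Multicat

/-! ### Trees as substitutions in two-level trees -/

namespace Tr
variable {X : ℕ → Type u}

theorem graft_node_leaf {n : ℕ} (x : X n) (c : Fin (node n x fun _ => leaf).leaves → Tr X) :
    (node n x fun _ => leaf).graft c = node n x fun i => c (Fin.cast (leaves_node_leaf n x).symm i) := by
  simp only [graft]
  congr 1
  funext i
  congr 1
  refine Fin.ext ?_
  refine (finSigmaFinEquiv_apply _).trans ?_
  simp [leaves]
  rfl

end Tr

namespace T
variable {X : ℕ → Type u} {Y : ℕ → Type v}

/-- The tree with a root vertex `x` and trees above it. -/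
def node {n : ℕ} (x : X n) {k : Fin n → ℕ} (c : ∀ i, T X (k i)) : T X (∑ i, k i) :=
  ⟨.node n x fun i => (c i).1, by simp [Tr.leaves, (c _).2]⟩

/-- This reduces actions on arbitrary trees to two-level ones, by recursion over the subtrees above
the root. -/
theorem mul_twoLevel_unit {n : ℕ} (x : X n) {k : Fin n → ℕ} (c : ∀ i, T X (k i)) :
    mul (twoLevel (X := T X) (unit x) c) = node x c := by
  refine Subtype.ext ?_
  refine (Tr.graft_node_leaf x fun i => (Tr.node (X := T X) _
    (c (Fin.cast (Tr.leaves_node_leaf n x) i)) fun _ => .leaf).flat).trans ?_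
  change _ = Tr.node n x fun i => (c i).1
  congr 1
  funext i
  exact Tr.graft_leaf _

end T

namespace StrucCat
variable (𝒯 : StrucCat.{z, z'})

theorem act_node {n : ℕ} (x : 𝒯.Obj n) {k : Fin n → ℕ} (c : ∀ i, T 𝒯.Obj (k i)) :
    𝒯.act (T.node x c) = 𝒯.substObj x fun i => 𝒯.act (c i) := by
  rw [← T.mul_twoLevel_unit, 𝒯.act_mul, T.map_twoLevel, 𝒯.act_unit]
  rfl

theorem actArr_node {n : ℕ} (x : 𝒯.Arr n) {k : Fin n → ℕ} (c : ∀ i, T 𝒯.Arr (k i)) :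
    𝒯.actArr (T.node x c) = 𝒯.actArr (T.twoLevel x fun i => 𝒯.actArr (c i)) := by
  rw [← T.mul_twoLevel_unit, 𝒯.actArr_mul, T.map_twoLevel, 𝒯.actArr_unit]

end StrucCat

/-! ## Operations of relaxed multicategories -/

namespace RelaxedData
variable {𝒯 : StrucCat.{z, z'}}

/-- An arrow of arity `n`, together with its shape, domain and codomain. -/
structure Op (C : RelaxedData.{u, w} 𝒯) (n : ℕ) where
  tree : 𝒯.Obj n
  ins : Fin n → C.C₀
  out : C.C₀
  arr : C.Hom tree ins out

namespace Op
variable {C : RelaxedData.{u, w} 𝒯}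

/-- The arrow underlying an operation. -/
def toArrow {n : ℕ} (x : C.Op n) : C.Arrow := ⟨n, x.tree, x.ins, x.out, x.arr⟩

theorem toArrow_injective {n : ℕ} {x y : C.Op n} (h : x.toArrow = y.toArrow) : x = y := by
  obtain ⟨t, i, o, f⟩ := x
  obtain ⟨t', i', o', f'⟩ := y
  unfold toArrow at h
  dsimp only at h
  injection h with h1 h2 h3 h4 h5
  subst h2 h3 h4
  obtain rfl := eq_of_heq h5
  rfl

/-- Transport along an equality of arities. -/
def cast {m n : ℕ} (h : m = n) (x : C.Op m) : C.Op n := h ▸ x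

theorem toArrow_cast {m n : ℕ} (h : m = n) (x : C.Op m) : (x.cast h).toArrow = x.toArrow := by
  subst h; rfl

theorem out_cast {m n : ℕ} (h : m = n) (x : C.Op m) : (x.cast h).out = x.out := by
  subst h; rfl

theorem out_congr {m n : ℕ} {x : C.Op m} {y : C.Op n} (h : x.toArrow = y.toArrow) :
    x.out = y.out := congrArg Arrow.out h

theorem ins_congr {m n : ℕ} {x : C.Op m} {y : C.Op n} (h : x.toArrow = y.toArrow)
    (i : Fin m) (j : Fin n) (hij : i.val = j.val) : x.ins i = y.ins j := by
  obtain rfl : m = n := congrArg Arrow.arity h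
  obtain rfl := toArrow_injective h
  obtain rfl := Fin.ext hij
  rfl

/-- Composition of operations. -/
def comp {n : ℕ} (f : C.Op n) {k : Fin n → ℕ} (g : ∀ i, C.Op (k i))
    (h : ∀ i, (g i).out = f.ins i) : C.Op (∑ i, k i) where
  tree := 𝒯.substObj f.tree fun i => (g i).tree
  ins := concat fun i => (g i).ins
  out := f.out
  arr := C.comp (as := f.ins) (fun i => h i ▸ (g i).arr) f.arr

theorem comp_congr {n n' : ℕ} {f : C.Op n} {f' : C.Op n'} {k : Fin n → ℕ} {k' : Fin n' → ℕ}
    {g : ∀ i, C.Op (k i)} {g' : ∀ i, C.Op (k' i)} (hf : f.toArrow = f'.toArrow)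
    (hg : ∀ i j, i.val = j.val → (g i).toArrow = (g' j).toArrow) (h h') :
    (f.comp g h).toArrow = (f'.comp g' h').toArrow := by
  obtain rfl : n = n' := congrArg Arrow.arity hf
  obtain rfl := toArrow_injective hf
  obtain rfl : k = k' := funext fun i => congrArg Arrow.arity (hg i i rfl)
  obtain rfl : g = g' := funext fun i => toArrow_injective (hg i i rfl)
  rfl

/-- Identities. -/
def ident (a : C.C₀) : C.Op 1 := ⟨𝒯.unitObj, fun _ => a, a, C.ident a⟩

/-- The action of `𝒯`. -/
def act {n : ℕ} (x : C.Op n) (φ : 𝒯.Arr n) (h : 𝒯.tgt φ = x.tree) : C.Op n where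
  tree := 𝒯.src φ
  ins := x.ins
  out := x.out
  arr := C.act ⟨φ, rfl, h⟩ x.arr

theorem act_congr {n : ℕ} {x x' : C.Op n} {φ φ' : 𝒯.Arr n} (hx : x = x') (hφ : φ = φ')
    (h h') : x.act φ h = x'.act φ' h' := by
  subst hx hφ; rfl

theorem act_hom {n : ℕ} {τ' τ : 𝒯.Obj n} {as : Fin n → C.C₀} {a : C.C₀} (f : C.Hom τ as a)
    (φ : 𝒯.Hom τ' τ) : act ⟨τ, as, a, f⟩ φ.1 φ.2.2 = ⟨τ', as, a, C.act φ f⟩ := by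
  obtain ⟨φ, rfl, rfl⟩ := φ
  rfl

end Op

/-- A tree of operations whose composite makes sense, with output `a`. -/
def Ok {C : RelaxedData.{u, w} 𝒯} : Tr C.Op → C.C₀ → Prop
  | .leaf, _ => True
  | .node _ x c, a => x.out = a ∧ ∀ i, Ok (c i) (x.ins i)

/-- The composite of a tree of operations. -/
def eval {C : RelaxedData.{u, w} 𝒯} :
    (t : Tr C.Op) → (a : C.C₀) → Ok t a → {f : C.Op t.leaves // f.out = a}
  | .leaf, a, _ => ⟨Op.ident a, rfl⟩
  | .node _ x c, a, h => ⟨x.comp (fun i => (eval (c i) (x.ins i) (h.2 i)).1)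
      (fun i => (eval (c i) (x.ins i) (h.2 i)).2), h.1⟩

variable {C : RelaxedData.{u, w} 𝒯}

theorem eval_congr {t t' : Tr C.Op} {a a' : C.C₀} (ht : t = t') (ha : a = a') (h h') :
    (eval t a h).1.toArrow = (eval t' a' h').1.toArrow := by
  subst ht ha; rfl

theorem tree_eval (t : Tr C.Op) (a : C.C₀) (h : Ok t a) :
    (eval t a h).1.tree = 𝒯.act ⟨t.map fun _ x => x.tree, Tr.leaves_map _ t⟩ := by
  induction t generalizing a with
  | leaf => rfl
  | node n x c ih =>
    refine Eq.trans ?_ (𝒯.act_node x.tree fun i =>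
      ⟨(c i).map fun _ x => x.tree, Tr.leaves_map _ (c i)⟩).symm
    exact congrArg (𝒯.substObj x.tree) (funext fun i => ih i _ _)

theorem tree_eq_of_toArrow {n : ℕ} (t : Tr C.Op) (a : C.C₀) (h : Ok t a) (y : C.Op n)
    (hy : y.toArrow = (eval t a h).1.toArrow) (e : (t.map fun _ x => x.tree).leaves = n) :
    y.tree = 𝒯.act ⟨t.map fun _ x => x.tree, e⟩ := by
  obtain rfl : n = t.leaves := congrArg Arrow.arity hy
  obtain rfl := Op.toArrow_injective hy
  exact tree_eval t a h

/-- The boundary of an operation. -/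
def Op.bd ⦃n : ℕ⦄ (x : C.Op n) : IndObj C.C₀ n := (x.ins, x.out)

/-- `Ok` checks colours along inner edges and at the root but does not mention the inputs; these are
a result of evaluation, and agree with the given colouring. -/
theorem exists_ok (t : Tr C.Op) (as : Fin (t.map Op.bd).leaves → C.C₀) (a : C.C₀)
    (h : (t.map Op.bd).Typed as a) :
    ∃ h' : Ok t a, ∀ i j, i.val = j.val → (eval t a h').1.ins i = as j := by
  induction t generalizing a with
  | leaf =>
    refine ⟨trivial, fun i j _ => ?_⟩
    have e : as (0 : Fin 1) = a := h
    rw [Subsingleton.elim (α := Fin 1) j (0 : Fin 1), e]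
    rfl
  | node n x c ih =>
    obtain ⟨h1, h2⟩ := h
    choose k1 k2 using fun i => ih i _ (x.ins i) (h2 i)
    refine ⟨⟨h1, k1⟩, fun p q hpq => ?_⟩
    obtain ⟨⟨i, j⟩, rfl⟩ := finSigmaFinEquiv.surjective p
    have e : (eval (.node n x c) a ⟨h1, k1⟩).1.ins (finSigmaFinEquiv ⟨i, j⟩) =
        (eval (c i) (x.ins i) (k1 i)).1.ins j := by
      change concat (fun i => (eval (c i) (x.ins i) (k1 i)).1.ins) (finSigmaFinEquiv ⟨i, j⟩) = _
      unfold concat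
      rw [Equiv.symm_apply_apply]
    rw [e, k2 i j (Fin.cast (Tr.leaves_map _ (c i)).symm j) rfl]
    congr 1
    refine Fin.ext ?_
    rw [← hpq]
    exact (Tr.finSigma_congr (fun i => (Tr.leaves_map _ (c i)).symm) i _ _ rfl).symm

end RelaxedData

/-! ### General associativity and compatibility for trees of operations -/

namespace RelaxedMulticategory
open RelaxedData
variable {𝒯 : StrucCat.{z, z'}} (R : RelaxedMulticategory.{u, w} 𝒯)

/-- For bundled operations the matching of colours is an equation. Eliminating these equations
removes the transports in `Op.comp` and leaves the axiom. -/
theorem op_comp_assoc {n : ℕ} {k : Fin n → ℕ} {l : ∀ i, Fin (k i) → ℕ} (f : R.Op n)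
    (g : ∀ i, R.Op (k i)) (h : ∀ i j, R.Op (l i j)) (hg : ∀ i, (g i).out = f.ins i)
    (hh : ∀ i j, (h i j).out = (g i).ins j) :
    (f.comp (fun i => (g i).comp (h i) (hh i)) hg).toArrow =
      ((f.comp g hg).comp (fun p : Fin (∑ i, k i) =>
        h (finSigmaFinEquiv.symm p).1 (finSigmaFinEquiv.symm p).2) fun p => hh _ _).toArrow := by
  obtain ⟨τ, as, a, f⟩ := f
  obtain ⟨σ, bs, as', g, rfl⟩ : ∃ (σ : ∀ i, 𝒯.Obj (k i)) (bs : ∀ i, Fin (k i) → R.C₀)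
    (as' : Fin n → R.C₀) (g' : ∀ i, R.Hom (σ i) (bs i) (as' i)),
    g = fun i => ⟨σ i, bs i, as' i, g' i⟩ := ⟨_, _, _, fun i => (g i).arr, rfl⟩
  obtain rfl : as' = as := funext hg
  obtain ⟨ρ, cs, bs', h, rfl⟩ : ∃ (ρ : ∀ i j, 𝒯.Obj (l i j)) (cs : ∀ i j, Fin (l i j) → R.C₀)
    (bs' : ∀ i, Fin (k i) → R.C₀) (h' : ∀ i j, R.Hom (ρ i j) (cs i j) (bs' i j)),
    h = fun i j => ⟨ρ i j, cs i j, bs' i j, h' i j⟩ := ⟨_, _, _, fun i j => (h i j).arr, rfl⟩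
  obtain rfl : bs' = bs := funext fun i => funext (hh i)
  exact R.assoc h g f

theorem op_comp_ident {n : ℕ} (f : R.Op n) :
    (f.comp (fun i => Op.ident (f.ins i)) fun _ => rfl).toArrow = f.toArrow :=
  R.comp_ident f.arr

theorem op_ident_comp {n : ℕ} (f : R.Op n) (a : R.C₀) (h) :
    ((Op.ident a).comp (fun _ : Fin 1 => f) h).toArrow = f.toArrow := by
  obtain ⟨τ, as, a', f⟩ := f
  obtain rfl : a' = a := h (0 : Fin 1)
  exact R.ident_comp f

theorem op_act_id {n : ℕ} (x : R.Op n) (h) : x.act (𝒯.id x.tree) h = x := by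
  obtain ⟨τ, as, a, f⟩ := x
  refine (Op.act_hom f (StrucCat.homId τ)).trans ?_
  rw [R.act_id]

theorem op_act_act {n : ℕ} (x : R.Op n) (φ φ' : 𝒯.Arr n) (h h' k k') :
    (x.act φ h).act φ' h' = x.act (𝒯.comp φ φ' k) k' := by
  obtain ⟨τ, as, a, f⟩ := x
  exact ((Op.act_hom f (StrucCat.homComp ⟨φ, rfl, h⟩ ⟨φ', rfl, h'⟩)).trans
    (congrArg (Op.mk _ as a) (R.act_comp ⟨φ, rfl, h⟩ ⟨φ', rfl, h'⟩ f))).symm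

theorem op_act_comp {n : ℕ} {k : Fin n → ℕ} (f : R.Op n) (g : ∀ i, R.Op (k i)) (h)
    (φ : 𝒯.Arr n) (ψ : ∀ i, 𝒯.Arr (k i)) (hφ : 𝒯.tgt φ = f.tree)
    (hψ : ∀ i, 𝒯.tgt (ψ i) = (g i).tree) (h₁) :
    (f.comp g h).act (𝒯.actArr (T.twoLevel φ ψ)) h₁ =
      (f.act φ hφ).comp (fun i => (g i).act (ψ i) (hψ i)) h := by
  obtain ⟨τ, as, a, f⟩ := f
  obtain ⟨σ, bs, as', g, rfl⟩ : ∃ (σ : ∀ i, 𝒯.Obj (k i)) (bs : ∀ i, Fin (k i) → R.C₀)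
    (as' : Fin n → R.C₀) (g' : ∀ i, R.Hom (σ i) (bs i) (as' i)),
    g = fun i => ⟨σ i, bs i, as' i, g' i⟩ := ⟨_, _, _, fun i => (g i).arr, rfl⟩
  obtain rfl : as' = as := funext h
  exact (Op.act_hom (R.comp g f) (StrucCat.substHom ⟨φ, rfl, hφ⟩ fun i => ⟨ψ i, rfl, hψ i⟩)).trans
    (congrArg (Op.mk _ (concat bs) a) (R.act_substHom ⟨φ, rfl, hφ⟩ (fun i => ⟨ψ i, rfl, hψ i⟩) g f))

/-- By induction on `t`: the unit law `ident_comp` at a leaf, associativity at a node. -/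
theorem eval_graft (t : Tr R.Op) (c : Fin t.leaves → Tr R.Op) (a : R.C₀) (h : Ok t a)
    (hc : ∀ i, Ok (c i) ((eval t a h).1.ins i)) :
    ∃ h' : Ok (t.graft c) a, (eval (t.graft c) a h').1.toArrow =
      ((eval t a h).1.comp (fun i => (eval (c i) _ (hc i)).1) fun i => (eval (c i) _ (hc i)).2).toArrow := by
  induction t generalizing a with
  | leaf =>
    obtain ⟨s, rfl⟩ : ∃ s, c = fun _ => s :=
      ⟨c (0 : Fin 1), funext fun i => congrArg c (Subsingleton.elim (α := Fin 1) _ _)⟩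
    exact ⟨hc (0 : Fin 1), (R.op_ident_comp _ a _).symm⟩
  | node n x d ih =>
    have e : ∀ i j, (eval (.node n x d) a h).1.ins (finSigmaFinEquiv ⟨i, j⟩) =
        (eval (d i) (x.ins i) (h.2 i)).1.ins j := fun i j => by
      change concat (fun i => (eval (d i) (x.ins i) (h.2 i)).1.ins) (finSigmaFinEquiv ⟨i, j⟩) = _
      unfold concat
      rw [Equiv.symm_apply_apply]
    have hc' : ∀ i j, Ok (c (finSigmaFinEquiv ⟨i, j⟩)) ((eval (d i) (x.ins i) (h.2 i)).1.ins j) :=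
      fun i j => by rw [← e]; exact hc _
    choose k1 k2 using fun i => ih i (fun j => c (finSigmaFinEquiv ⟨i, j⟩)) _ (h.2 i) (hc' i)
    refine ⟨⟨h.1, k1⟩, ?_⟩
    refine (Op.comp_congr (f' := x) (g' := fun i => (eval (d i) (x.ins i) (h.2 i)).1.comp
      (fun j => (eval (c (finSigmaFinEquiv ⟨i, j⟩)) _ (hc' i j)).1)
      fun j => (eval (c (finSigmaFinEquiv ⟨i, j⟩)) _ (hc' i j)).2) rfl ?_ _ ?_).trans
      ((R.op_comp_assoc x _ _ _ _).trans (Op.comp_congr rfl ?_ _ _))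
    · intro i j hij
      obtain rfl := Fin.ext hij
      exact k2 i
    · exact fun i => (eval (d i) (x.ins i) (h.2 i)).2
    · intro p q hpq
      obtain rfl := Fin.ext hpq
      refine eval_congr (congrArg c (finSigmaFinEquiv.apply_symm_apply p)) ?_ _ _
      rw [← e]
      exact congrArg _ (finSigmaFinEquiv.apply_symm_apply p)

variable {I : ℕ → Type v}

/-- General associativity, from `eval_graft` at each vertex. The composites `V` are prescribed only
up to `toArrow`, since their arities agree with those of `eval` only propositionally. -/
theorem eval_flat (q : ∀ ⦃m⦄, I m → T R.Op m) (b : ∀ ⦃m⦄, I m → R.C₀)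
    (hq : ∀ ⦃m⦄ (i : I m), Ok (q i).1 (b i)) (V : ∀ ⦃m⦄, I m → R.Op m)
    (hV : ∀ ⦃m⦄ (i : I m), (V i).toArrow = (eval (q i).1 (b i) (hq i)).1.toArrow)
    (Θ : Tr I) (a : R.C₀) (h : Ok (Θ.map V) a) :
    ∃ h' : Ok (Θ.map q).flat a,
      (eval (Θ.map q).flat a h').1.toArrow = (eval (Θ.map V) a h).1.toArrow := by
  induction Θ generalizing a with
  | leaf => exact ⟨trivial, rfl⟩
  | node n y c ih =>
    choose k1 k2 using fun i => ih i _ (h.2 i)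
    obtain rfl : b y = a := by
      rw [← h.1, Op.out_congr (hV y), (eval (q y).1 (b y) (hq y)).2]
    have hi : ∀ i, (eval (q y).1 (b y) (hq y)).1.ins i = (V y).ins (Fin.cast (q y).2 i) :=
      fun i => Op.ins_congr (hV y).symm _ _ rfl
    obtain ⟨l1, l2⟩ := R.eval_graft (q y).1 (fun i => ((c (Fin.cast (q y).2 i)).map q).flat) (b y)
      (hq y) fun i => by rw [hi]; exact k1 _
    refine ⟨l1, l2.trans (Op.comp_congr (hV y).symm ?_ _ _)⟩
    intro i j hij
    obtain rfl : Fin.cast (q y).2 i = j := Fin.ext hij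
    exact (eval_congr rfl (hi i) _ _).trans (k2 _)

theorem tgt_actArr_eval (x : ∀ ⦃m⦄, I m → R.Op m) (φ : ∀ ⦃m⦄, I m → 𝒯.Arr m)
    (hφ : ∀ ⦃m⦄ (i : I m), 𝒯.tgt (φ i) = (x i).tree) {n : ℕ} (Θ : T I n) (a : R.C₀)
    (h : Ok (Θ.1.map x) a) (y : R.Op n) (hy : y.toArrow = (eval (Θ.1.map x) a h).1.toArrow) :
    𝒯.tgt (𝒯.actArr (T.map φ Θ)) = y.tree := by
  rw [𝒯.tgt_actArr, T.map_map, tree_eq_of_toArrow _ a h y hy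
    (by rw [Tr.leaves_map, Tr.leaves_map, Θ.2])]
  refine congrArg (@𝒯.act n) (Subtype.ext ?_)
  refine Eq.trans ?_ (Tr.map_map _ _ _).symm
  simp only [hφ]
  rfl

/-- By induction: at a node this is `act_substHom`; at a leaf the empty tree of arrows acts as an
identity arrow, and `act_id` applies. -/
theorem eval_act (x : ∀ ⦃m⦄, I m → R.Op m) (φ : ∀ ⦃m⦄, I m → 𝒯.Arr m)
    (hφ : ∀ ⦃m⦄ (i : I m), 𝒯.tgt (φ i) = (x i).tree) (Θ : Tr I) (a : R.C₀)
    (h : Ok (Θ.map x) a) (y : R.Op Θ.leaves) (hy : y.toArrow = (eval (Θ.map x) a h).1.toArrow)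
    (k : 𝒯.tgt (𝒯.actArr (T.map φ ⟨Θ, rfl⟩)) = y.tree) :
    ∃ h' : Ok (Θ.map fun _ i => (x i).act (φ i) (hφ i)) a,
      (eval (Θ.map fun _ i => (x i).act (φ i) (hφ i)) a h').1.toArrow = (y.act _ k).toArrow := by
  induction Θ generalizing a with
  | leaf =>
    obtain rfl : y = Op.ident a := Op.toArrow_injective (n := 1) hy
    refine ⟨trivial, congrArg Op.toArrow (Eq.symm ?_)⟩
    have e : 𝒯.actArr (T.map φ ⟨.leaf, rfl⟩) = 𝒯.id (𝒯.act T.trivial) := 𝒯.actArr_id T.trivial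
    exact (Op.act_congr rfl e _ (𝒯.tgt_id _)).trans (R.op_act_id _ _)
  | node n i c ih =>
    let e : ∀ j, R.Op (c j).leaves := fun j =>
      (eval ((c j).map x) _ (h.2 j)).1.cast (Tr.leaves_map x (c j))
    have he : ∀ j, (e j).toArrow = (eval ((c j).map x) _ (h.2 j)).1.toArrow :=
      fun j => Op.toArrow_cast _ _
    have ho : ∀ j, (e j).out = (x i).ins j := fun j =>
      (Op.out_cast _ _).trans (eval ((c j).map x) _ (h.2 j)).2
    have hk : ∀ j, 𝒯.tgt (𝒯.actArr (T.map φ ⟨c j, rfl⟩)) = (e j).tree := fun j =>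
      R.tgt_actArr_eval x φ hφ ⟨c j, rfl⟩ _ (h.2 j) (e j) (he j)
    obtain rfl : y = (x i).comp e ho := by
      refine Op.toArrow_injective (n := ∑ j, (c j).leaves) (hy.trans ?_)
      refine Op.comp_congr rfl (fun j j' hj => ?_) _ _
      obtain rfl := Fin.ext hj
      exact (he j).symm
    choose k1 k2 using fun j => ih j _ (h.2 j) (e j) (he j) (hk j)
    refine ⟨⟨h.1, k1⟩, ?_⟩
    have ha : 𝒯.actArr (T.map φ ⟨.node n i c, rfl⟩) =
        𝒯.actArr (T.twoLevel (φ i) fun j => 𝒯.actArr (T.map φ ⟨c j, rfl⟩)) :=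
      𝒯.actArr_node (φ i) fun j => T.map φ ⟨c j, rfl⟩
    refine Eq.trans ?_ (congrArg Op.toArrow ((Op.act_congr rfl ha _ (ha ▸ k)).trans
      (R.op_act_comp (x i) e ho (φ i) (fun j => 𝒯.actArr (T.map φ ⟨c j, rfl⟩)) (hφ i) hk
        (ha ▸ k)))).symm
    refine Op.comp_congr rfl (fun j j' hj => ?_) _ _
    obtain rfl := Fin.ext hj
    exact k2 j

/-- The composite of a tree of operations with `n` input edges. -/
def _root_.Relaxed.RelaxedData.evalT {C : RelaxedData.{u, w} 𝒯} {n : ℕ} (W : T C.Op n) (a : C.C₀)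
    (h : Ok W.1 a) : C.Op n := (eval W.1 a h).1.cast W.2

theorem toArrow_evalT {n : ℕ} (W : T R.Op n) (a : R.C₀) (h : Ok W.1 a) :
    (evalT W a h).toArrow = (eval W.1 a h).1.toArrow := Op.toArrow_cast _ _

theorem out_evalT {n : ℕ} (W : T R.Op n) (a : R.C₀) (h : Ok W.1 a) :
    (evalT W a h).out = a := (Op.out_cast _ _).trans (eval W.1 a h).2

theorem evalT_congr {n : ℕ} {W W' : T R.Op n} {a a' : R.C₀} (hW : W = W') (ha : a = a') (h h') :
    evalT W a h = evalT W' a' h' := by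
  subst hW ha; rfl

theorem tree_evalT {n : ℕ} (W : T R.Op n) (a : R.C₀) (h : Ok W.1 a) :
    (evalT W a h).tree = 𝒯.act (T.map (fun _ x => x.tree) W) :=
  tree_eq_of_toArrow _ _ _ _ (R.toArrow_evalT W a h) _

theorem exists_ok_evalT {n : ℕ} (W : T R.Op n) (ins : Fin n → R.C₀) (a : R.C₀)
    (h : (T.map Op.bd W).1.Typed (fun i => ins (Fin.cast (T.map Op.bd W).2 i)) a) :
    ∃ h' : Ok W.1 a, (evalT W a h').ins = ins := by
  obtain ⟨t, rfl⟩ := W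
  obtain ⟨h1, h2⟩ := exists_ok t _ a h
  exact ⟨h1, funext fun i => h2 i (Fin.cast (Tr.leaves_map _ _).symm i) rfl⟩

theorem evalT_mul (q : ∀ ⦃m⦄, I m → T R.Op m) (b : ∀ ⦃m⦄, I m → R.C₀)
    (hq : ∀ ⦃m⦄ (i : I m), Ok (q i).1 (b i)) {n : ℕ} (Θ : T I n) (a : R.C₀)
    (h : Ok (T.map (fun _ i => evalT (q i) (b i) (hq i)) Θ).1 a) :
    ∃ h' : Ok (T.mul (T.map q Θ)).1 a, evalT (T.mul (T.map q Θ)) a h' =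
      evalT (T.map (fun _ i => evalT (q i) (b i) (hq i)) Θ) a h := by
  obtain ⟨h1, h2⟩ := R.eval_flat q b hq (fun _ i => evalT (q i) (b i) (hq i))
    (fun _ i => R.toArrow_evalT (q i) (b i) (hq i)) Θ.1 a h
  exact ⟨h1, Op.toArrow_injective (((R.toArrow_evalT _ _ _).trans h2).trans
    (R.toArrow_evalT _ _ _).symm)⟩

theorem evalT_act (x : ∀ ⦃m⦄, I m → R.Op m) (φ : ∀ ⦃m⦄, I m → 𝒯.Arr m)
    (hφ : ∀ ⦃m⦄ (i : I m), 𝒯.tgt (φ i) = (x i).tree) {n : ℕ} (Θ : T I n) (a : R.C₀)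
    (h : Ok (T.map x Θ).1 a) (k : 𝒯.tgt (𝒯.actArr (T.map φ Θ)) = (evalT (T.map x Θ) a h).tree) :
    ∃ h' : Ok (T.map (fun _ i => (x i).act (φ i) (hφ i)) Θ).1 a,
      evalT (T.map (fun _ i => (x i).act (φ i) (hφ i)) Θ) a h' =
        (evalT (T.map x Θ) a h).act _ k := by
  obtain ⟨t, rfl⟩ := Θ
  obtain ⟨h1, h2⟩ := R.eval_act x φ hφ t a h _ (R.toArrow_evalT _ _ _) k
  exact ⟨h1, Op.toArrow_injective ((R.toArrow_evalT _ _ _).trans h2)⟩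

theorem evalT_unit {n : ℕ} (x : R.Op n) (h : Ok (T.unit x).1 x.out) :
    evalT (T.unit x) x.out h = x :=
  Op.toArrow_injective ((R.toArrow_evalT _ _ _).trans (R.op_comp_ident x))

/-- Evaluation places identities on the input edges of the upper vertices, and the unit law removes
them. -/
theorem evalT_twoLevel {n : ℕ} (f : R.Op n) {k : Fin n → ℕ} (g : ∀ i, R.Op (k i))
    (hg : ∀ i, (g i).out = f.ins i) :
    ∃ h : Ok (T.twoLevel f g).1 f.out, evalT (T.twoLevel f g) f.out h = f.comp g hg := by
  refine ⟨⟨rfl, fun i => ⟨hg i, fun _ => trivial⟩⟩, Op.toArrow_injective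
    ((R.toArrow_evalT _ _ _).trans (Op.comp_congr rfl (fun i j hij => ?_) _ _))⟩
  obtain rfl := Fin.ext hij
  exact R.op_comp_ident (g i)

theorem evalT_trivial (a : R.C₀) (h) : evalT T.trivial a h = (Op.ident a : R.Op 1) :=
  Op.toArrow_injective (R.toArrow_evalT _ _ _)

end RelaxedMulticategory

/-! ### Functions compared through pointed sets -/

namespace SetArr

/-- The value of a function, as an element of some set. -/
def ap {n : ℕ} (r : SetArr.{u} n) (x : T Pointed.{u} n) (h : T.map (fun _ y => y.1) x = r.dom) :
    Pointed.{u} n := ⟨r.cod, r.fn ⟨x, h⟩⟩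

theorem ap_congr {n : ℕ} {r r' : SetArr.{u} n} {x x' : T Pointed.{u} n} (hr : r = r') (hx : x = x')
    (h h') : r.ap x h = r'.ap x' h' := by
  subst hr hx; rfl

/-- Carrying each value together with its set replaces heterogeneous equalities by ordinary ones. -/
theorem ext_ap {n : ℕ} {a b : SetArr.{u} n} (hd : a.dom = b.dom) (hc : a.cod = b.cod)
    (hf : ∀ x h h', a.ap x h = b.ap x h') : a = b :=
  ext_fn hd hc fun x h h' => (Sigma.mk.inj (hf x h h')).2

theorem ap_id {n : ℕ} (X : Type u) (x : X) (h) :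
    (id (n := n) X).ap (T.unit ⟨X, x⟩) h = ⟨X, x⟩ :=
  congrArg (Sigma.mk X) (id_fn X x h)

theorem ap_comp {I : ℕ → Type v} {n : ℕ} (W : T I n) (θ : ∀ ⦃m⦄, I m → SetArr.{u} m)
    (q : ∀ ⦃m⦄, I m → T Pointed.{u} m)
    (e : ∀ ⦃m⦄ (i : I m), T.map (fun _ x => x.1) (q i) = (θ i).dom)
    (Θ : T SetArr.{u} n) (g : SetArr.{u} n) (h : T.map (fun _ f => f.cod) Θ = g.dom)
    (x : T Pointed.{u} n) (h1 : T.map θ W = Θ) (h2 : T.mul (T.map q W) = x) (hx hx') :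
    (comp Θ g h).ap x hx = g.ap (T.map (fun _ i => (θ i).ap (q i) (e i)) W) hx' :=
  congrArg (Sigma.mk g.cod) (fn_congr g (evalAll_eq W θ q e Θ ⟨x, hx⟩ h1 h2) _ _)

theorem toFun_ap {n : ℕ} (r : SetArr.{u} n) {D : T (fun _ => Type u) n} {X : Type u}
    (hD : r.dom = D) (hX : r.cod = X) (p : Elements D) :
    (⟨X, r.toFun hD hX p⟩ : Pointed n) = r.ap p.1 (p.2.trans hD.symm) := by
  subst hX
  rfl

end SetArr

namespace RelaxedData
variable {𝒯 : StrucCat.{z, z'}} {C : RelaxedData.{u, w} 𝒯}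

namespace Op

/-- The shape and the boundary of an operation. -/
def idx ⦃n : ℕ⦄ (x : C.Op n) : IndObj C.C₀ n × 𝒯.Obj n := ((x.ins, x.out), x.tree)

/-- An operation as an element of the set of operations of its shape and boundary. -/
def pt ⦃n : ℕ⦄ (x : C.Op n) : Pointed.{u} n := ⟨C.Hom x.tree x.ins x.out, x.arr⟩

theorem ext_pt {n : ℕ} {x y : C.Op n} (h : x.idx = y.idx) (h' : x.pt = y.pt) : x = y := by
  obtain ⟨t, i, o, f⟩ := x
  obtain ⟨t', i', o', f'⟩ := y
  unfold idx at h
  dsimp only at h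
  obtain ⟨h1, h2⟩ := Prod.mk.inj h
  obtain ⟨h3, h4⟩ := Prod.mk.inj h1
  subst h2 h3 h4
  obtain rfl := eq_of_heq (Sigma.mk.inj h').2
  rfl

/-- An operation as an arrow of prescribed shape and boundary. -/
def arrAs {n : ℕ} (x : C.Op n) {τ : 𝒯.Obj n} {as : Fin n → C.C₀} {a : C.C₀} (h₁ : x.tree = τ)
    (h₂ : x.ins = as) (h₃ : x.out = a) : C.Hom τ as a := h₁ ▸ h₂ ▸ h₃ ▸ x.arr

theorem pt_arrAs {n : ℕ} (x : C.Op n) {τ : 𝒯.Obj n} {as : Fin n → C.C₀} {a : C.C₀}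
    (h₁ : x.tree = τ) (h₂ : x.ins = as) (h₃ : x.out = a) :
    (⟨C.Hom τ as a, x.arrAs h₁ h₂ h₃⟩ : Pointed n) = x.pt := by
  subst h₁ h₂ h₃
  rfl

end Op

/-- The set of arrows of given shape and boundary. -/
def homObj (C : RelaxedData.{u, w} 𝒯) ⦃n : ℕ⦄ (y : IndObj C.C₀ n × 𝒯.Obj n) : Type u :=
  C.Hom y.2 y.1.1 y.1.2

/-- Operations are the pullback of their indices and of pointed sets over sets, and `T` preserves
it. So an element of a product of hom sets is a tree of operations, unique by `ops_ext`. -/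
theorem exists_ops {n : ℕ} (P : T (fun m => IndObj C.C₀ m × 𝒯.Obj m) n) (x : T Pointed.{u} n)
    (h : T.map (fun _ y => y.1) x = T.map C.homObj P) :
    ∃ W : T C.Op n, T.map Op.idx W = P ∧ T.map Op.pt W = x := by
  obtain ⟨Y, h1, h2⟩ := T.exists_pullback C.homObj (fun _ y => y.1) P x h.symm
  refine ⟨T.map (fun _ y => ⟨y.1.1.2, y.1.1.1.1, y.1.1.1.2, cast y.2.symm y.1.2.2⟩) Y, ?_, ?_⟩
  · rw [T.map_map]; exact h1
  · rw [T.map_map, ← h2]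
    refine T.map_congr (fun _ y => ?_) Y
    obtain ⟨⟨p, X, x⟩, hy⟩ := y
    have hy' : C.homObj p = X := hy
    subst hy'
    rfl

theorem ops_ext {n : ℕ} {W W' : T C.Op n} (h : T.map Op.idx W = T.map Op.idx W')
    (h' : T.map Op.pt W = T.map Op.pt W') : W = W' :=
  T.pair_ext Op.idx Op.pt (fun _ _ _ => Op.ext_pt) W W' h h'

theorem map_fst_pt {n : ℕ} (W : T C.Op n) :
    T.map (fun _ y => y.1) (T.map Op.pt W) = T.map C.homObj (T.map Op.idx W) := by
  rw [T.map_map, T.map_map]; rfl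

end RelaxedData

/-! ### From a relaxed multicategory to a map to `Set` -/

namespace RelaxedMulticategory
open RelaxedData
variable {𝒯 : StrucCat.{z, z'}} (R : RelaxedMulticategory.{u, w} 𝒯)

theorem exists_ok_prodArr {n : ℕ} (p : T2Multicat.ProdArr (MI R.C₀) 𝒯.op.toMulticat n)
    (W : T R.Op n) (h : T.map (fun _ x => (x.ins, x.out)) W = p.fst.dom) :
    ∃ h' : Ok W.1 p.fst.out, (evalT W _ h').ins = p.fst.ins := by
  refine R.exists_ok_evalT W p.fst.ins p.fst.out ?_
  refine Tr.Typed.congr (congrArg Subtype.val h).symm ?_ p.fst.typed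
  intro i j hij
  exact congrArg p.fst.ins (Fin.ext hij)

theorem bd_of_idx {n : ℕ} {p : T2Multicat.ProdArr (MI R.C₀) 𝒯.op.toMulticat n}
    {W : T R.Op n} (h : T.map Op.idx W = p.dom) :
    T.map (fun _ x => (x.ins, x.out)) W = p.fst.dom := by
  refine Eq.trans ?_ p.dom_fst
  refine Eq.trans ?_ (congrArg (fun t => T.map (fun _ x => x.1) t) h)
  exact T.eq_map_map (by intros; rfl) W

/-- In the opposite of `𝒯` sources are targets. So the arrow stored in `p` ends at the shape of the
composite of `W`, as is needed for it to act. -/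
theorem tree_of_idx {n : ℕ} {p : T2Multicat.ProdArr (MI R.C₀) 𝒯.op.toMulticat n}
    {W : T R.Op n} (h : T.map Op.idx W = p.dom) (a : R.C₀) (ok : Ok W.1 a) :
    𝒯.tgt p.snd.arr = (evalT W a ok).tree := by
  rw [R.tree_evalT]
  refine (p.snd.src_arr : 𝒯.tgt p.snd.arr = 𝒯.act p.snd.dom).trans ?_
  refine congrArg (@𝒯.act n) (p.dom_snd.symm.trans ?_)
  refine (congrArg (fun t => T.map (fun _ x => x.2) t) h.symm).trans ?_
  exact (T.eq_map_map (by intros; rfl) W).symm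

/-- The value, at a tree `W` of arrows of `R`, of the function assigned to `p`. -/
noncomputable def value {n : ℕ} (p : T2Multicat.ProdArr (MI R.C₀) 𝒯.op.toMulticat n) (W : T R.Op n)
    (h : T.map Op.idx W = p.dom) : R.Op n :=
  (evalT W p.fst.out (R.exists_ok_prodArr p W (R.bd_of_idx h)).1).act p.snd.arr
    (R.tree_of_idx h _ _)

theorem idx_value {n : ℕ} (p : T2Multicat.ProdArr (MI R.C₀) 𝒯.op.toMulticat n) (W : T R.Op n)
    (h : T.map Op.idx W = p.dom) :
    (R.value p W h).idx = ((p.fst.ins, p.fst.out), 𝒯.src p.snd.arr) :=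
  Prod.ext (Prod.ext (R.exists_ok_prodArr p W (R.bd_of_idx h)).2 (R.out_evalT _ _ _)) rfl

/-- The function assigned to an arrow of `MI C₀ × 𝒯ᵒᵖ`. -/
noncomputable def setArr {n : ℕ} (p : T2Multicat.ProdArr (MI R.C₀) 𝒯.op.toMulticat n) :
    SetArr.{u} n where
  dom := T.map R.homObj p.dom
  cod := R.Hom (𝒯.src p.snd.arr) p.fst.ins p.fst.out
  fn x := (R.value p (exists_ops p.dom x.1 x.2).choose (exists_ops p.dom x.1 x.2).choose_spec.1).arrAs
    rfl (R.exists_ok_prodArr p _ (R.bd_of_idx (exists_ops p.dom x.1 x.2).choose_spec.1)).2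
    (R.out_evalT _ _ _)

theorem ap_setArr {n : ℕ} (p : T2Multicat.ProdArr (MI R.C₀) 𝒯.op.toMulticat n) (W : T R.Op n)
    (h : T.map Op.idx W = p.dom) (h') :
    (R.setArr p).ap (T.map Op.pt W) h' = (R.value p W h).pt := by
  have s := (exists_ops p.dom (T.map Op.pt W) h').choose_spec
  have e : (exists_ops p.dom (T.map Op.pt W) h').choose = W :=
    ops_ext (s.1.trans h.symm) s.2
  refine (Op.pt_arrAs (R.value p _ s.1) rfl
    (R.exists_ok_prodArr p _ (R.bd_of_idx s.1)).2 (R.out_evalT _ _ _)).trans ?_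
  congr 2

theorem setArr_id {n : ℕ} (x : IndObj R.C₀ n × 𝒯.Obj n) :
    R.setArr (((MI R.C₀).prod 𝒯.op.toMulticat).id x) = SetArr.id (R.homObj x) := by
  have hc : R.Hom (𝒯.src (𝒯.id x.2)) x.1.1 x.1.2 = R.homObj x := by rw [𝒯.src_id]; rfl
  refine SetArr.ext_ap rfl hc fun y h h' => ?_
  obtain ⟨f, rfl⟩ := SetArr.exists_unit y h'
  let W : R.Op n := ⟨x.2, x.1.1, x.1.2, f⟩
  refine (R.ap_setArr _ (T.unit W) rfl h).trans (Eq.trans ?_ (SetArr.ap_id _ f h').symm)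
  have : R.value (((MI R.C₀).prod 𝒯.op.toMulticat).id x) (T.unit W) rfl = W := by
    refine Eq.trans ?_ (R.op_act_id W (𝒯.tgt_id _))
    exact Op.act_congr (R.evalT_unit W _) rfl _ _
  exact congrArg (fun y => Op.pt y) this

/-- One side composes the whole tree and acts by a composite arrow; the other composes and acts on
each part, then composes and acts on the results. They agree by `evalT_mul`, `evalT_act` and
`op_act_act`. -/
theorem setArr_comp {n : ℕ} (Θ : T (T2Multicat.ProdArr (MI R.C₀) 𝒯.op.toMulticat) n)
    (g : T2Multicat.ProdArr (MI R.C₀) 𝒯.op.toMulticat n)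
    (h : T.map ((MI R.C₀).prod 𝒯.op.toMulticat).cod Θ = g.dom)
    (h' : T.map (fun _ f => f.cod) (T.map (fun _ p => R.setArr p) Θ) = (R.setArr g).dom) :
    R.setArr (((MI R.C₀).prod 𝒯.op.toMulticat).comp Θ g h) =
      SetArr.comp (T.map (fun _ p => R.setArr p) Θ) (R.setArr g) h' := by
  let c : T2Multicat.ProdArr (MI R.C₀) 𝒯.op.toMulticat n :=
    ((MI R.C₀).prod 𝒯.op.toMulticat).comp Θ g h
  have hd : (R.setArr c).dom = T.mul (T.map (fun _ f => f.dom) (T.map (fun _ p => R.setArr p) Θ)) := by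
    refine (T.map_mul _ _).trans (congrArg (@T.mul _ n) ?_)
    exact (T.map_map _ _ Θ).trans (T.eq_map_map (by intros; rfl) Θ)
  have hc : 𝒯.src c.snd.arr = 𝒯.src g.snd.arr :=
    congrArg Prod.snd (((MI R.C₀).prod 𝒯.op.toMulticat).cod_comp Θ g h)
  refine SetArr.ext_ap hd (congrArg (fun τ => R.Hom τ g.fst.ins g.fst.out) hc) fun y k k' => ?_
  obtain ⟨W, w1, rfl⟩ := exists_ops c.dom y k
  obtain ⟨Ω, ⟨o1, o2⟩, -⟩ := T.existsUnique_split Op.idx 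
    (fun _ (p : T2Multicat.ProdArr (MI R.C₀) 𝒯.op.toMulticat _) => p.dom) Θ W (by exact w1)
  have e1 : T.map (fun m i => R.setArr i.1.1) Ω = T.map (fun _ p => R.setArr p) Θ := by
    rw [← o1, T.map_map]
  have e2 : T.mul (T.map (fun m i => T.map Op.pt i.1.2) Ω) = T.map Op.pt W := by
    rw [← o2, T.map_mul, T.map_map]
  have e3 : ∀ ⦃m⦄ (i : {z : T2Multicat.ProdArr (MI R.C₀) 𝒯.op.toMulticat m × T R.Op m //
      T.map Op.idx z.2 = z.1.dom}),
      T.map (fun _ y => y.1) (T.map Op.pt i.1.2) = (R.setArr i.1.1).dom := fun m i => by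
    rw [map_fst_pt, i.2]; rfl
  let V : T R.Op n := T.map (fun m i => R.value i.1.1 i.1.2 i.2) Ω
  have v1 : T.map Op.idx V = g.dom := by
    refine Eq.trans ?_ h
    rw [← o1]
    refine (T.map_map _ _ _).trans (Eq.trans ?_ (T.map_map _ _ _).symm)
    refine T.map_congr (fun m i => ?_) Ω
    exact R.idx_value i.1.1 i.1.2 i.2
  have e4 : T.map (fun m i => (R.setArr i.1.1).ap (T.map Op.pt i.1.2) (e3 i)) Ω = T.map Op.pt V := by
    refine Eq.trans ?_ (T.map_map _ _ _).symm
    refine T.map_congr (fun m i => ?_) Ω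
    exact R.ap_setArr i.1.1 i.1.2 i.2 (e3 i)
  have e5 : T.map (fun _ y => y.1) (T.map Op.pt V) = (R.setArr g).dom := by
    rw [map_fst_pt, v1]; rfl
  refine (R.ap_setArr c W w1 k).trans (Eq.trans ?_ (SetArr.ap_comp Ω _ _ e3 _ (R.setArr g) h'
    (T.map Op.pt W) e1 e2 k' (by rw [e4]; exact e5)).symm)
  refine Eq.trans ?_ (SetArr.ap_congr rfl e4 _ e5).symm
  refine Eq.trans ?_ (R.ap_setArr g V v1 e5).symm
  refine congrArg (fun y => Op.pt y) ?_
  -- The composites of the parts, before the arrows of `𝒯` act on them.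
  let q : ∀ ⦃m⦄ (i : {z : T2Multicat.ProdArr (MI R.C₀) 𝒯.op.toMulticat m × T R.Op m //
      T.map Op.idx z.2 = z.1.dom}), R.Op m := fun m i =>
    evalT i.1.2 i.1.1.fst.out (R.exists_ok_prodArr i.1.1 i.1.2 (R.bd_of_idx i.2)).1
  have b1 : T.map (fun _ x => (x.ins, x.out)) (T.map q Ω) = g.fst.dom := by
    refine Eq.trans ?_ (R.bd_of_idx v1)
    rw [T.map_map, T.map_map]; rfl
  obtain ⟨ok1, -⟩ := R.exists_ok_prodArr g _ b1
  obtain ⟨ok2, m1⟩ := R.evalT_mul (fun m i => i.1.2) (fun m i => i.1.1.fst.out)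
    (fun m i => (R.exists_ok_prodArr i.1.1 i.1.2 (R.bd_of_idx i.2)).1) Ω g.fst.out ok1
  have a0 : 𝒯.tgt (𝒯.actArr (T.map (fun _ i => i.1.1.snd.arr) Ω)) =
      (evalT (T.map q Ω) g.fst.out ok1).tree := by
    refine (𝒯.tgt_actArr _).trans (Eq.trans ?_ (R.tree_evalT _ _ _).symm)
    refine congrArg (@𝒯.act n) ((T.map_map _ _ _).trans (Eq.trans ?_ (T.map_map _ _ _).symm))
    refine T.map_congr (fun m i => ?_) Ω
    exact R.tree_of_idx i.2 _ _
  obtain ⟨ok3, m2⟩ := R.evalT_act q (fun m i => i.1.1.snd.arr) 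
    (fun m i => R.tree_of_idx i.2 _ _) Ω g.fst.out ok1 a0
  have a1 : T.map (fun _ p => p.arr) (T.map (fun _ p => p.snd) Θ) =
      T.map (fun _ i => i.1.1.snd.arr) Ω := by
    rw [← o1, T.map_map, T.map_map]
  have mW : T.mul (T.map (fun _ i => i.1.2) Ω) = W := o2
  have okW : Ok W.1 g.fst.out := by rw [← mW]; exact ok2
  have okV : Ok V.1 g.fst.out := ok3
  have eW : evalT W g.fst.out okW = evalT (T.map q Ω) g.fst.out ok1 :=
    (R.evalT_congr mW.symm rfl _ ok2).trans m1
  have kc := R.tree_of_idx w1 g.fst.out okW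
  have ka : 𝒯.tgt g.snd.arr = 𝒯.src (𝒯.actArr (T.map (fun _ i => i.1.1.snd.arr) Ω)) := by
    refine (g.snd.src_arr : 𝒯.tgt g.snd.arr = 𝒯.act g.snd.dom).trans
      (Eq.trans ?_ (𝒯.src_actArr _).symm)
    refine congrArg (@𝒯.act n) (g.dom_snd.symm.trans ?_)
    refine (congrArg (fun t => T.map (fun _ x => x.2) t) h.symm).trans ?_
    refine Eq.trans ?_ (congrArg (fun t => T.map 𝒯.src t) a1)
    refine (T.map_map _ _ _).trans (Eq.trans ?_ (congrArg (fun t => T.map 𝒯.src t) (T.map_map _ _ _).symm))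
    exact T.eq_map_map (by intros; rfl) Θ
  let γ : 𝒯.Arr n := c.snd.arr
  -- Composition is reversed in the opposite: in `𝒯` the arrow of `g` comes first and the action of
  -- the inner arrows after it.
  have kb : γ = 𝒯.comp (𝒯.actArr (T.map (fun _ i => i.1.1.snd.arr) Ω)) g.snd.arr ka :=
    𝒯.comp_congr (congrArg (@𝒯.actArr n) a1) rfl _ _
  have kd : 𝒯.tgt γ = (evalT (T.map q Ω) g.fst.out ok1).tree :=
    kc.trans (congrArg Op.tree eW)
  have ke := (congrArg (fun φ => 𝒯.tgt φ) kb.symm).trans kd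
  refine Eq.trans (b := (evalT (T.map q Ω) g.fst.out ok1).act γ kd)
    (Op.act_congr eW rfl kc kd) ?_
  refine (Op.act_congr rfl kb kd ke).trans ?_
  refine Eq.trans (R.op_act_act _ _ _ a0 ka ka ke).symm ?_
  exact Op.act_congr m2.symm rfl _ _

/-- A relaxed multicategory as a map to `Set`. -/
noncomputable def toHom : T2Multicat.Hom ((MI R.C₀).prod 𝒯.op.toMulticat) SetT2.{u} where
  obj _ y := R.homObj y
  arr _ p := R.setArr p
  dom_arr _ := rfl
  cod_arr _ := rfl
  arr_id x := R.setArr_id x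
  arr_comp Θ g h h' := R.setArr_comp Θ g h h'

end RelaxedMulticategory

/-- In its applications the objects and hom sets agree by definition, so only the operations need
comparison. -/
theorem RelaxedData.ext_ops {𝒯 : StrucCat.{z, z'}} (C : RelaxedData.{u, w} 𝒯)
    (act : ∀ {n : ℕ} {τ' τ : 𝒯.Obj n} {as : Fin n → C.C₀} {a : C.C₀},
      𝒯.Hom τ' τ → C.Hom τ as a → C.Hom τ' as a)
    (comp : ∀ {n : ℕ} {k : Fin n → ℕ} {τ : 𝒯.Obj n} {σ : ∀ i, 𝒯.Obj (k i)}
      {bs : ∀ i, Fin (k i) → C.C₀} {as : Fin n → C.C₀} {a : C.C₀},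
      (∀ i, C.Hom (σ i) (bs i) (as i)) → C.Hom τ as a → C.Hom (𝒯.substObj τ σ) (concat bs) a)
    (ident : ∀ a : C.C₀, C.Hom 𝒯.unitObj (fun _ => a) a)
    (h₁ : ∀ {n : ℕ} {τ' τ : 𝒯.Obj n} {as : Fin n → C.C₀} {a : C.C₀} (φ : 𝒯.Hom τ' τ)
      (f : C.Hom τ as a), act φ f = C.act φ f)
    (h₂ : ∀ {n : ℕ} {k : Fin n → ℕ} {τ : 𝒯.Obj n} {σ : ∀ i, 𝒯.Obj (k i)}
      {bs : ∀ i, Fin (k i) → C.C₀} {as : Fin n → C.C₀} {a : C.C₀}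
      (g : ∀ i, C.Hom (σ i) (bs i) (as i)) (f : C.Hom τ as a), comp g f = C.comp g f)
    (h₃ : ∀ a, ident a = C.ident a) :
    RelaxedData.mk C.C₀ C.Hom act comp ident = C := by
  obtain ⟨C₀, Hom, act', comp', ident'⟩ := C
  congr 1
  · funext n τ' τ as a φ f
    exact h₁ φ f
  · funext n k τ σ bs as a g f
    exact h₂ g f
  · funext a
    exact h₃ a

/-- The set `A`, with the identity of `MI A`. -/
def EnrichedPlain.tautological (A : Type w) : EnrichedPlain.{w, w, w} (MI A) :=
  ⟨A, T2Multicat.Hom.id _⟩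

/-! ### Recovering the relaxed multicategory from its map to `Set` -/

namespace RelaxedMulticategory
open RelaxedData
variable {𝒯 : StrucCat.{z, z'}} (R : RelaxedMulticategory.{u, w} 𝒯)

theorem toFun_setArr {n : ℕ} (p : T2Multicat.ProdArr (MI R.C₀) 𝒯.op.toMulticat n)
    {D : T (fun _ => Type u) n} (x : R.Op n) (hD : (R.setArr p).dom = D)
    (hX : (R.setArr p).cod = R.Hom x.tree x.ins x.out) (W : T R.Op n) (h : T.map Op.idx W = p.dom)
    (q : Elements D) (hq : q.1 = T.map Op.pt W) (hx : R.value p W h = x) :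
    (R.setArr p).toFun hD hX q = x.arr := by
  subst hx
  obtain ⟨q, hq'⟩ := q
  obtain rfl : q = T.map Op.pt W := hq
  exact eq_of_heq (Sigma.mk.inj ((SetArr.toFun_ap (R.setArr p) hD hX _).trans
    (R.ap_setArr p W h _))).2

/-- At one-vertex, two-level and trivial trees, composition reduces by the unit laws to an
operation, a single composite and an identity. At the last two the arrow of `𝒯` is an identity and
acts trivially. -/
theorem relaxedData_toHom :
    (EnrichedPlain.tautological R.C₀).relaxedData R.toHom = R.toRelaxedData := by
  refine RelaxedData.ext_ops R.toRelaxedData _ _ _ ?_ ?_ ?_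
  · intro n τ' τ as a φ f
    refine R.toFun_setArr _ ⟨τ', as, a, R.act φ f⟩ _ _ (T.unit ⟨τ, as, a, f⟩) rfl _ rfl ?_
    refine Eq.trans ?_ (Op.act_hom f φ)
    exact Op.act_congr (R.evalT_unit ⟨τ, as, a, f⟩ _) rfl _ _
  · intro n k τ σ bs as a g f
    let f' : R.Op n := ⟨τ, as, a, f⟩
    let g' : ∀ i, R.Op (k i) := fun i => ⟨σ i, bs i, as i, g i⟩
    refine R.toFun_setArr _ (f'.comp g' fun _ => rfl) _ _ (T.twoLevel f' g') rfl _ rfl ?_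
    refine Eq.trans ?_ (R.op_act_id (f'.comp g' fun _ => rfl) (𝒯.tgt_id _))
    obtain ⟨h, e⟩ := R.evalT_twoLevel f' g' fun _ => rfl
    exact Op.act_congr e rfl _ _
  · intro a
    refine R.toFun_setArr _ (Op.ident a : R.Op 1) _ _ T.trivial rfl _ rfl ?_
    refine Eq.trans ?_ (R.op_act_id (Op.ident a : R.Op 1) (𝒯.tgt_id _))
    exact Op.act_congr (R.evalT_trivial a _) rfl _ _

end RelaxedMulticategory

/-! ### Diagrams and their values under a map to `Set` -/

namespace RelaxedData
variable {𝒯 : StrucCat.{z, z'}}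

/-- A tree of operations, a boundary for which it is coloured consistently, and an arrow of `𝒯` to
the tree obtained by substitution. -/
structure Diagram (C : RelaxedData.{u, w} 𝒯) (n : ℕ) where
  ops : T C.Op n
  ins : Fin n → C.C₀
  out : C.C₀
  typed : (T.map Op.bd ops).1.Typed (fun i => ins (Fin.cast (T.map Op.bd ops).2 i)) out
  arr : 𝒯.Arr n
  tgt_arr : 𝒯.tgt arr = 𝒯.act (T.map (fun _ x => x.tree) ops)

namespace Diagram

theorem ext_of {C : RelaxedData.{u, w} 𝒯} {n : ℕ} {d d' : C.Diagram n} (h₁ : d.ops = d'.ops)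
    (h₂ : d.ins = d'.ins) (h₃ : d.out = d'.out) (h₄ : d.arr = d'.arr) : d = d' := by
  obtain ⟨W, i, o, t, φ, h⟩ := d
  obtain ⟨W', i', o', t', φ', h'⟩ := d'
  dsimp only at h₁ h₂ h₃ h₄
  subst h₁ h₂ h₃ h₄
  rfl

/-- The arrow of `MI C₀ × 𝒯ᵒᵖ` underlying a diagram. -/
def prodArr {C : RelaxedData.{u, w} 𝒯} {n : ℕ} (d : C.Diagram n) :
    T2Multicat.ProdArr (MI C.C₀) 𝒯.op.toMulticat n where
  dom := T.map Op.idx d.ops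
  fst := ⟨T.map Op.bd d.ops, d.ins, d.out, d.typed⟩
  snd := ⟨T.map (fun _ (x : C.Op _) => x.tree) d.ops, d.arr, d.tgt_arr⟩
  dom_fst := T.map_map _ _ _
  dom_snd := T.map_map _ _ _

variable {A : Type w} (G : T2Multicat.Hom ((MI A).prod 𝒯.op.toMulticat) SetT2.{u})

/-- The data of a relaxed multicategory given by a map to `Set`. -/
abbrev _root_.Relaxed.RelaxedData.ofHom : RelaxedData.{u, w} 𝒯 :=
  (EnrichedPlain.tautological A).relaxedData G

variable {G}

theorem map_pt_dom {n : ℕ} (p : T2Multicat.ProdArr (MI A) 𝒯.op.toMulticat n)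
    (W : T (ofHom G).Op n) (h : T.map Op.idx W = p.dom) :
    T.map (fun _ y => y.1) (T.map Op.pt W) = (G.arr p).dom := by
  refine (map_fst_pt W).trans (Eq.trans ?_ (G.dom_arr p).symm)
  exact congrArg (fun t => T.map G.obj t) h

/-- The operation assigned by `G` to a diagram. -/
def val {n : ℕ} (d : (ofHom G).Diagram n) : (ofHom G).Op n where
  tree := 𝒯.src d.arr
  ins := d.ins
  out := d.out
  arr := (G.arr d.prodArr).toFun rfl (G.cod_arr d.prodArr)
    ⟨T.map Op.pt d.ops, map_pt_dom d.prodArr d.ops rfl⟩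

theorem pt_val {n : ℕ} (d : (ofHom G).Diagram n) :
    d.val.pt = (G.arr d.prodArr).ap (T.map Op.pt d.ops) (map_pt_dom d.prodArr d.ops rfl) :=
  SetArr.toFun_ap (G.arr d.prodArr) rfl (G.cod_arr d.prodArr) _

/-- Preservation of identities by `G`. -/
theorem val_unit {n : ℕ} (x : (ofHom G).Op n) (d : (ofHom G).Diagram n) (h₁ : d.ops = T.unit x)
    (h₂ : d.ins = x.ins) (h₃ : d.out = x.out) (h₄ : d.arr = 𝒯.id x.tree) : d.val = x := by
  obtain ⟨W, i, o, t, φ, h⟩ := d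
  dsimp only at h₁ h₂ h₃ h₄
  subst h₁ h₂ h₃ h₄
  refine Op.ext_pt (Prod.ext rfl (𝒯.src_id _)) ((pt_val _).trans ?_)
  have e : G.arr (prodArr ⟨T.unit x, x.ins, x.out, t, 𝒯.id x.tree, h⟩) =
      SetT2.id (G.obj x.idx) := by
    refine Eq.trans ?_ (G.arr_id x.idx)
    rfl
  exact (SetArr.ap_congr e rfl _ (by rfl)).trans (SetArr.ap_id _ x.arr rfl)

/-- The colouring of the substituted tree is that of a composite in `MI C₀`. -/
theorem typed_mul {C : RelaxedData.{u, w} 𝒯} {I : ℕ → Type v} {n : ℕ} (W : T I n)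
    (d : ∀ ⦃m⦄, I m → C.Diagram m) (x : ∀ ⦃m⦄, I m → C.Op m)
    (hi : ∀ ⦃m⦄ (i : I m), (x i).ins = (d i).ins)
    (ho : ∀ ⦃m⦄ (i : I m), (x i).out = (d i).out) (ins : Fin n → C.C₀) (out : C.C₀)
    (t : (T.map Op.bd (T.map x W)).1.Typed
      (fun i => ins (Fin.cast (T.map Op.bd (T.map x W)).2 i)) out) :
    (T.map Op.bd (T.mul (T.map (fun _ i => (d i).ops) W))).1.Typed
      (fun i => ins (Fin.cast (T.map Op.bd (T.mul (T.map (fun _ i => (d i).ops) W))).2 i)) out := by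
  have h : T.map (MI C.C₀).cod (T.map (fun _ i => (d i).prodArr.fst) W) =
      T.map Op.bd (T.map x W) := by
    refine (T.map_map _ _ _).trans (Eq.trans ?_ (T.map_map _ _ _).symm)
    exact T.map_congr (fun m i => Prod.ext (hi i).symm (ho i).symm) W
  have k := ((MI C.C₀).comp (T.map (fun _ i => (d i).prodArr.fst) W)
    ⟨T.map Op.bd (T.map x W), ins, out, t⟩ h).typed
  refine Tr.Typed.congr (congrArg Subtype.val ?_) ?_ k
  · refine Eq.trans (congrArg (@T.mul _ n) ?_) (T.map_mul _ _).symm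
    refine (T.map_map _ _ _).trans (Eq.trans ?_ (T.map_map _ _ _).symm)
    rfl
  · intro i j hij
    exact congrArg ins (Fin.ext hij)

/-- Preservation of composition by `G`: the outer diagram `e` carries the values of the inner
diagrams at its vertices, and `e'` carries the inner diagrams substituted. -/
theorem val_mul {I : ℕ → Type v} {n : ℕ} (W : T I n) (d : ∀ ⦃m⦄, I m → (ofHom G).Diagram m)
    (e e' : (ofHom G).Diagram n)
    (h₁ : e.ops = T.map (fun _ i => (d i).val) W)
    (h₁' : e'.ops = T.mul (T.map (fun _ i => (d i).ops) W)) (h₂ : e.ins = e'.ins)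
    (h₃ : e.out = e'.out) (k : 𝒯.tgt e.arr = 𝒯.src (𝒯.actArr (T.map (fun _ i => (d i).arr) W)))
    (h₄ : e'.arr = 𝒯.comp (𝒯.actArr (T.map (fun _ i => (d i).arr) W)) e.arr k) :
    e'.val = e.val := by
  have hs : 𝒯.src e'.arr = 𝒯.src e.arr := by rw [h₄, 𝒯.src_comp]
  refine Op.ext_pt (Prod.ext (Prod.ext h₂.symm h₃.symm) hs) ((pt_val _).trans
    (Eq.trans ?_ (pt_val _).symm))
  have hc : T.map ((MI A).prod 𝒯.op.toMulticat).cod (T.map (fun _ i => (d i).prodArr) W) =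
      e.prodArr.dom := by
    refine Eq.trans ?_ (congrArg (fun t => T.map Op.idx t) h₁).symm
    exact (T.map_map _ _ _).trans (T.eq_map_map (by intros; rfl) W)
  have hp : e'.prodArr = ((MI A).prod 𝒯.op.toMulticat).comp (T.map (fun _ i => (d i).prodArr) W)
      e.prodArr hc := by
    refine T2Multicat.ProdArr.ext ?_ (MIArr.ext ?_ h₂.symm h₃.symm)
      (StrucCat.MultiArr.ext ?_ (h₄.trans ?_))
    · refine (congrArg (fun t => T.map Op.idx t) h₁').trans ((T.map_mul _ _).trans ?_)
      refine congrArg (@T.mul _ n) ((T.map_map _ _ _).trans ?_)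
      exact T.eq_map_map (by intros; rfl) W
    · refine (congrArg (fun t => T.map Op.bd t) h₁').trans ((T.map_mul _ _).trans ?_)
      refine congrArg (@T.mul _ n) ((T.map_map _ _ _).trans ?_)
      refine Eq.trans ?_ (T.map_map _ _ _).symm
      exact T.eq_map_map (by intros; rfl) W
    · refine (congrArg (fun t => T.map (fun _ x => x.tree) t) h₁').trans ((T.map_mul _ _).trans ?_)
      refine congrArg (@T.mul _ n) ((T.map_map _ _ _).trans ?_)
      refine Eq.trans ?_ (T.map_map _ _ _).symm
      exact T.eq_map_map (by intros; rfl) W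
    · refine 𝒯.comp_congr (congrArg (@𝒯.actArr n) ?_) rfl _ _
      refine Eq.trans ?_ (T.map_map _ _ _).symm
      exact T.eq_map_map (by intros; rfl) W
  have ha : T.map SetT2.cod (T.map G.arr (T.map (fun _ i => (d i).prodArr) W)) =
      SetT2.dom (G.arr e.prodArr) := by
    refine Eq.trans ?_ (G.dom_arr _).symm
    refine Eq.trans ?_ (congrArg (fun t => T.map G.obj t) hc)
    refine (T.map_map _ _ _).trans (Eq.trans ?_ (T.map_map _ _ _).symm)
    exact T.map_congr (fun m p => G.cod_arr p) _
  have hG := (congrArg (fun p => G.arr p) hp).trans (G.arr_comp _ _ hc ha)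
  have hx : T.mul (T.map (fun _ i => T.map Op.pt (d i).ops) W) = T.map Op.pt e'.ops := by
    refine Eq.trans ?_ (congrArg (fun t => T.map Op.pt t) h₁').symm
    exact (congrArg (@T.mul _ n) (T.eq_map_map (by intros; rfl) W)).trans (T.map_mul _ _).symm
  have hv : T.map (fun _ i => (G.arr (d i).prodArr).ap (T.map Op.pt (d i).ops)
      (map_pt_dom (d i).prodArr (d i).ops rfl)) W = T.map Op.pt e.ops := by
    refine Eq.trans ?_ (congrArg (fun t => T.map Op.pt t) h₁).symm
    refine Eq.trans ?_ (T.map_map _ _ _).symm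
    exact T.map_congr (fun m i => (pt_val (d i)).symm) W
  have hm := map_pt_dom e'.prodArr e'.ops rfl
  refine (SetArr.ap_congr hG rfl hm ((congrArg SetArr.dom hG.symm).symm ▸ hm)).trans ?_
  refine (SetArr.ap_comp W (fun _ i => G.arr (d i).prodArr) (fun _ i => T.map Op.pt (d i).ops)
    (fun _ i => map_pt_dom (d i).prodArr (d i).ops rfl) _ _ ha _ (T.map_map _ _ _).symm hx _
    (by rw [hv]; exact map_pt_dom e.prodArr e.ops rfl)).trans ?_
  exact SetArr.ap_congr rfl hv _ _

end Diagram
end RelaxedData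

namespace T
variable {X : ℕ → Type u}

/-- The two ways of building a three-level tree. Only underlying trees are compared, because the
input counts are different iterated sums. -/
theorem mul_twoLevel_twoLevel {n : ℕ} {k : Fin n → ℕ} {l : ∀ i, Fin (k i) → ℕ} (x : X n)
    (y : ∀ i, X (k i)) (c : ∀ i j, X (l i j)) :
    (mul (twoLevel (X := T X) (twoLevel x y) fun p : Fin (∑ i, k i) =>
      unit (c (finSigmaFinEquiv.symm p).1 (finSigmaFinEquiv.symm p).2))).1 =
    (node x fun i => twoLevel (y i) (c i)).1 := by
  change Tr.node n x _ = Tr.node n x _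
  congr 1
  funext i
  refine (Tr.graft_node_leaf (y i) _).trans ?_
  change Tr.node _ (y i) _ = Tr.node _ (y i) _
  congr 1
  funext j
  refine (Tr.flat_node_leaf _ _).trans ?_
  have e : ∀ p : Fin (∑ i, k i), p = finSigmaFinEquiv ⟨i, j⟩ →
      (unit (c (finSigmaFinEquiv.symm p).1 (finSigmaFinEquiv.symm p).2)).1 = (unit (c i j)).1 := by
    rintro p rfl
    rw [Equiv.symm_apply_apply]
  refine e _ (Fin.ext ?_)
  exact Tr.finSigma_congr (k := fun i => (Tr.node (k i) (y i) fun _ => .leaf).leaves) (k' := k)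
    (fun i => Tr.leaves_node_leaf (k i) (y i)) i _ j rfl

theorem mul_twoLevel_trivial {n : ℕ} (x : X n) :
    (mul (twoLevel (X := T X) trivial fun _ : Fin 1 => unit x)).1 = (unit x).1 :=
  Tr.flat_node_leaf _ _

end T

theorem Tr.Typed.unique {A : Type u} (t : Tr (IndObj A)) (as as' : Fin t.leaves → A) (a : A)
    (h : t.Typed as a) (h' : t.Typed as' a) : as = as' := by
  induction t generalizing a with
  | leaf =>
    funext i
    rw [Subsingleton.elim (α := Fin 1) i (0 : Fin 1)]
    exact Eq.trans h h'.symm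
  | node n x c ih =>
    funext p
    obtain ⟨⟨i, j⟩, rfl⟩ := finSigmaFinEquiv.surjective p
    exact congrFun (ih i _ _ _ (h.2 i) (h'.2 i)) j

namespace RelaxedData.Diagram
variable {𝒯 : StrucCat.{z, z'}} {C : RelaxedData.{u, w} 𝒯}

/-- The arrow of a diagram is an identity. -/
def Plain {n : ℕ} (d : C.Diagram n) : Prop := d.arr = 𝒯.id (𝒯.act (T.map (fun _ x => x.tree) d.ops))

theorem exists_unit {n : ℕ} (x : C.Op n) (φ : 𝒯.Arr n) (h : 𝒯.tgt φ = x.tree) :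
    ∃ d : C.Diagram n, d.ops = T.unit x ∧ d.ins = x.ins ∧ d.out = x.out ∧ d.arr = φ :=
  ⟨⟨T.unit x, x.ins, x.out, ((MI C.C₀).id x.bd).typed, φ, h.trans (𝒯.act_unit _).symm⟩,
    rfl, rfl, rfl, rfl⟩

variable {A : Type w} {G : T2Multicat.Hom ((MI A).prod 𝒯.op.toMulticat) SetT2.{u}}

theorem act_eq_val {n : ℕ} (x : (ofHom G).Op n) (φ : 𝒯.Arr n) (h : 𝒯.tgt φ = x.tree) 
    (d : (ofHom G).Diagram n) (h₁ : d.ops = T.unit x) (h₂ : d.ins = x.ins) (h₃ : d.out = x.out)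
    (h₄ : d.arr = φ) : x.act φ h = d.val := by
  obtain ⟨W, i, o, t, φ, k⟩ := d
  dsimp only at h₁ h₂ h₃ h₄
  subst h₁ h₂ h₃ h₄
  rfl

theorem comp_eq_val {n : ℕ} {k : Fin n → ℕ} (f : (ofHom G).Op n) (g : ∀ i, (ofHom G).Op (k i))
    (h : ∀ i, (g i).out = f.ins i) :
    ∃ d : (ofHom G).Diagram (∑ i, k i), d.ops = T.twoLevel f g ∧ d.ins = (f.comp g h).ins ∧
      d.out = f.out ∧ d.Plain ∧ d.val = f.comp g h := by
  obtain ⟨τ, as, a, f⟩ := f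
  obtain ⟨σ, bs, as', g, rfl⟩ : ∃ (σ : ∀ i, 𝒯.Obj (k i)) (bs : ∀ i, Fin (k i) → (ofHom G).C₀)
    (as' : Fin n → (ofHom G).C₀) (g' : ∀ i, (ofHom G).Hom (σ i) (bs i) (as' i)),
    g = fun i => ⟨σ i, bs i, as' i, g' i⟩ := ⟨_, _, _, fun i => (g i).arr, rfl⟩
  obtain rfl : as' = as := funext h
  let f' : (ofHom G).Op n := ⟨τ, as', a, f⟩
  let g' : ∀ i, (ofHom G).Op (k i) := fun i => ⟨σ i, bs i, as' i, g i⟩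
  refine ⟨⟨T.twoLevel f' g', concat bs, a, MIArr.typed_twoLevel bs as' a, 𝒯.id _, 𝒯.tgt_id _⟩,
    rfl, rfl, rfl, rfl, ?_⟩
  refine Op.ext_pt (Prod.ext rfl (𝒯.src_id _)) ((pt_val _).trans (Eq.symm ?_))
  exact SetArr.toFun_ap (G.arr _) (G.dom_arr _) _ _

theorem ident_eq_val (a : A) :
    ∃ d : (ofHom G).Diagram 1, d.ops = T.trivial ∧ d.ins = (fun _ => a) ∧
      d.out = a ∧ d.Plain ∧ d.val = Op.ident a := by
  refine ⟨⟨T.trivial, fun _ => a, a, rfl, 𝒯.id _, 𝒯.tgt_id _⟩, rfl, rfl, rfl, rfl, ?_⟩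
  refine Op.ext_pt (Prod.ext rfl (𝒯.src_id _)) ((pt_val _).trans (Eq.symm ?_))
  exact SetArr.toFun_ap (G.arr _) (G.dom_arr _) _ _

/-- By `Tr.Typed.unique` the tree and the output colour fix the input colours, and plainness fixes
the arrow. The output has to be given since a trivial tree does not determine it. -/
theorem val_congr {n n' : ℕ} (d : (ofHom G).Diagram n) (d' : (ofHom G).Diagram n')
    (h₁ : d.ops.1 = d'.ops.1) (h₂ : d.out = d'.out) (h₃ : d.Plain) (h₄ : d'.Plain) :
    d.val.toArrow = d'.val.toArrow := by
  obtain ⟨⟨W, rfl⟩, i, o, t, φ, k⟩ := d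
  obtain ⟨⟨W', rfl⟩, i', o', t', φ', k'⟩ := d'
  unfold Plain at h₃ h₄
  dsimp only at h₁ h₂ h₃ h₄
  subst h₁ h₂ h₃ h₄
  have e := Tr.Typed.unique _ _ _ _ t t'
  obtain rfl : i = i' := funext fun p =>
    congrFun e (Fin.cast (Tr.leaves_map Op.bd W).symm p)
  rfl

theorem exists_mul {I : ℕ → Type v} {n : ℕ} (W : T I n) (d : ∀ ⦃m⦄, I m → (ofHom G).Diagram m)
    (e : (ofHom G).Diagram n) (h : e.ops = T.map (fun _ i => (d i).val) W) :
    ∃ (e' : (ofHom G).Diagram n) (k : 𝒯.tgt e.arr = 𝒯.src (𝒯.actArr (T.map (fun _ i => (d i).arr) W))),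
      e'.ops = T.mul (T.map (fun _ i => (d i).ops) W) ∧ e'.ins = e.ins ∧ e'.out = e.out ∧
      e'.arr = 𝒯.comp (𝒯.actArr (T.map (fun _ i => (d i).arr) W)) e.arr k ∧ e'.val = e.val := by
  have k : 𝒯.tgt e.arr = 𝒯.src (𝒯.actArr (T.map (fun _ i => (d i).arr) W)) := by
    rw [e.tgt_arr, h, 𝒯.src_actArr, T.map_map, T.map_map]
    rfl
  obtain ⟨W', ins, out, t, β, hβ⟩ := e
  dsimp only at h
  subst h
  refine ⟨⟨T.mul (T.map (fun _ i => (d i).ops) W), ins, out,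
    typed_mul W d (fun _ i => (d i).val) (fun _ _ => rfl) (fun _ _ => rfl) ins out t,
    𝒯.comp _ _ k, ?_⟩, k, rfl, rfl, rfl, rfl, ?_⟩
  · rw [𝒯.tgt_comp, 𝒯.tgt_actArr, T.map_mul, 𝒯.act_mul, T.map_map, T.map_map, T.map_map]
    exact congrArg (@𝒯.act n) (T.map_congr (fun m i => (d i).tgt_arr) W)
  · exact val_mul W d _ _ rfl rfl rfl rfl k rfl

/-- Identities are preserved by the action and by composition, so plain diagrams are closed under
substitution. -/
theorem exists_mul_plain {I : ℕ → Type v} {n : ℕ} (W : T I n)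
    (d : ∀ ⦃m⦄, I m → (ofHom G).Diagram m) (hd : ∀ ⦃m⦄ (i : I m), (d i).Plain)
    (e : (ofHom G).Diagram n) (h : e.ops = T.map (fun _ i => (d i).val) W) (he : e.Plain) :
    ∃ e' : (ofHom G).Diagram n,
      e'.ops = T.mul (T.map (fun _ i => (d i).ops) W) ∧ e'.ins = e.ins ∧ e'.out = e.out ∧
      e'.Plain ∧ e'.val = e.val := by
  obtain ⟨e', k, h₁, h₂, h₃, h₄, h₅⟩ := exists_mul W d e h
  refine ⟨e', h₁, h₂, h₃, ?_, h₅⟩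
  have ha : 𝒯.actArr (T.map (fun _ i => (d i).arr) W) =
      𝒯.id (𝒯.act (T.map (fun _ x => x.tree) e'.ops)) := by
    rw [h₁, T.map_mul, 𝒯.act_mul, T.map_map, T.map_map, ← 𝒯.actArr_id, T.map_map]
    exact congrArg (@𝒯.actArr n) (T.map_congr (fun m i => hd i) W)
  have hb : e.arr = 𝒯.id (𝒯.act (T.map (fun _ x => x.tree) e'.ops)) := by
    unfold Plain at he
    rw [he, ← e.tgt_arr, k, ha, 𝒯.src_id]
  refine h₄.trans ((𝒯.comp_congr ha hb _ (by rw [𝒯.tgt_id, 𝒯.src_id])).trans ?_)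
  refine (𝒯.comp_congr (congrArg (@𝒯.id n) (𝒯.tgt_id _).symm) rfl _ ?_).trans (𝒯.id_comp _ ?_)
  all_goals rw [𝒯.src_id]

end RelaxedData.Diagram

/-! ### The axioms of a relaxed multicategory for a map to `Set` -/

namespace RelaxedData.Diagram
variable {𝒯 : StrucCat.{z, z'}} {A : Type w}
  {G : T2Multicat.Hom ((MI A).prod 𝒯.op.toMulticat) SetT2.{u}}

theorem Plain.arr_eq {n : ℕ} {d : (ofHom G).Diagram n} (h : d.Plain) :
    d.arr = 𝒯.id d.val.tree := by
  have e : d.val.tree = 𝒯.act (T.map (fun _ x => x.tree) d.ops) :=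
    (congrArg (fun φ => 𝒯.src φ) h).trans (𝒯.src_id _)
  rw [e]
  exact h

theorem exists_unit_val {n : ℕ} (x : (ofHom G).Op n) :
    ∃ d : (ofHom G).Diagram n, d.ops = T.unit x ∧ d.ins = x.ins ∧ d.out = x.out ∧
      d.Plain ∧ d.val = x := by
  obtain ⟨d, h₁, h₂, h₃, h₄⟩ := exists_unit x (𝒯.id x.tree) (𝒯.tgt_id _)
  refine ⟨d, h₁, h₂, h₃, h₄.trans ?_, val_unit x d h₁ h₂ h₃ h₄⟩
  rw [h₁, T.map_unit, 𝒯.act_unit]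

theorem op_act_id {n : ℕ} (x : (ofHom G).Op n) (h) : x.act (𝒯.id x.tree) h = x := by
  obtain ⟨d, h₁, h₂, h₃, h₄⟩ := exists_unit x _ h
  exact (act_eq_val x _ h d h₁ h₂ h₃ h₄).trans (val_unit x d h₁ h₂ h₃ h₄)

/-- Acting is the value at a one-vertex diagram; substituting one such diagram in another composes
their arrows. -/
theorem op_act_act {n : ℕ} (x : (ofHom G).Op n) (φ φ' : 𝒯.Arr n) (h h' k k') :
    (x.act φ h).act φ' h' = x.act (𝒯.comp φ φ' k) k' := by
  obtain ⟨d, h₁, h₂, h₃, h₄⟩ := exists_unit x φ h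
  have hd := act_eq_val x φ h d h₁ h₂ h₃ h₄
  obtain ⟨e, l₁, l₂, l₃, l₄⟩ := exists_unit (x.act φ h) φ' h'
  obtain ⟨e', k₀, m₁, m₂, m₃, m₄, m₅⟩ := exists_mul (T.unit d) (fun _ d => d) e
    (by rw [l₁, hd]; rfl)
  refine (act_eq_val _ _ _ e l₁ l₂ l₃ l₄).trans (m₅.symm.trans (Eq.symm ?_))
  refine act_eq_val _ _ _ e' (m₁.trans ((T.mul_unit _).trans h₁)) (m₂.trans l₂) (m₃.trans l₃)
    (m₄.trans ?_)
  refine 𝒯.comp_congr ((𝒯.actArr_unit _).trans h₄) l₄ _ _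

/-- Both sides are the value at one diagram: the two-level tree of `f` and the `g i`, with the
action of `φ` and the `ψ i` as arrow. On the left a plain two-level diagram is substituted in a
one-vertex one; on the right one-vertex diagrams are substituted in a plain two-level one. -/
theorem op_act_comp {n : ℕ} {k : Fin n → ℕ} (f : (ofHom G).Op n) (g : ∀ i, (ofHom G).Op (k i)) (h)
    (φ : 𝒯.Arr n) (ψ : ∀ i, 𝒯.Arr (k i)) (hφ : 𝒯.tgt φ = f.tree)
    (hψ : ∀ i, 𝒯.tgt (ψ i) = (g i).tree) (h₁) :
    (f.comp g h).act (𝒯.actArr (T.twoLevel φ ψ)) h₁ =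
      (f.act φ hφ).comp (fun i => (g i).act (ψ i) (hψ i)) h := by
  obtain ⟨d, p₁, p₂, p₃, p₄, p₅⟩ := comp_eq_val f g h
  obtain ⟨e, q₁, q₂, q₃, q₄⟩ := exists_unit (f.comp g h) _ h₁
  obtain ⟨e', k₀, r₁, r₂, r₃, r₄, r₅⟩ := exists_mul (T.unit d) (fun _ d => d) e
    (by rw [q₁, ← p₅]; rfl)
  obtain ⟨df, s₁, s₂, s₃, s₄⟩ := exists_unit f φ hφ
  choose dg t₁ t₂ t₃ t₄ using fun i => exists_unit (g i) (ψ i) (hψ i)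
  have hf := act_eq_val f φ hφ df s₁ s₂ s₃ s₄
  have hg := fun i => act_eq_val (g i) (ψ i) (hψ i) (dg i) (t₁ i) (t₂ i) (t₃ i) (t₄ i)
  obtain ⟨c, u₁, u₂, u₃, u₄, u₅⟩ := comp_eq_val (f.act φ hφ) (fun i => (g i).act (ψ i) (hψ i)) h
  obtain ⟨c', k₁, v₁, v₂, v₃, v₄, v₅⟩ := exists_mul (T.twoLevel df dg) (fun _ d => d) c
    (by rw [u₁, T.map_twoLevel, hf]; simp only [hg])
  refine (act_eq_val _ _ _ e q₁ q₂ q₃ q₄).trans (r₅.symm.trans (Eq.trans ?_ (v₅.trans u₅)))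
  refine congrArg val (ext_of (r₁.trans ?_) ?_ ?_ (r₄.trans (Eq.trans ?_ v₄.symm)))
  · refine (T.mul_unit _).trans (p₁.trans (Eq.trans ?_ v₁.symm))
    rw [T.map_twoLevel, s₁]
    simp only [t₁]
    exact (T.mul_map_unit (T.twoLevel f g)).symm
  · exact r₂.trans (q₂.trans (v₂.trans u₂).symm)
  · exact r₃.trans (q₃.trans (v₃.trans u₃).symm)
  · have a₁ : 𝒯.actArr (T.map (fun _ d => d.arr) (T.unit d)) = 𝒯.id (𝒯.tgt e.arr) := by
      rw [q₄, h₁, ← p₅]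
      exact (𝒯.actArr_unit _).trans (Plain.arr_eq p₄)
    have a₂ : 𝒯.actArr (T.map (fun _ d => d.arr) (T.twoLevel df dg)) = e.arr := by
      rw [q₄, T.map_twoLevel, s₄]
      simp only [t₄]
    have a₃ : c.arr = 𝒯.id (𝒯.src e.arr) := by
      refine u₄.trans (congrArg (@𝒯.id _) ?_)
      rw [u₁, q₄, 𝒯.src_actArr]
      rfl
    refine (𝒯.comp_congr a₁ rfl _ (𝒯.src_id _).symm).trans ((𝒯.id_comp _ _).trans ?_)
    exact ((𝒯.comp_congr a₂ a₃ _ (𝒯.tgt_id _)).trans (𝒯.comp_id _ _)).symm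

/-- Both bracketings are values at plain diagrams on the same three-level tree. -/
theorem op_assoc {n : ℕ} {k : Fin n → ℕ} {l : ∀ i, Fin (k i) → ℕ} (f : (ofHom G).Op n)
    (g : ∀ i, (ofHom G).Op (k i)) (h : ∀ i j, (ofHom G).Op (l i j)) (hg : ∀ i, (g i).out = f.ins i)
    (hh : ∀ i j, (h i j).out = (g i).ins j) :
    (f.comp (fun i => (g i).comp (h i) (hh i)) hg).toArrow =
      ((f.comp g hg).comp (fun p : Fin (∑ i, k i) =>
        h (finSigmaFinEquiv.symm p).1 (finSigmaFinEquiv.symm p).2) fun p => hh _ _).toArrow := by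
  obtain ⟨df, p₁, p₂, p₃, p₄, p₅⟩ := exists_unit_val f
  choose dg q₁ q₂ q₃ q₄ q₅ using fun i => comp_eq_val (g i) (h i) (hh i)
  obtain ⟨e, r₁, r₂, r₃, r₄, r₅⟩ := comp_eq_val f (fun i => (g i).comp (h i) (hh i)) hg
  obtain ⟨dc, p₁', p₂', p₃', p₄', p₅'⟩ := comp_eq_val f g hg
  choose dh q₁' q₂' q₃' q₄' q₅' using fun p : Fin (∑ i, k i) =>
    exists_unit_val (h (finSigmaFinEquiv.symm p).1 (finSigmaFinEquiv.symm p).2)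
  obtain ⟨e', r₁', r₂', r₃', r₄', r₅'⟩ := comp_eq_val (f.comp g hg) (fun p : Fin (∑ i, k i) =>
        h (finSigmaFinEquiv.symm p).1 (finSigmaFinEquiv.symm p).2) fun p => hh _ _
  let I : ℕ → Type _ := fun m => {d : (ofHom G).Diagram m // d.Plain}
  obtain ⟨c, s₁, s₂, s₃, s₄, s₅⟩ := exists_mul_plain
    (T.twoLevel (X := I) ⟨df, p₄⟩ fun i => ⟨dg i, q₄ i⟩) (fun _ d => d.1) (fun _ d => d.2) e
    (by rw [r₁, T.map_twoLevel, p₅]; simp only [q₅]) r₄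
  obtain ⟨c', s₁', s₂', s₃', s₄', s₅'⟩ := exists_mul_plain
    (T.twoLevel (X := I) ⟨dc, p₄'⟩ fun i => ⟨dh i, q₄' i⟩) (fun _ d => d.1) (fun _ d => d.2) e'
    (by rw [r₁', T.map_twoLevel, p₅']; simp only [q₅']) r₄'
  rw [← r₅, ← r₅', ← s₅, ← s₅']
  refine val_congr c c' ?_ ((s₃.trans r₃).trans (s₃'.trans r₃').symm) s₄ s₄'
  rw [s₁, s₁', T.map_twoLevel, T.map_twoLevel, p₁, p₁']
  simp only [q₁, q₁']
  rw [T.mul_twoLevel_unit]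
  exact (T.mul_twoLevel_twoLevel f g h).symm

/-- Identities are values at trivial trees; substituting these above `f` leaves its one-vertex tree.
-/
theorem op_comp_ident {n : ℕ} (f : (ofHom G).Op n) :
    (f.comp (fun i => Op.ident (f.ins i)) fun _ => rfl).toArrow = f.toArrow := by
  obtain ⟨df, p₁, p₂, p₃, p₄, p₅⟩ := exists_unit_val f
  choose dg q₁ q₂ q₃ q₄ q₅ using fun i => ident_eq_val (G := G) (f.ins i)
  obtain ⟨e, r₁, r₂, r₃, r₄, r₅⟩ := comp_eq_val f (fun i => Op.ident (f.ins i)) fun _ => rfl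
  let I : ℕ → Type _ := fun m => {d : (ofHom G).Diagram m // d.Plain}
  obtain ⟨c, s₁, s₂, s₃, s₄, s₅⟩ := exists_mul_plain
    (T.twoLevel (X := I) ⟨df, p₄⟩ fun i => ⟨dg i, q₄ i⟩) (fun _ d => d.1) (fun _ d => d.2) e
    (by rw [r₁, T.map_twoLevel, p₅]; simp only [q₅]) r₄
  rw [← r₅, ← s₅]
  refine (val_congr c df ?_ ((s₃.trans r₃).trans p₃.symm) s₄ p₄).trans (congrArg Op.toArrow p₅)
  rw [s₁, T.map_twoLevel, p₁]
  simp only [q₁]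
  rw [T.mul_twoLevel_unit]
  rfl

theorem op_ident_comp {n : ℕ} (f : (ofHom G).Op n) (a : A) (h) :
    ((Op.ident a).comp (fun _ : Fin 1 => f) h).toArrow = f.toArrow := by
  obtain ⟨df, p₁, p₂, p₃, p₄, p₅⟩ := exists_unit_val f
  obtain ⟨dg, q₁, q₂, q₃, q₄, q₅⟩ := ident_eq_val (G := G) a
  obtain ⟨e, r₁, r₂, r₃, r₄, r₅⟩ := comp_eq_val (Op.ident a : (ofHom G).Op 1)
    (fun _ : Fin 1 => f) h
  let I : ℕ → Type _ := fun m => {d : (ofHom G).Diagram m // d.Plain}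
  obtain ⟨c, s₁, s₂, s₃, s₄, s₅⟩ := exists_mul_plain
    (T.twoLevel (X := I) ⟨dg, q₄⟩ fun _ => ⟨df, p₄⟩) (fun _ d => d.1) (fun _ d => d.2) e
    (by rw [r₁, T.map_twoLevel, p₅, q₅]) r₄
  rw [← r₅, ← s₅]
  have ho : f.out = a := h (0 : Fin 1)
  refine (val_congr c df ?_ ((s₃.trans r₃).trans (ho.symm.trans p₃.symm)) s₄ p₄).trans
    (congrArg Op.toArrow p₅)
  rw [s₁, T.map_twoLevel, q₁]
  simp only [p₁]
  exact T.mul_twoLevel_trivial f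

variable (G)

/-- The relaxed multicategory given by a map to `Set`. -/
def _root_.Relaxed.RelaxedMulticategory.ofHom : RelaxedMulticategory.{u, w} 𝒯 where
  toRelaxedData := RelaxedData.ofHom G
  act_id {n τ as a} f := by
    have e := (Op.act_hom f (StrucCat.homId τ)).symm.trans
      (op_act_id (G := G) ⟨τ, as, a, f⟩ (𝒯.tgt_id _))
    exact eq_of_heq (Sigma.mk.inj (congrArg (fun y => Op.pt y) e)).2
  act_comp {n τ'' τ' τ as a} φ φ' f := by
    have e := op_act_act (G := G) ⟨τ, as, a, f⟩ φ.1 φ'.1 φ.2.2 (φ'.2.2.trans φ.2.1.symm)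
      (φ'.2.2.trans φ.2.1.symm) ((𝒯.tgt_comp _ _ _).trans φ.2.2)
    have e' := (Op.act_hom f (StrucCat.homComp φ φ')).symm.trans
      (e.symm.trans ((Op.act_congr (Op.act_hom f φ) rfl _ φ'.2.2).trans (Op.act_hom _ φ')))
    exact eq_of_heq (Sigma.mk.inj (congrArg (fun y => Op.pt y) e')).2
  assoc {n k l τ σ ρ cs bs as a} h g f :=
    op_assoc (G := G) ⟨τ, as, a, f⟩ (fun i => ⟨σ i, bs i, as i, g i⟩)
      (fun i j => ⟨ρ i j, cs i j, bs i j, h i j⟩) (fun _ => rfl) (fun _ _ => rfl)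
  comp_ident {n τ as a} f := op_comp_ident (G := G) ⟨τ, as, a, f⟩
  ident_comp {n τ as a} f := op_ident_comp (G := G) ⟨τ, as, a, f⟩ a (fun _ => rfl)
  act_substHom {n k τ' τ σ' σ bs as a} φ ψ g f := by
    obtain ⟨φ, rfl, rfl⟩ := φ
    obtain ⟨ψ, h₁, h₂, rfl⟩ : ∃ (ψ' : ∀ i, 𝒯.Arr (k i)) (h₁ : ∀ i, 𝒯.src (ψ' i) = σ' i)
      (h₂ : ∀ i, 𝒯.tgt (ψ' i) = σ i), ψ = fun i => ⟨ψ' i, h₁ i, h₂ i⟩ :=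
      ⟨fun i => (ψ i).1, fun i => (ψ i).2.1, fun i => (ψ i).2.2, rfl⟩
    obtain rfl : (fun i => 𝒯.src (ψ i)) = σ' := funext h₁
    obtain rfl : (fun i => 𝒯.tgt (ψ i)) = σ := funext h₂
    let φ' : 𝒯.Hom _ _ := ⟨φ, rfl, rfl⟩
    let ψ' : ∀ i, 𝒯.Hom (𝒯.src (ψ i)) (𝒯.tgt (ψ i)) := fun i => ⟨ψ i, rfl, rfl⟩
    have e := op_act_comp (G := G) ⟨𝒯.tgt φ, as, a, f⟩ (fun i => ⟨𝒯.tgt (ψ i), bs i, as i, g i⟩)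
      (fun _ => rfl) φ ψ rfl (fun _ => rfl) (StrucCat.substHom φ' ψ').2.2
    have e' := (Op.act_hom ((RelaxedData.ofHom G).comp g f) (StrucCat.substHom φ' ψ')).symm.trans e
    exact eq_of_heq (Sigma.mk.inj (congrArg (fun y => Op.pt y) e')).2

end RelaxedData.Diagram

/-! ### The two passages are mutually inverse -/

namespace RelaxedData.Diagram
variable {𝒯 : StrucCat.{z, z'}} {A : Type w}
  {G : T2Multicat.Hom ((MI A).prod 𝒯.op.toMulticat) SetT2.{u}}

/-- Every tree arises by substitution from one-vertex, two-level and trivial trees, so the value of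
`G` at a plain diagram is an iterated composite of the operations already read off from `G`. -/
theorem eval_eq_val (t : Tr (ofHom G).Op) (a : A) (h : Ok t a) :
    ∃ d : (ofHom G).Diagram t.leaves, d.ops = ⟨t, rfl⟩ ∧ d.Plain ∧ d.val = (eval t a h).1 := by
  induction t generalizing a with
  | leaf =>
    obtain ⟨d, h₁, -, -, h₂, h₃⟩ := ident_eq_val (G := G) a
    exact ⟨d, h₁, h₂, h₃⟩
  | node n x c ih =>
    obtain ⟨dx, p₁, -, -, p₄, p₅⟩ := exists_unit_val x
    choose dc q₁ q₂ q₃ using fun i => ih i (x.ins i) (h.2 i)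
    obtain ⟨e, r₁, -, -, r₄, r₅⟩ := comp_eq_val x (fun i => (eval (c i) (x.ins i) (h.2 i)).1)
      fun i => (eval (c i) (x.ins i) (h.2 i)).2
    let I : ℕ → Type _ := fun m => {d : (ofHom G).Diagram m // d.Plain}
    obtain ⟨d, s₁, -, -, s₄, s₅⟩ := exists_mul_plain
      (T.twoLevel (X := I) ⟨dx, p₄⟩ fun i => ⟨dc i, q₂ i⟩) (fun _ d => d.1) (fun _ d => d.2) e
      (by rw [r₁, T.map_twoLevel, p₅]; simp only [q₃]) r₄
    refine ⟨d, s₁.trans ?_, s₄, s₅.trans r₅⟩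
    rw [T.map_twoLevel, p₁]
    simp only [q₁]
    rw [T.mul_twoLevel_unit]
    rfl

theorem evalT_eq_val {n : ℕ} (W : T (ofHom G).Op n) (a : A) (h : Ok W.1 a) :
    ∃ d : (ofHom G).Diagram n, d.ops = W ∧ d.Plain ∧ d.val = evalT W a h := by
  obtain ⟨t, rfl⟩ := W
  exact eval_eq_val t a h

/-- A general arrow is a plain diagram substituted in a one-vertex diagram carrying its arrow of
`𝒯`; so composing and then acting gives every value of `G`. -/
theorem pt_act_evalT {n : ℕ} (p : T2Multicat.ProdArr (MI A) 𝒯.op.toMulticat n)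
    (W : T (ofHom G).Op n) (h : T.map Op.idx W = p.dom) (ok : Ok W.1 p.fst.out)
    (hi : (evalT W p.fst.out ok).ins = p.fst.ins) (ho : (evalT W p.fst.out ok).out = p.fst.out)
    (k : 𝒯.tgt p.snd.arr = (evalT W p.fst.out ok).tree) :
    ((evalT W p.fst.out ok).act p.snd.arr k).pt =
      (G.arr p).ap (T.map Op.pt W) (map_pt_dom p W h) := by
  obtain ⟨d, p₁, p₂, p₃⟩ := evalT_eq_val W p.fst.out ok
  obtain ⟨e, q₁, q₂, q₃, q₄⟩ := exists_unit _ _ k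
  obtain ⟨e', k', r₁, r₂, r₃, r₄, r₅⟩ := exists_mul (T.unit d) (fun _ d => d) e
    (by rw [q₁, ← p₃]; rfl)
  have hW : e'.ops = W := r₁.trans ((T.mul_unit _).trans p₁)
  have ha : e'.arr = p.snd.arr := by
    refine r₄.trans ((𝒯.comp_congr (g' := 𝒯.id (𝒯.tgt e.arr)) ?_ rfl _
      (𝒯.src_id _).symm).trans ((𝒯.id_comp _ _).trans q₄))
    rw [q₄]
    exact (𝒯.actArr_unit _).trans (p₂.arr_eq.trans (by rw [p₃, k]))
  have he : e'.prodArr = p := by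
    refine T2Multicat.ProdArr.ext ?_ (MIArr.ext ?_ (r₂.trans (q₂.trans hi)) (r₃.trans (q₃.trans ho)))
      (StrucCat.MultiArr.ext ?_ ha)
    · exact (congrArg (fun t => T.map Op.idx t) hW).trans h
    · refine Eq.trans ?_ (p.dom_fst)
      refine Eq.trans ?_ (congrArg (fun t => T.map (fun _ x => x.1) t) h)
      refine Eq.trans ?_ (T.map_map _ _ W).symm
      exact congrArg (fun t => T.map Op.bd t) hW
    · refine Eq.trans ?_ (p.dom_snd)
      refine Eq.trans ?_ (congrArg (fun t => T.map (fun _ x => x.2) t) h)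
      refine Eq.trans ?_ (T.map_map _ _ W).symm
      exact congrArg (fun t => T.map (fun _ x => x.tree) t) hW
  refine (congrArg (fun y => Op.pt y) ((act_eq_val _ _ k e q₁ q₂ q₃ q₄).trans r₅.symm)).trans
    ((pt_val e').trans ?_)
  exact SetArr.ap_congr (congrArg (fun p => G.arr p) he) (congrArg (fun t => T.map Op.pt t) hW) _ _

end RelaxedData.Diagram

namespace RelaxedMulticategory
open RelaxedData
variable {𝒯 : StrucCat.{z, z'}} {A : Type w}
  (G : T2Multicat.Hom ((MI A).prod 𝒯.op.toMulticat) SetT2.{u})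

theorem toHom_ofHom : (RelaxedMulticategory.ofHom G).toHom = G := by
  let R := RelaxedMulticategory.ofHom G
  refine T2Multicat.Hom.ext rfl ?_
  funext n p
  refine SetArr.ext_ap (G.dom_arr p).symm (G.cod_arr p).symm fun x h h' => ?_
  obtain ⟨W, w₁, rfl⟩ := exists_ops (C := R.toRelaxedData) p.dom x h
  refine (R.ap_setArr p W w₁ h).trans ?_
  exact RelaxedData.Diagram.pt_act_evalT p W w₁ _ (R.exists_ok_prodArr p W (R.bd_of_idx w₁)).2
    (R.out_evalT _ _ _) _

theorem toRelaxedData_injective :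
    Function.Injective (toRelaxedData : RelaxedMulticategory.{u, w} 𝒯 → RelaxedData.{u, w} 𝒯) := by
  intro R R' h
  cases R
  cases R'
  dsimp only at h
  subst h
  rfl

theorem ofHom_toHom (R : RelaxedMulticategory.{u, w} 𝒯) : ofHom R.toHom = R :=
  toRelaxedData_injective R.relaxedData_toHom

end RelaxedMulticategory

/-! ### From enriched multicategories to maps to `Set` -/

namespace EnrichedPlain
variable {𝒯 : StrucCat.{z, z'}} {E : T2Multicat.{v, v'}}

theorem relaxedData_comp_prodMap (ev : T2Multicat.Hom (E.prod 𝒯.op.toMulticat) SetT2.{u})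
    (C : EnrichedPlain.{v, v', w} E) :
    (tautological C.C₀).relaxedData (ev.comp (T2Multicat.prodMap C.hom 𝒯.op.toMulticat)) =
      C.relaxedData ev := by
  refine RelaxedData.ext_ops (C.relaxedData ev) _ _ _ ?_ ?_ ?_
  · intro n τ' τ as a φ f
    -- The action is defined through identities of `E`, so it agrees only because `C.hom` preserves
    -- identities; composition and identities agree by definition.
    have e : (T2Multicat.prodMap C.hom 𝒯.op.toMulticat).arr (n := n)
      { dom := T.unit ((as, a), τ)
        fst := (MI C.C₀).id (as, a)
        snd := ⟨T.unit τ, φ.1, φ.2.2.trans (𝒯.act_unit τ).symm⟩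
        dom_fst := ((MI C.C₀).dom_id _).symm
        dom_snd := rfl } =
      { dom := T.unit (C.hom.obj (as, a), τ)
        fst := E.id (C.hom.obj (as, a))
        snd := ⟨T.unit τ, φ.1, φ.2.2.trans (𝒯.act_unit τ).symm⟩
        dom_fst := (E.dom_id _).symm
        dom_snd := rfl } := T2Multicat.ProdArr.ext rfl (C.hom.arr_id _) rfl
    refine eq_of_heq (Sigma.mk.inj ((SetArr.toFun_ap (n := n) _ (ev.dom_arr _) _ _).trans (Eq.trans ?_
      (SetArr.toFun_ap (ev.arr _) (ev.dom_arr _) _ _).symm))).2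
    exact SetArr.ap_congr (congrArg (fun p => ev.arr p) e) rfl _ _
  · intro n k τ σ bs as a g f
    rfl
  · intro a
    rfl

end EnrichedPlain

namespace RelaxedMulticategory
variable {𝒯 : StrucCat.{z, z'}}

theorem ofHom_injective {A : Type w} : Function.Injective
    (ofHom : T2Multicat.Hom ((MI A).prod 𝒯.op.toMulticat) SetT2.{u} → RelaxedMulticategory 𝒯) := by
  intro G G' h
  -- The left inverse `toHom` has a type depending on the set of objects, hence the heterogeneous
  -- equality; the object sets here are both `A`.
  have e := congr_arg_heq (fun R : RelaxedMulticategory.{u, w} 𝒯 => R.toHom) h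
  exact (toHom_ofHom G).symm.trans ((eq_of_heq e).trans (toHom_ofHom G'))

end RelaxedMulticategory

end Relaxed

/-! ### The theorem -/

theorem mainTheorem2 :
    (∃ (E : T2Multicat.{u + 1, u + 1})
        (ev : T2Multicat.Hom (E.prod TR.op.toMulticat) SetT2.{u}), IsExponential E ev) ∧
    ∀ (E : T2Multicat.{u + 1, u + 1})
      (ev : T2Multicat.Hom (E.prod TR.op.toMulticat) SetT2.{u}), IsExponential E ev →
      ∃ e : EnrichedPlain.{u + 1, u + 1, w} E ≃ RelaxedMulticategory.{u, w} TR,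
        ∀ C, (e C).toRelaxedData = C.relaxedData ev := by
  refine ⟨⟨TR.op.exp SetT2, StrucCat.expEval _ _, T2Multicat.isExponential_expEval _ _⟩,
    fun E ev hE => ?_⟩
  -- Untranspose `C.hom`, then read off the relaxed multicategory. Its data are those of
  -- `C.relaxedData ev` by `relaxedData_comp_prodMap`.
  let F : EnrichedPlain.{u + 1, u + 1, w} E → RelaxedMulticategory.{u, w} TR := fun C =>
    RelaxedMulticategory.ofHom (ev.comp (T2Multicat.prodMap C.hom TR.op.toMulticat))
  refine ⟨Equiv.ofBijective F ⟨?_, ?_⟩, fun C => C.relaxedData_comp_prodMap ev⟩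
  · rintro ⟨A, H⟩ ⟨A', H'⟩ h
    -- Once the object sets are identified, both enriched structures are maps out of the same `MI
    -- A`, and injectivity of transposition applies.
    obtain rfl : A = A' := congrArg (fun R => R.C₀) h
    obtain rfl : H = H' :=
      (hE.bijective (MI A)).1 (RelaxedMulticategory.ofHom_injective h)
    rfl
  · intro R
    obtain ⟨H, hH⟩ := (hE.bijective (MI R.C₀)).2 R.toHom
    exact ⟨⟨R.C₀, H⟩, (congrArg RelaxedMulticategory.ofHom hH).trans R.ofHom_toHom⟩
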